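/- Let $F$ be a local field, i.e. a locally compact field with respect to a non-trivial absolute value. Let $\mu$ be a Haar measure on $(F,+)$ and let $\|t\|$ be the module of $t\in F$, so $\mu(tS)=\|t\|\mu(S)$. Let $B=F^\times$ with the Haar measure $d_Bx=d\mu(x)/\|x\|$, and let $\hat B$ be its Pontryagin dual, written additively, with the dual Haar measure, i.e. the one normalised by $\int_{\hat B}\alpha(x)\,d\alpha=\delta_B(x)$. Put $A=\hat B\times B$, which is self-dual through the Fourier kernel $\langle(\alpha,x);(\beta,y)\rangle=\alpha(y)\beta(x)$. Let $\mathsf C=\mathbb R\times F^\times$ be the abelian group of angles $a=(\dot a,\ddot a)$, written additively, $a+b=(\dot a+\dot b,\ddot a\ddot b)$. For $a,c\in\mathsf C$ let $b=(1,-1)-a-c$, say that $(a,c)$ is *positive* if $\dot a,\dot b,\dot c\ge 0$, and put $$\Psi_{a,c}(\alpha,x)=\frac{1}{\alpha\big((1-\ddot a x)\ddot c\big)}\,\frac{\|\ddot a x\|^{\dot c}}{\|1-\ddot a x\|^{1-\dot a}}\qquad(\alpha\in\hat B,\ x\in B\setminus\{\ddot a^{-1}\}).$$ **Theorem.** Let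 $a_i,c_i\in\mathsf C$ $(0\le i\le 4)$ with $(a_i,c_i)$ positive for all $i$, and put $\Psi_i=\Psi_{a_i,c_i}$. If $$a_3=a_2+a_4,\quad c_3=a_0+c_4,\quad c_1=c_0+a_4,\quad a_1=a_0+a_2,\quad c_2=c_1+c_3,$$ then, as tempered distributions in $((\alpha,x),(\beta,y))\in A^2$, $$\Psi_1(\alpha,x)\Psi_3(\beta,y)=\int_{\hat B\times B}\Psi_0(\alpha-\gamma,x/z)\,\Psi_2(\gamma,z)\,\Psi_4(\beta-\gamma,y/z)\,\frac{\alpha(y/z)\,\beta(x/z)}{\gamma(xy/z^2)}\,d(\gamma,z).$$ Here the equality means the following. Let $\Phi$ be any Schwartz–Bruhat function on $A^2$. Both sides are paired with $\Phi$ by integrating first over the variables in $\hat B$ and then over those in $B$, and the integral over $\gamma$ is improper. That is, the left hand side gives $$I=\int_{B^2}\Big(\int_{\hat B^2}\Psi_1(\alpha,x)\Psi_3(\beta,y)\,\Phi\big((\alpha,x),(\beta,y)\big)\,d(\alpha,\beta)\Big)d(x,y).$$ For the right hand side let $(\rho_n)$ be any sequence of continuous, compactly supported functions $\rho_n\ge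 0$ on $B$ with $\int_B\rho_n=1$ and integrable Fourier transforms $\hat\rho_n(\gamma)=\int_B\rho_n(x)\gamma(x)^{-1}d_Bx$, such that every neighbourhood of $1$ contains the support of $\rho_n$ for all large $n$; let $J_n$ be the integral over $(\alpha,\beta,\gamma)\in\hat B^3$, followed by the integral over $(x,y,z)\in B^3$, of the integrand on the right hand side times $\hat\rho_n(\gamma)\,\Phi\big((\alpha,x),(\beta,y)\big)$. Then in $I$ and in all $J_n$ the inner integrals converge absolutely for almost every value of the outer variables, the outer integrals converge absolutely, and $\lim_{n\to\infty}J_n=I$. -/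

import Mathlib

open MeasureTheory Filter Topology
open scoped Pointwise

namespace LocalPentagon

noncomputable section

/-! ### Haar measures on `F^×` and on its Pontryagin dual -/

section LocalField

variable {F : Type*} [NontriviallyNormedField F] [LocallyCompactSpace F]

open Classical in
/-- The module `‖t‖` of an element of a locally compact field: the factor by which multiplication
by `t` scales every additive Haar measure, `μ (t • s) = ‖t‖ * μ s`, with value `0` at `t = 0`.
It is `|t|` on the reals and `|t|²` on the complex numbers; it is not the norm of the
`NontriviallyNormedField` structure, which is only used for the topology of `F`. -/
def modulus (t : F) : ℝ :=
  if h : t = 0 then 0 else (distribHaarChar F (Units.mk0 t h) : ℝ)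

/-- The multiplicative Haar measure `d_B x = d_F x / ‖x‖` on `B = F^×`. -/
def unitsHaar [MeasurableSpace F] (μ : Measure F) : Measure Fˣ :=
  (μ.withDensity fun t => ENNReal.ofReal (modulus t)⁻¹).comap Units.val

end LocalField

section Dual

variable {G : Type*} [CommGroup G] [TopologicalSpace G] [IsTopologicalGroup G] [MeasurableSpace G]

/-- The Fourier transform `f̂(χ) = ∫ f(x) χ(x)⁻¹ dx` of a function on an abelian group. -/
def fourierTransform (m : Measure G) (f : G → ℂ) (χ : PontryaginDual G) : ℂ :=
  ∫ x, f x * (χ x : ℂ)⁻¹ ∂m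

/-- The measure `ν` on the dual group is normalised so that `∫ χ(x) dν(χ) = δ(x)`, the Dirac delta
at the unit of `G` with respect to the measure `m`, as an integral of distributions: integrating
`χ(x)⁻¹` first against a function `f` on `G` and then over the dual group gives `f(1)`. A Haar
measure on the dual with this normalisation is called the dual Haar measure of `m`. -/
def IsDualNormalized [MeasurableSpace (PontryaginDual G)]
    (m : Measure G) (ν : Measure (PontryaginDual G)) : Prop :=
  ∀ f : G → ℂ, Continuous f → Integrable f m → Integrable (fourierTransform m f) ν →
    ∫ χ, fourierTransform m f χ ∂ν = f 1

/-- A sequence of probability densities `ρ n` on `G` that converges to the Dirac delta at the unit: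
continuous, compactly supported functions with integrable Fourier transform, whose supports
shrink to `{1}`. Their Fourier transforms are bounded by `1` and tend to `1` pointwise, so they are
convergence factors for improper integrals over the dual group. -/
structure IsDeltaSequence [MeasurableSpace (PontryaginDual G)]
    (m : Measure G) (ν : Measure (PontryaginDual G)) (ρ : ℕ → G → ℝ) : Prop where
  continuous : ∀ n, Continuous (ρ n)
  hasCompactSupport : ∀ n, HasCompactSupport (ρ n)
  nonneg : ∀ n x, 0 ≤ ρ n x
  integral_eq_one : ∀ n, ∫ x, ρ n x ∂m = 1
  integrable_fourier : ∀ n, Integrable (fourierTransform m fun x => (ρ n x : ℂ)) ν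
  support_shrinks : ∀ U ∈ 𝓝 (1 : G), ∀ᶠ n in atTop, Function.support (ρ n) ⊆ U

end Dual

/-! ### Test functions -/

/-- Rapid decrease on a locally compact abelian group: for some compact set `C`, the values of `f`
outside of the `k`-fold product set `C ^ k` are `O(k ^ (-n))` for every `n`. -/
def RapidlyDecreasing {G : Type*} [CommGroup G] [TopologicalSpace G] (f : G → ℂ) : Prop :=
  ∃ C : Set G, IsCompact C ∧ ∀ n : ℕ, ∃ M : ℝ, ∀ k : ℕ, ∀ g : G, g ∉ C ^ k →
    (k : ℝ) ^ n * ‖f g‖ ≤ M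

section Gaussian

variable (F : Type*) [NontriviallyNormedField F]

/-- The self-dual group `A = B̂ × B`, where `B = F^×` and `B̂` is its Pontryagin dual. Both factors
are written multiplicatively, so that `α - γ` becomes `α / γ`. -/
abbrev GaussianGroup : Type _ := PontryaginDual Fˣ × Fˣ

variable {F}

/-- The Fourier kernel `⟨(α, x); (β, y)⟩ = α(y) β(x)` of `A`. -/
def fourierKernel (p q : GaussianGroup F) : ℂ := (p.1 q.2 : ℂ) * (q.1 p.2 : ℂ)

variable [MeasurableSpace F] [MeasurableSpace (PontryaginDual Fˣ)]

/-- The Fourier transform on `A × A`, which is a function on `A × A` by means of the Fourier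
kernel. The measure on `A` is the product of `ν` on `B̂` and `m` on `B`. -/
def fourierA₂ (m : Measure Fˣ) (ν : Measure (PontryaginDual Fˣ))
    (Φ : GaussianGroup F × GaussianGroup F → ℂ) (q : GaussianGroup F × GaussianGroup F) : ℂ :=
  ∫ p, Φ p * (fourierKernel p.1 q.1 * fourierKernel p.2 q.2)⁻¹ ∂((ν.prod m).prod (ν.prod m))

/-- The Schwartz-Bruhat space of `A × A`, in Osborne's description (valid on every locally compact
abelian group): the continuous functions that are rapidly decreasing together with their Fourier
transform. -/
structure IsSchwartzBruhat (m : Measure Fˣ) (ν : Measure (PontryaginDual Fˣ))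
    (Φ : GaussianGroup F × GaussianGroup F → ℂ) : Prop where
  continuous : Continuous Φ
  rapidlyDecreasing : RapidlyDecreasing Φ
  rapidlyDecreasing_fourier : RapidlyDecreasing (fourierA₂ m ν Φ)

end Gaussian

/-- The value `I` of `∫ f`, where the integral over the variables `χ` in (powers of) the dual group
is taken before the integral over the variables `x` in (powers of) the group, and both of these
integrals converge absolutely. -/
structure HasDualFirstIntegral {X Y : Type*} [MeasurableSpace X] [MeasurableSpace Y]
    (κ : Measure X) (m : Measure Y) (f : X → Y → ℂ) (I : ℂ) : Prop where
  integrable_inner : ∀ᵐ x ∂m, Integrable (fun χ => f χ x) κ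
  integrable_outer : Integrable (fun x => ∫ χ, f χ x ∂κ) m
  integral_eq : ∫ x, ∫ χ, f χ x ∂κ ∂m = I

/-! ### Angles and the angled quantum dilogarithm -/

section Angles

variable (F : Type*) [NontriviallyNormedField F]

/-- The abelian group of angles `C = ℝ × F^×`; its group law, written as `+`, adds the real
components and multiplies the components in `F^×`. -/
abbrev Angle : Type _ := ℝ × Additive Fˣ

variable {F}

/-- The real component of an angle. -/
def Angle.re (a : Angle F) : ℝ := a.1

/-- The component of an angle in `F^×`. -/
def Angle.unit (a : Angle F) : Fˣ := a.2.toMul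

/-- The angle `ϖ = (1, -1)`. -/
def Angle.varpi : Angle F := (1, Additive.ofMul (-1))

/-- The third angle `b` of a triangle with angles `a`, `c`, so that `a + b + c = ϖ`. -/
def Angle.third (a c : Angle F) : Angle F := Angle.varpi - a - c

/-- The positivity condition on the angles `a`, `b`, `c` of a triangle. -/
def Angle.Positive (a c : Angle F) : Prop :=
  0 ≤ Angle.re a ∧ 0 ≤ Angle.re (Angle.third a c) ∧ 0 ≤ Angle.re c

open Classical in
/-- The value of a character of `F^×` at a non-zero element of `F`, with value `0` at `0`. -/
def charValue (α : PontryaginDual Fˣ) (t : F) : ℂ :=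
  if h : t = 0 then 0 else (α (Units.mk0 t h) : ℂ)

/-- The angled quantum dilogarithm
`Ψ_{a,c}(α, x) = α((1 - a'' x) c'')⁻¹ ‖a'' x‖ ^ c' / ‖1 - a'' x‖ ^ (1 - a')`
for angles `a = (a', a'')`, `c = (c', c'')` and `x ≠ 1 / a''`. The value given at the remaining
point `x = 1 / a''`, a null set, is `0`. -/
def Psi [LocallyCompactSpace F] (a c : Angle F) (p : GaussianGroup F) : ℂ :=
  (charValue p.1 ((1 - Angle.unit a * p.2) * Angle.unit c))⁻¹ *
    ((modulus (Angle.unit a * p.2 : F) ^ Angle.re c /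
      modulus (1 - Angle.unit a * p.2 : F) ^ (1 - Angle.re a) : ℝ) : ℂ)

/-- The integrand
`Ψ₀(α - γ, x/z) Ψ₂(γ, z) Ψ₄(β - γ, y/z) α(y/z) β(x/z) / γ(xy/z²)`
of the pentagon relation. -/
def pentagonIntegrand [LocallyCompactSpace F] (a c : Fin 5 → Angle F)
    (α β γ : PontryaginDual Fˣ) (x y z : Fˣ) : ℂ :=
  Psi (a 0) (c 0) (α / γ, x / z) * Psi (a 2) (c 2) (γ, z) * Psi (a 4) (c 4) (β / γ, y / z) *
    ((α (y / z) : ℂ) * (β (x / z) : ℂ) / (γ (x * y / z ^ 2) : ℂ))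

end Angles

/-! ### The two sides of the pentagon relation as distributions on `A × A` -/

section Distributions

variable {F : Type*} [NontriviallyNormedField F] [LocallyCompactSpace F] [MeasurableSpace F]
  [MeasurableSpace (PontryaginDual Fˣ)]

/-- The distribution `Ψ₁(α, x) Ψ₃(β, y)` is defined on the test function `Φ` and has value `I`. -/
def PentagonLeft (m : Measure Fˣ) (ν : Measure (PontryaginDual Fˣ)) (a c : Fin 5 → Angle F)
    (Φ : GaussianGroup F × GaussianGroup F → ℂ) (I : ℂ) : Prop :=
  HasDualFirstIntegral (ν.prod ν) (m.prod m)
    (fun χ u => Psi (a 1) (c 1) (χ.1, u.1) * Psi (a 3) (c 3) (χ.2, u.2) *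
      Φ ((χ.1, u.1), (χ.2, u.2))) I

/-- The distribution
`∫ Ψ₀(α - γ, x/z) Ψ₂(γ, z) Ψ₄(β - γ, y/z) α(y/z) β(x/z) / γ(xy/z²) d(γ, z)`
is defined on the test function `Φ` and has value `I`. The integral over `γ` is improper: it is the
limit, for every sequence `ρ n` tending to the Dirac delta, of the integrals with the convergence
factors `ρ̂ n (γ)`. The integration variables are `α, β, γ` and `x, y, z`. -/
def PentagonRight (m : Measure Fˣ) (ν : Measure (PontryaginDual Fˣ)) (a c : Fin 5 → Angle F)
    (Φ : GaussianGroup F × GaussianGroup F → ℂ) (I : ℂ) : Prop :=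
  ∀ ρ : ℕ → Fˣ → ℝ, IsDeltaSequence m ν ρ → ∃ J : ℕ → ℂ,
    (∀ n, HasDualFirstIntegral (ν.prod (ν.prod ν)) (m.prod (m.prod m))
      (fun χ u => pentagonIntegrand a c χ.1 χ.2.1 χ.2.2 u.1 u.2.1 u.2.2 *
        fourierTransform m (fun x => (ρ n x : ℂ)) χ.2.2 *
        Φ ((χ.1, u.1), (χ.2.1, u.2.1))) (J n)) ∧
    Tendsto J atTop (𝓝 I)

end Distributions

end

end LocalPentagon

/-! For fixed `x, y, z` every factor `Psi` is a nonnegative weight times a single character value,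
so the integrals over the dual variables can be computed exactly. On the left they give the partial
Fourier transform `dualTransform` of `Φ`. On the right the integrals over `α` and `β` give the same
transform at other arguments, and Fourier inversion in `γ` turns the convergence factor into the
value of `ρ n` at a point `g` (`left_inner`, `right_inner`). Only integrals over powers of `F^×`
remain.

On the right, substitute `a₂ z = 1 - r`, `a₀ x / z = 1 / (1 + s)`, `a₄ y / z = 1 / (1 + t)` with `s
t = g r`; the integrand becomes `ρ n g` times `core` at `(g, r, s)`. On the left, substitute `a₁ x =
(1 - r) / (1 + s)`, `a₃ y = (1 - r) / (1 + t)` with `s t = r`; the integrand becomes `core` at `(1,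
r, s)`. The angle relations are what makes arguments and exponents agree
(`tripleDensity_mul_rightOuter`, `shiftDensity_mul_leftOuter`). The theorem is thus the convergence
of averages of `core` over `g` near `1` to its integral on the fibre `g = 1`.

This needs an integrable bound, locally uniform in `g`. The exponents at the poles `1 + s`, `1 + t`,
`1 - r` add up to one, so the weight is at most a sum of three simple poles (`coreWeight_le`). A
simple pole just fails to be integrable, but a power of its logarithm repairs this
(`exists_integrable_majorant`). The logarithms come from the rapid decrease of `dualTransform` in
all four variables (`IsSchwartzBruhat.exists_dualTransform_bound`), because its arguments control
`s`, `t` and the ratios of `1 + s` and `1 + t` to `1 - r` (`mul_poles_le_of_decay`). The poles in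
`s` and `r` are dominated in the coordinates `(g, r, s)`, the pole in `t` in the coordinates `(g, r,
t)`: `poleShare` splits `core`, and the measure preserving `factorSwap` passes between the
coordinates. `IsDeltaSequence.tendsto_integral` applies to both parts. -/

set_option linter.unusedSectionVars false

namespace LocalPentagon

noncomputable section

/-! ### Rapid decrease and polynomial growth -/

section Growth

variable {G H : Type*} [CommGroup G] [CommGroup H]

open Classical in
/-- The number `1 / (k + 1)` for the least `k` with `g ∈ C ^ k`, and `0` if there is none. -/
def proximity (C : Set G) (g : G) : ℝ :=
  if h : ∃ k, g ∈ C ^ k then ((Nat.find h : ℝ) + 1)⁻¹ else 0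

lemma proximity_nonneg (C : Set G) (g : G) : 0 ≤ proximity C g := by
  unfold proximity
  split_ifs <;> positivity

lemma le_proximity {C : Set G} {g : G} {k : ℕ} (h : g ∈ C ^ k) :
    ((k : ℝ) + 1)⁻¹ ≤ proximity C g := by
  classical
  have h' : ∃ k, g ∈ C ^ k := ⟨k, h⟩
  rw [proximity, dif_pos h']
  have : Nat.find h' ≤ k := Nat.find_min' h' h
  gcongr

/-- Homomorphisms do not increase word length. Applied to coordinate projections, this separates
decay in several variables. -/
lemma proximity_le_map (f : G →* H) (C : Set G) (g : G) :
    proximity C g ≤ proximity (f '' C) (f g) := by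
  classical
  by_cases h : ∃ k, g ∈ C ^ k
  · have h' : f g ∈ (f '' C) ^ Nat.find h := by
      rw [← Set.image_pow]
      exact Set.mem_image_of_mem f (Nat.find_spec h)
    refine le_trans ?_ (le_proximity h')
    rw [proximity, dif_pos h]
  · rw [proximity, dif_neg h]
    exact proximity_nonneg _ _

/-- Testing rapid decrease one step below the word length of `g` turns it into a bound by powers of
`proximity`, valid at every point. -/
lemma RapidlyDecreasing.exists_proximity_bound [TopologicalSpace G] {f : G → ℂ}
    (hf : RapidlyDecreasing f) :
    ∃ C : Set G, IsCompact C ∧ ∀ n : ℕ, ∃ M : ℝ, 0 ≤ M ∧ ∀ g, ‖f g‖ ≤ M * proximity C g ^ n := by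
  classical
  obtain ⟨C, hC, h⟩ := hf
  refine ⟨C, hC, fun n => ?_⟩
  obtain ⟨M₀, hM₀⟩ := h 0
  obtain ⟨M₁, hM₁⟩ := h 1
  obtain ⟨M, hM⟩ := h n
  -- Since `C ^ 0 = {1}`, the case `n = k = 0` of rapid decrease bounds `f` away from the unit.
  have hbd : ∀ g, ‖f g‖ ≤ |M₀| + ‖f 1‖ := fun g => by
    by_cases hg : g = 1
    · rw [hg]
      linarith [abs_nonneg M₀]
    · have := hM₀ 0 g (by simpa using hg)
      simp only [pow_zero, one_mul] at this
      linarith [le_abs_self M₀, norm_nonneg (f 1)]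
  refine ⟨(|M₀| + ‖f 1‖) * 2 ^ n + |M| * 3 ^ n, by positivity, fun g => ?_⟩
  by_cases hg : ∃ k, g ∈ C ^ k
  · rw [proximity, dif_pos hg]
    set N := Nat.find hg with hN
    rcases le_or_gt N 1 with h1 | h1
    · have h2 : (2 : ℝ)⁻¹ ≤ ((N : ℝ) + 1)⁻¹ := by
        have : (N : ℝ) ≤ 1 := by exact_mod_cast h1
        gcongr
        linarith
      calc ‖f g‖ ≤ |M₀| + ‖f 1‖ := hbd g
        _ = (|M₀| + ‖f 1‖) * 2 ^ n * (2 : ℝ)⁻¹ ^ n := by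
          rw [mul_assoc, ← mul_pow]; norm_num
        _ ≤ ((|M₀| + ‖f 1‖) * 2 ^ n + |M| * 3 ^ n) * ((N : ℝ) + 1)⁻¹ ^ n := by
          gcongr
          linarith [show 0 ≤ |M| * 3 ^ n by positivity]
    · have h3 : g ∉ C ^ (N - 1) := Nat.find_min hg (by omega)
      have h4 := hM (N - 1) g h3
      -- The factor `3 ^ n` comes from `N + 1 ≤ 3 * (N - 1)` for `N ≥ 2`.
      have h5 : (1 : ℝ) ≤ 3 * (((N - 1 : ℕ) : ℝ) * ((N : ℝ) + 1)⁻¹) := by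
        rw [← mul_assoc, ← div_eq_mul_inv, le_div_iff₀ (by positivity)]
        have : ((N - 1 : ℕ) : ℝ) = N - 1 := by
          rw [Nat.cast_sub (by omega)]; simp
        have : (2 : ℝ) ≤ N := by exact_mod_cast h1
        linarith
      calc ‖f g‖ ≤ (3 * (((N - 1 : ℕ) : ℝ) * ((N : ℝ) + 1)⁻¹)) ^ n * ‖f g‖ :=
            le_mul_of_one_le_left (norm_nonneg _) (one_le_pow₀ h5)
        _ = 3 ^ n * ((N : ℝ) + 1)⁻¹ ^ n * (((N - 1 : ℕ) : ℝ) ^ n * ‖f g‖) := by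
          rw [mul_pow, mul_pow]; ring
        _ ≤ 3 ^ n * ((N : ℝ) + 1)⁻¹ ^ n * |M| := by
          gcongr
          exact h4.trans (le_abs_self M)
        _ = |M| * 3 ^ n * ((N : ℝ) + 1)⁻¹ ^ n := by ring
        _ ≤ _ := by
          gcongr
          linarith [show 0 ≤ (|M₀| + ‖f 1‖) * 2 ^ n by positivity]
  · have h0 : f g = 0 := by
      -- A point in no power of `C` satisfies `k * ‖f g‖ ≤ M₁` for every `k`.
      by_contra hne
      have hpos : 0 < ‖f g‖ := norm_pos_iff.mpr hne
      obtain ⟨k, hk⟩ := exists_nat_gt (M₁ / ‖f g‖)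
      have := hM₁ k g (fun hk' => hg ⟨k, hk'⟩)
      rw [div_lt_iff₀ hpos] at hk
      rw [pow_one] at this
      linarith
    rw [h0, norm_zero]
    have := proximity_nonneg C g
    positivity

lemma exists_exponents_of_mem_pow (E : Finset G) (k : ℕ) {g : G} (hg : g ∈ (E : Set G) ^ k) :
    ∃ f : E → ℕ, (∀ e, f e ≤ k) ∧ g = ∏ e : E, (e : G) ^ f e := by
  classical
  induction k generalizing g with
  | zero =>
    refine ⟨fun _ => 0, fun _ => le_rfl, ?_⟩
    simpa using hg
  | succ k ih =>
    rw [pow_succ, Set.mem_mul] at hg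
    obtain ⟨a, ha, b, hb, rfl⟩ := hg
    obtain ⟨f, hf, rfl⟩ := ih ha
    refine ⟨f + Pi.single ⟨b, hb⟩ 1, fun e => ?_, ?_⟩
    · have := hf e
      by_cases he : e = ⟨b, hb⟩
      · subst he; simpa using this
      · simp [Pi.single_eq_of_ne he]; omega
    · simp only [Pi.add_apply, pow_add, Finset.prod_mul_distrib]
      congr 1
      rw [Finset.prod_eq_single (⟨b, hb⟩ : E)]
      · simp
      · intro e _ he
        simp [Pi.single_eq_of_ne he]
      · simp

/-- By commutativity a product of `k` elements of `E` depends only on the exponents, each at most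
`k`; hence the growth is polynomial. -/
lemma exists_finset_pow_subset (E : Finset G) (k : ℕ) :
    ∃ T : Finset G, (E : Set G) ^ k ⊆ T ∧ T.card ≤ (k + 1) ^ E.card := by
  classical
  refine ⟨Finset.univ.image fun f : E → Fin (k + 1) => ∏ e : E, (e : G) ^ (f e : ℕ), ?_, ?_⟩
  · intro g hg
    obtain ⟨f, hf, rfl⟩ := exists_exponents_of_mem_pow E k hg
    simp only [Finset.coe_image, Finset.coe_univ, Set.image_univ, Set.mem_range]
    exact ⟨fun e => ⟨f e, Nat.lt_succ_of_le (hf e)⟩, rfl⟩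
  · refine Finset.card_image_le.trans ?_
    simp

variable [TopologicalSpace G] [IsTopologicalGroup G] [MeasurableSpace G] [BorelSpace G]

/-- If finitely many translates `E * D` of a compact neighbourhood `D` of the unit cover `D * D`,
then `D ^ (k + 1) ⊆ E ^ k * D`, and `E ^ k` has polynomially many elements. -/
lemma exists_measure_pow_le [LocallyCompactSpace G] (ν : Measure G) [ν.IsHaarMeasure] {C : Set G}
    (hC : IsCompact C) :
    ∃ (d : ℕ) (K : ENNReal), K ≠ ⊤ ∧ ∀ k : ℕ, ν (C ^ k) ≤ K * ((k : ENNReal) + 1) ^ d := by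
  obtain ⟨V, hV, hV1⟩ := exists_compact_mem_nhds (1 : G)
  set D := C ∪ V
  have hD : IsCompact D := hC.union hV
  have hDi : (interior D).Nonempty :=
    ⟨1, mem_interior_iff_mem_nhds.mpr (mem_of_superset hV1 Set.subset_union_right)⟩
  have h1D : (1 : G) ∈ D := Or.inr (mem_of_mem_nhds hV1)
  obtain ⟨t, ht⟩ := compact_covered_by_mul_left_translates (hD.mul hD) hDi
  classical
  set E : Finset G := t.image (·⁻¹)
  have hE : D * D ⊆ (E : Set G) * D := by
    intro g hg
    obtain ⟨a, ha⟩ := Set.mem_iUnion.mp (ht hg)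
    obtain ⟨hat, hag⟩ := Set.mem_iUnion.mp ha
    refine Set.mem_mul.mpr ⟨a⁻¹, ?_, a * g, hag, by simp⟩
    simpa [E] using hat
  have hk : ∀ k, D ^ (k + 1) ⊆ (E : Set G) ^ k * D := by
    intro k
    induction k with
    | zero => simp
    | succ k ih =>
      calc D ^ (k + 1 + 1) = D ^ (k + 1) * D := pow_succ _ _
        _ ⊆ (E : Set G) ^ k * D * D := Set.mul_subset_mul_right ih
        _ = (E : Set G) ^ k * (D * D) := mul_assoc _ _ _
        _ ⊆ (E : Set G) ^ k * ((E : Set G) * D) := Set.mul_subset_mul_left hE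
        _ = (E : Set G) ^ (k + 1) * D := by rw [pow_succ, mul_assoc]
  refine ⟨E.card, ν D, hD.measure_ne_top, fun k => ?_⟩
  obtain ⟨T, hT, hTc⟩ := exists_finset_pow_subset E k
  calc ν (C ^ k) ≤ ν (D ^ (k + 1)) := by
        refine measure_mono ((Set.pow_subset_pow_left (t := D) Set.subset_union_left).trans ?_)
        exact Set.pow_subset_pow_right h1D (Nat.le_succ k)
    _ ≤ ν (⋃ g ∈ T, g • D) := by
        refine measure_mono ((hk k).trans ?_)
        rintro _ ⟨a, ha, b, hb, rfl⟩
        exact Set.mem_biUnion (hT ha) (Set.smul_mem_smul_set hb)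
    _ ≤ ∑ g ∈ T, ν (g • D) := measure_biUnion_finset_le _ _
    _ = T.card * ν D := by simp [measure_smul]
    _ ≤ ((k : ENNReal) + 1) ^ E.card * ν D := by
        gcongr
        exact_mod_cast hTc
    _ = _ := mul_comm _ _

/-- `W` is the sum of the indicators of `C ^ k` with coefficients `(k + 1) ^ (-(e + 2))`: `e` powers
pay for the growth of the measure and two make the series converge. At a point of word length `k`
the `k`-th term alone is the required power of `proximity`. -/
lemma exists_integrable_ge_proximity_pow [LocallyCompactSpace G] [T2Space G] (ν : Measure G)
    [ν.IsHaarMeasure] {C : Set G} (hC : IsCompact C) :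
    ∃ (d : ℕ) (W : G → ℝ), Integrable W ν ∧ ∀ g, proximity C g ^ d ≤ W g := by
  classical
  obtain ⟨e, K, hK, h⟩ := exists_measure_pow_le ν hC
  have hCk : ∀ k, IsCompact (C ^ k) := fun k => by
    induction k with
    | zero => simp
    | succ k ih => rw [pow_succ]; exact ih.mul hC
  set c : ℕ → ENNReal := fun k => ENNReal.ofReal ((((k : ℝ) + 1) ^ (e + 2))⁻¹)
  set W : G → ENNReal := fun g => ∑' k, (C ^ k).indicator (fun _ => c k) g
  have hsum : Summable fun k : ℕ => (((k : ℝ) + 1) ^ 2)⁻¹ := by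
    have := (summable_nat_add_iff 1).mpr (Real.summable_nat_pow_inv.mpr (one_lt_two))
    simpa using this
  have hfin : ∑' k : ℕ, ENNReal.ofReal ((((k : ℝ) + 1) ^ 2)⁻¹) ≠ ⊤ := hsum.tsum_ofReal_ne_top
  have hc : ∀ k, c k * ((k : ENNReal) + 1) ^ e = ENNReal.ofReal ((((k : ℝ) + 1) ^ 2)⁻¹) := by
    intro k
    have : ((k : ENNReal) + 1) ^ e = ENNReal.ofReal (((k : ℝ) + 1) ^ e) := by
      rw [ENNReal.ofReal_pow (by positivity), ENNReal.ofReal_add (by positivity) zero_le_one]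
      simp
    rw [this, ← ENNReal.ofReal_mul (by positivity)]
    congr 1
    rw [pow_add]
    field_simp
  have hc1 : ∀ k, c k ≤ ENNReal.ofReal ((((k : ℝ) + 1) ^ 2)⁻¹) := fun k => by
    rw [← hc k]
    refine le_mul_of_one_le_right zero_le (one_le_pow₀ (by simp))
  have hWtop : ∀ g, W g ≠ ⊤ := fun g => by
    refine ne_top_of_le_ne_top hfin (ENNReal.tsum_le_tsum fun k => ?_)
    exact (Set.indicator_le_self _ _ g).trans (hc1 k)
  have hWm : Measurable W := Measurable.tsum fun k =>
    measurable_const.indicator (hCk k).measurableSet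
  refine ⟨e + 2, fun g => (W g).toReal, ?_, fun g => ?_⟩
  · refine integrable_toReal_of_lintegral_ne_top hWm.aemeasurable ?_
    rw [lintegral_tsum fun k => (measurable_const.indicator (hCk k).measurableSet).aemeasurable]
    refine ne_top_of_le_ne_top (ENNReal.mul_ne_top hK hfin) ?_
    rw [← ENNReal.tsum_mul_left]
    refine ENNReal.tsum_le_tsum fun k => ?_
    rw [lintegral_indicator_const (hCk k).measurableSet, ← hc k]
    calc c k * ν (C ^ k) ≤ c k * (K * ((k : ENNReal) + 1) ^ e) := by gcongr; exact h k
      _ = _ := by ring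
  · by_cases hg : ∃ k, g ∈ C ^ k
    · rw [proximity, dif_pos hg, ← ENNReal.ofReal_le_iff_le_toReal (hWtop g)]
      refine le_trans ?_ (ENNReal.le_tsum (Nat.find hg))
      rw [Set.indicator_of_mem (Nat.find_spec hg), inv_pow]
    · rw [proximity, dif_neg hg, zero_pow (by omega)]
      exact ENNReal.toReal_nonneg

end Growth

/-! ### The module of a locally compact field -/

section Modulus

variable {F : Type*} [NontriviallyNormedField F] [LocallyCompactSpace F]

instance properSpace_field : ProperSpace F := ProperSpace.of_locallyCompactSpace F

@[simp] lemma modulus_zero : modulus (0 : F) = 0 := dif_pos rfl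

lemma modulus_of_ne {t : F} (h : t ≠ 0) :
    modulus t = (distribHaarChar F (Units.mk0 t h) : ℝ) := dif_neg h

lemma modulus_coe (t : Fˣ) : modulus (t : F) = (distribHaarChar F t : ℝ) := by
  rw [modulus_of_ne t.ne_zero, Units.mk0_val]

lemma modulus_nonneg (t : F) : 0 ≤ modulus t := by
  unfold modulus
  split_ifs
  · exact le_rfl
  · exact NNReal.coe_nonneg _

lemma modulus_pos {t : F} (h : t ≠ 0) : 0 < modulus t := by
  rw [modulus_of_ne h]
  exact_mod_cast distribHaarChar_pos

lemma modulus_units_pos (t : Fˣ) : 0 < modulus (t : F) := modulus_pos t.ne_zero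

@[simp] lemma modulus_one : modulus (1 : F) = 1 := by
  have := modulus_coe (1 : Fˣ)
  simpa using this

@[simp] lemma modulus_mul (s t : F) : modulus (s * t) = modulus s * modulus t := by
  by_cases hs : s = 0
  · simp [hs]
  by_cases ht : t = 0
  · simp [ht]
  have := modulus_coe (Units.mk0 s hs * Units.mk0 t ht)
  rw [map_mul, NNReal.coe_mul, ← modulus_coe, ← modulus_coe] at this
  simpa using this

@[simp] lemma modulus_inv (t : F) : modulus t⁻¹ = (modulus t)⁻¹ := by
  by_cases ht : t = 0
  · simp [ht]
  refine eq_inv_of_mul_eq_one_left ?_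
  rw [← modulus_mul, inv_mul_cancel₀ ht, modulus_one]

@[simp] lemma modulus_div (s t : F) : modulus (s / t) = modulus s / modulus t := by
  rw [div_eq_mul_inv, modulus_mul, modulus_inv, div_eq_mul_inv]

@[simp] lemma modulus_neg (t : F) : modulus (-t) = modulus t := by
  have h : modulus (-1 : F) ^ 2 = 1 := by
    rw [sq, ← modulus_mul]
    simp
  have h1 : modulus (-1 : F) = 1 := by
    exact (pow_eq_one_iff_of_nonneg (modulus_nonneg _) two_ne_zero).mp h
  rw [← neg_one_mul, modulus_mul, h1, one_mul]

variable [MeasurableSpace F] [BorelSpace F] (μ : Measure F) [μ.IsAddHaarMeasure]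

lemma measure_units_smul (t : Fˣ) (s : Set F) :
    μ (t • s) = ENNReal.ofReal (modulus (t : F)) * μ s := by
  rw [← distribHaarChar_mul μ t s, modulus_coe, ENNReal.ofReal_coe_nnreal]

lemma measure_image_mul (t : F) {s : Set F} (hs : s.Nonempty) :
    μ ((t * ·) '' s) = ENNReal.ofReal (modulus t) * μ s := by
  by_cases ht : t = 0
  · subst ht
    obtain ⟨a, ha⟩ := hs
    have : (fun x : F => 0 * x) '' s = {0} := by
      ext x; simp only [zero_mul, Set.mem_image, Set.mem_singleton_iff]
      exact ⟨fun ⟨_, _, h⟩ => h.symm, fun h => ⟨a, ha, h.symm⟩⟩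
    rw [this]; simp
  · exact measure_units_smul μ (Units.mk0 t ht) s

-- Outer regularity gives an open set around `t₀ K` of measure less than `c * μ K`, and by
-- compactness it still contains `t K` for `t` near `t₀`.
omit [MeasurableSpace F] [BorelSpace F] in
lemma isOpen_modulus_lt (c : ℝ) : IsOpen {t : F | modulus t < c} := by
  borelize F
  let μ : Measure F := Measure.addHaar
  rw [isOpen_iff_mem_nhds]
  intro t₀ (ht₀ : modulus t₀ < c)
  obtain ⟨K, hK, hK0⟩ := exists_compact_mem_nhds (0 : F)
  have hKpos : μ K ≠ 0 := (Measure.measure_pos_of_mem_nhds μ hK0).ne'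
  have hKtop : μ K ≠ ⊤ := hK.measure_ne_top
  have hKne : K.Nonempty := ⟨0, mem_of_mem_nhds hK0⟩
  have hlt : μ ((t₀ * ·) '' K) < ENNReal.ofReal c * μ K := by
    rw [measure_image_mul μ t₀ hKne]
    refine ENNReal.mul_lt_mul_left hKpos hKtop ?_
    exact (ENNReal.ofReal_lt_ofReal_iff_of_nonneg (modulus_nonneg t₀)).mpr ht₀
  obtain ⟨U, hUK, hUo, hU⟩ := Set.exists_isOpen_lt_of_lt _ _ hlt
  have h1 : ∀ᶠ t in 𝓝 t₀, ∀ y ∈ K, t * y ∈ U := by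
    refine hK.eventually_forall_of_forall_eventually fun y hy => ?_
    exact (continuous_fst.mul continuous_snd).continuousAt.eventually
      (hUo.mem_nhds (hUK ⟨y, hy, rfl⟩))
  filter_upwards [h1] with t ht
  have h2 : ENNReal.ofReal (modulus t) * μ K < ENNReal.ofReal c * μ K := by
    rw [← measure_image_mul μ t hKne]
    refine (measure_mono ?_).trans_lt hU
    rintro _ ⟨y, hy, rfl⟩
    exact ht y hy
  exact (ENNReal.ofReal_lt_ofReal_iff_of_nonneg (modulus_nonneg t)).mp
    (lt_of_mul_lt_mul_right h2 zero_le)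

-- Away from `0`, upper semicontinuity at `t⁻¹` is lower semicontinuity at `t`; at `0` upper
-- semicontinuity suffices.
omit [MeasurableSpace F] [BorelSpace F] in
@[fun_prop]
lemma continuous_modulus : Continuous (modulus : F → ℝ) := by
  rw [continuous_iff_continuousAt]
  intro t₀
  by_cases h0 : t₀ = 0
  · subst h0
    rw [ContinuousAt, modulus_zero, Metric.tendsto_nhds]
    intro ε hε
    filter_upwards [(isOpen_modulus_lt ε).mem_nhds (show modulus (0 : F) < ε by simpa)] with t ht
    rw [Real.dist_eq, sub_zero, abs_of_nonneg (modulus_nonneg t)]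
    exact ht
  · rw [ContinuousAt, tendsto_order]
    refine ⟨fun a ha => ?_, fun a ha => (isOpen_modulus_lt a).mem_nhds ha⟩
    rcases le_or_gt a 0 with h | h
    · filter_upwards [eventually_ne_nhds h0] with t ht using h.trans_lt (modulus_pos ht)
    · have h1 : modulus t₀⁻¹ < a⁻¹ := by
        rw [modulus_inv]
        exact inv_strictAnti₀ h ha
      have h2 := (continuousAt_inv₀ h0).eventually ((isOpen_modulus_lt (F := F) a⁻¹).mem_nhds h1)
      filter_upwards [h2, eventually_ne_nhds h0] with t ht ht0
      have ht' : modulus t⁻¹ < a⁻¹ := ht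
      rw [modulus_inv] at ht'
      exact (inv_lt_inv₀ (modulus_pos ht0) h).mp ht'

-- If the norm of `t` is large, then `t⁻¹` is near `0`, where the module is small, so the module of
-- `t` is large.
omit [MeasurableSpace F] [BorelSpace F] in
lemma isCompact_modulus_le (R : ℝ) : IsCompact {t : F | modulus t ≤ R} := by
  refine Metric.isCompact_of_isClosed_isBounded (isClosed_le continuous_modulus continuous_const) ?_
  have hR : 0 < (|R| + 1)⁻¹ := by positivity
  have h0 : {t : F | modulus t < (|R| + 1)⁻¹} ∈ 𝓝 (0 : F) :=
    (isOpen_modulus_lt _).mem_nhds (by simpa using hR)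
  obtain ⟨δ, hδ, hb⟩ := Metric.mem_nhds_iff.mp h0
  refine (Metric.isBounded_closedBall (x := (0 : F)) (r := δ⁻¹)).subset fun t ht => ?_
  rw [mem_closedBall_zero_iff]
  by_contra! hlt
  have ht0 : t ≠ 0 := by
    rintro rfl
    rw [norm_zero] at hlt
    exact absurd hlt (not_lt.mpr (inv_nonneg.mpr hδ.le))
  have h1 : t⁻¹ ∈ Metric.ball (0 : F) δ := by
    rw [mem_ball_zero_iff, norm_inv]
    exact inv_lt_of_inv_lt₀ hδ hlt
  have h2 : modulus t⁻¹ < (|R| + 1)⁻¹ := hb h1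
  rw [modulus_inv, inv_lt_inv₀ (modulus_pos ht0) (by positivity)] at h2
  have : modulus t ≤ R := ht
  linarith [le_abs_self R]

-- A substitute for the triangle inequality, which fails for the module of `ℂ`. It follows from
-- compactness of the unit ball and division by `t` outside of it.
omit [MeasurableSpace F] [BorelSpace F] in
lemma exists_modulus_one_add_le :
    ∃ K : ℝ, 1 ≤ K ∧ ∀ t : F, modulus (1 + t) ≤ K * max 1 (modulus t) := by
  obtain ⟨K₀, hK₀⟩ := (isCompact_modulus_le (F := F) 1).exists_bound_of_continuousOn
    (f := fun t => modulus (1 + t)) (continuous_modulus.comp (by fun_prop)).continuousOn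
  have h : ∀ t : F, modulus t ≤ 1 → modulus (1 + t) ≤ max 1 K₀ := fun t ht =>
    ((le_abs_self _).trans (hK₀ t ht)).trans (le_max_right _ _)
  refine ⟨max 1 K₀, le_max_left _ _, fun t => ?_⟩
  rcases le_total (modulus t) 1 with ht | ht
  · rw [max_eq_left ht, mul_one]
    exact h t ht
  · have ht0 : t ≠ 0 := by
      rintro rfl
      norm_num at ht
    have h1 : modulus t⁻¹ ≤ 1 := by
      rw [modulus_inv]; exact inv_le_one_of_one_le₀ ht
    rw [max_eq_right ht, show 1 + t = (1 + t⁻¹) * t by rw [add_mul, inv_mul_cancel₀ ht0]; ring,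
      modulus_mul]
    exact mul_le_mul_of_nonneg_right (h _ h1) (modulus_nonneg t)

omit [MeasurableSpace F] [BorelSpace F] in
lemma exists_one_lt_modulus : ∃ t : Fˣ, 1 < modulus (t : F) := by
  have h0 : {t : F | modulus t < 1} ∈ 𝓝 (0 : F) :=
    (isOpen_modulus_lt _).mem_nhds (by simp)
  obtain ⟨t, ht, ht1⟩ : ∃ t : F, t ≠ 0 ∧ modulus t < 1 := by
    have := (NormedField.nhdsNE_neBot (0 : F)).nonempty_of_mem
      (inter_mem_inf (f := 𝓝 (0 : F)) (g := 𝓟 {0}ᶜ) h0 (mem_principal_self _))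
    obtain ⟨t, ht1, ht2⟩ := this
    exact ⟨t, ht2, ht1⟩
  refine ⟨(Units.mk0 t ht)⁻¹, ?_⟩
  rw [Units.val_inv_eq_inv_val, modulus_inv]
  exact (one_lt_inv₀ (modulus_pos ht)).mpr ht1

end Modulus

/-! ### The multiplicative Haar measure -/

section UnitsHaar

variable {F : Type*} [NontriviallyNormedField F]

instance secondCountable_units [SecondCountableTopology F] : SecondCountableTopology Fˣ :=
  Units.isEmbedding_val₀.secondCountableTopology

instance borelSpace_units [MeasurableSpace F] [BorelSpace F] : BorelSpace Fˣ := by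
  constructor
  rw [Units.isEmbedding_val₀.eq_induced, borel_comap, ← BorelSpace.measurable_eq (α := F)]
  rfl

lemma measurableEmbedding_val [MeasurableSpace F] [BorelSpace F] :
    MeasurableEmbedding (Units.val : Fˣ → F) := by
  refine Units.isEmbedding_val₀.measurableEmbedding ?_
  have : Set.range (Units.val : Fˣ → F) = {0}ᶜ := by
    ext t
    simp only [Set.mem_range, Set.mem_compl_iff, Set.mem_singleton_iff]
    exact ⟨fun ⟨u, hu⟩ => hu ▸ u.ne_zero, fun h => ⟨Units.mk0 t h, rfl⟩⟩
  rw [this]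
  exact (measurableSet_singleton 0).compl

variable [LocallyCompactSpace F] [MeasurableSpace F] [BorelSpace F]
  (μ : Measure F) [μ.IsAddHaarMeasure]

@[fun_prop]
lemma measurable_modulus : Measurable (modulus : F → ℝ) := continuous_modulus.measurable

lemma lintegral_unitsHaar {h : F → ENNReal} (hh : Measurable h) :
    ∫⁻ x : Fˣ, h x ∂(unitsHaar μ) = ∫⁻ t, ENNReal.ofReal (modulus t)⁻¹ * h t ∂μ := by
  have hd : Measurable fun t : F => ENNReal.ofReal (modulus t)⁻¹ :=
    measurable_modulus.inv.ennreal_ofReal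
  rw [unitsHaar, ← measurableEmbedding_val.lintegral_map, measurableEmbedding_val.map_comap,
    show Set.range (Units.val : Fˣ → F) = {0}ᶜ from ?_, setLIntegral_withDensity_eq_setLIntegral_mul
      _ hd hh (measurableSet_singleton 0).compl]
  · rw [Measure.restrict_eq_self_of_ae_mem (by simp [ae_iff])]
    rfl
  · ext t
    simp only [Set.mem_range, Set.mem_compl_iff, Set.mem_singleton_iff]
    exact ⟨fun ⟨u, hu⟩ => hu ▸ u.ne_zero, fun h => ⟨Units.mk0 t h, rfl⟩⟩

open Classical in
/-- A non-zero element as a unit, with the value `1` at `0`. -/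
def toUnit (t : F) : Fˣ := if h : t = 0 then 1 else Units.mk0 t h

omit [LocallyCompactSpace F] [MeasurableSpace F] [BorelSpace F] in
lemma coe_toUnit {t : F} (h : t ≠ 0) : (toUnit t : F) = t := by
  rw [toUnit, dif_neg h, Units.val_mk0]

omit [LocallyCompactSpace F] [MeasurableSpace F] [BorelSpace F] in
@[simp] lemma toUnit_coe (t : Fˣ) : toUnit (t : F) = t := by
  ext
  exact coe_toUnit t.ne_zero

omit [LocallyCompactSpace F] [MeasurableSpace F] [BorelSpace F] in
lemma toUnit_eq {t : F} {u : Fˣ} (h : t = u) : toUnit t = u := by rw [h, toUnit_coe]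

omit [LocallyCompactSpace F] in
@[fun_prop]
lemma measurable_toUnit : Measurable (toUnit : F → Fˣ) := by
  classical
  rw [← measurableEmbedding_val.measurable_comp_iff]
  have : Units.val ∘ toUnit = fun t : F => if t = 0 then 1 else t := by
    ext t
    by_cases h : t = 0
    · simp [toUnit, h]
    · simp [coe_toUnit h, h]
  rw [this]
  exact Measurable.ite (measurableSet_singleton 0) measurable_const measurable_id

omit [LocallyCompactSpace F] [MeasurableSpace F] [BorelSpace F] in
lemma continuousAt_toUnit {t : F} (h : t ≠ 0) : ContinuousAt (toUnit : F → Fˣ) t := by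
  rw [Units.isEmbedding_val₀.continuousAt_iff]
  refine continuousAt_id.congr ?_
  filter_upwards [eventually_ne_nhds h] with s hs
  exact (coe_toUnit hs).symm

lemma lintegral_unitsHaar' {h : Fˣ → ENNReal} (hh : Measurable h) :
    ∫⁻ x, h x ∂(unitsHaar μ) = ∫⁻ t, ENNReal.ofReal (modulus t)⁻¹ * h (toUnit t) ∂μ := by
  rw [← lintegral_unitsHaar μ (h := fun t => h (toUnit t)) (by fun_prop)]
  simp

lemma lintegral_units_mul (g : Fˣ) {h : F → ENNReal} (hh : Measurable h) :
    ENNReal.ofReal (modulus (g : F)) * ∫⁻ t, h (g * t) ∂μ = ∫⁻ t, h t ∂μ := by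
  have hm : Measurable fun t : F => (g : F) * t := by fun_prop
  have : ENNReal.ofReal (modulus (g : F)) • μ.map (fun t => (g : F) * t) = μ := by
    ext s hs
    have hs' : g • ((fun t : F => (g : F) * t) ⁻¹' s) = s := by
      ext t
      rw [Set.mem_smul_set_iff_inv_smul_mem]
      simp [Units.smul_def]
    rw [Measure.smul_apply, Measure.map_apply hm hs, smul_eq_mul, ← measure_units_smul, hs']
  conv_rhs => rw [← this]
  rw [lintegral_smul_measure, lintegral_map hh hm, smul_eq_mul]

instance isMulLeftInvariant_unitsHaar : (unitsHaar μ).IsMulLeftInvariant where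
  map_mul_left_eq_self g := by
    refine Measure.ext_of_lintegral _ fun h hh => ?_
    have hm : Measurable fun x : Fˣ => g * x := by fun_prop
    rw [lintegral_map hh hm, lintegral_unitsHaar' μ (h := fun x => h (g * x)) (by fun_prop),
      lintegral_unitsHaar' μ hh,
      ← lintegral_units_mul μ g
        (h := fun t => ENNReal.ofReal (modulus t)⁻¹ * h (toUnit t)) (by fun_prop),
      ← lintegral_const_mul' _ _ ENNReal.ofReal_ne_top]
    refine lintegral_congr_ae ?_
    filter_upwards [compl_mem_ae_iff.mpr (measure_singleton (μ := μ) (0 : F))] with t ht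
    have ht0 : t ≠ 0 := ht
    have h1 : toUnit ((g : F) * t) = g * toUnit t := toUnit_eq (by simp [coe_toUnit ht0])
    have hg := modulus_units_pos g
    rw [h1, ← mul_assoc, ← ENNReal.ofReal_mul hg.le, modulus_mul, mul_inv,
      mul_inv_cancel_left₀ hg.ne']

omit [μ.IsAddHaarMeasure] in
lemma unitsHaar_apply {s : Set Fˣ} (hs : MeasurableSet s) :
    unitsHaar μ s = ∫⁻ t in Units.val '' s, ENNReal.ofReal (modulus t)⁻¹ ∂μ := by
  rw [unitsHaar, measurableEmbedding_val.comap_apply,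
    withDensity_apply _ (measurableEmbedding_val.measurableSet_image.mpr hs)]

instance isHaarMeasure_unitsHaar : (unitsHaar μ).IsHaarMeasure := by
  obtain ⟨K, hK, hK1⟩ := exists_compact_mem_nhds (1 : Fˣ)
  have hd : Measurable fun t : F => ENNReal.ofReal (modulus t)⁻¹ :=
    measurable_modulus.inv.ennreal_ofReal
  have hKi : IsCompact (Units.val '' K : Set F) := hK.image Units.continuous_val
  refine Measure.isHaarMeasure_of_isCompact_nonempty_interior _ K hK
    ⟨1, mem_interior_iff_mem_nhds.mpr hK1⟩ ?_ ?_
  · rw [unitsHaar_apply μ hK.measurableSet]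
    intro h0
    rw [lintegral_eq_zero_iff hd] at h0
    have h1 : ∀ᵐ t ∂(μ.restrict (Units.val '' K)), False := by
      filter_upwards [h0, ae_restrict_mem hKi.measurableSet] with t ht ht'
      obtain ⟨u, -, rfl⟩ := ht'
      have := modulus_units_pos u
      simp only [Pi.zero_apply, ENNReal.ofReal_eq_zero] at ht
      exact absurd ht (not_le.mpr (inv_pos.mpr this))
    rw [eventually_false_iff_eq_bot, ae_eq_bot, Measure.restrict_eq_zero] at h1
    refine (Measure.measure_pos_of_mem_nhds μ (x := (1 : F)) ?_).ne' h1
    exact (Units.isOpenEmbedding_val (R := F)).isOpenMap.image_mem_nhds hK1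
  · rw [unitsHaar_apply μ hK.measurableSet]
    obtain ⟨M, hM⟩ := hK.exists_bound_of_continuousOn (f := fun x : Fˣ => (modulus (x : F))⁻¹)
      ((continuous_modulus.comp Units.continuous_val).inv₀
        fun x => (modulus_units_pos x).ne').continuousOn
    refine ne_top_of_le_ne_top (ENNReal.mul_ne_top (ENNReal.ofReal_ne_top (r := M))
      hKi.measure_ne_top) ((setLIntegral_mono' hKi.measurableSet
        (g := fun _ => ENNReal.ofReal M) fun t ht => ?_).trans (setLIntegral_const _ _).le)
    obtain ⟨u, hu, rfl⟩ := ht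
    exact ENNReal.ofReal_le_ofReal ((le_abs_self _).trans (hM u hu))

instance nullSingletonClass_unitsHaar : NullSingletonClass (unitsHaar μ) where
  measure_singleton x := by
    rw [unitsHaar_apply μ (measurableSet_singleton x), Set.image_singleton]
    simp

/-- Translation invariance of the additive measure, read in multiplicative terms. At `x = -1` the
density is `0` by the convention for division. -/
lemma lintegral_one_add {h : Fˣ → ENNReal} (hh : Measurable h) :
    ∫⁻ x, h x ∂(unitsHaar μ) =
      ∫⁻ x : Fˣ, ENNReal.ofReal (modulus (x : F) / modulus (1 + x : F)) * h (toUnit (1 + x))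
        ∂(unitsHaar μ) := by
  rw [lintegral_unitsHaar' μ hh, lintegral_unitsHaar μ (h := fun x : F =>
    ENNReal.ofReal (modulus (x : F) / modulus (1 + x : F)) * h (toUnit (1 + x))) (by fun_prop),
    ← lintegral_add_left_eq_self _ (1 : F)]
  refine lintegral_congr_ae ?_
  filter_upwards [compl_mem_ae_iff.mpr (measure_singleton (μ := μ) (0 : F))] with t ht
  have ht0 : modulus t ≠ 0 := (modulus_pos ht).ne'
  rw [← mul_assoc, ← ENNReal.ofReal_mul (inv_nonneg.mpr (modulus_nonneg t)), div_eq_mul_inv,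
    inv_mul_cancel_left₀ ht0]

end UnitsHaar

/-! ### The logarithmic size -/

section LogSize

variable {F : Type*} [NontriviallyNormedField F] [LocallyCompactSpace F]

/-- The logarithmic size `1 + |log ‖t‖|`. -/
def logSize (t : F) : ℝ := 1 + |Real.log (modulus t)|

lemma one_le_logSize (t : F) : 1 ≤ logSize t := by
  unfold logSize
  linarith [abs_nonneg (Real.log (modulus t))]

lemma logSize_pos (t : F) : 0 < logSize t := zero_lt_one.trans_le (one_le_logSize t)

@[simp] lemma logSize_inv (t : F) : logSize t⁻¹ = logSize t := by simp [logSize]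

@[simp] lemma logSize_neg (t : F) : logSize (-t) = logSize t := by simp [logSize]

lemma logSize_mul_le (s t : F) : logSize (s * t) ≤ logSize s * logSize t := by
  by_cases hs : s = 0
  · subst hs
    simp [logSize]
  by_cases ht : t = 0
  · subst ht
    simp [logSize]
  unfold logSize
  rw [modulus_mul, Real.log_mul (modulus_pos hs).ne' (modulus_pos ht).ne']
  have := abs_add_le (Real.log (modulus s)) (Real.log (modulus t))
  nlinarith [abs_nonneg (Real.log (modulus s)), abs_nonneg (Real.log (modulus t)),
    mul_nonneg (abs_nonneg (Real.log (modulus s))) (abs_nonneg (Real.log (modulus t)))]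

lemma logSize_div_le (s t : F) : logSize (s / t) ≤ logSize s * logSize t := by
  rw [div_eq_mul_inv]
  exact (logSize_mul_le s t⁻¹).trans_eq (by rw [logSize_inv])

@[fun_prop]
lemma measurable_logSize [MeasurableSpace F] [BorelSpace F] : Measurable (logSize : F → ℝ) := by
  unfold logSize
  fun_prop

lemma continuous_logSize_units : Continuous fun x : Fˣ => logSize (x : F) := by
  unfold logSize
  refine continuous_const.add (Continuous.abs (Continuous.log ?_ fun x => (modulus_units_pos x).ne'))
  exact continuous_modulus.comp Units.continuous_val

/-- The logarithm of the module is a homomorphism to `ℝ`, so it grows at most linearly with word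
length. -/
lemma exists_logSize_inv_ge_proximity {C : Set Fˣ} (hC : IsCompact C) :
    ∃ L : ℝ, 0 ≤ L ∧ ∀ x : Fˣ, proximity C x ≤ L * (logSize (x : F))⁻¹ := by
  obtain ⟨L₀, hL₀⟩ := hC.exists_bound_of_continuousOn continuous_logSize_units.continuousOn
  have hL : ∀ k : ℕ, ∀ x ∈ C ^ k, |Real.log (modulus (x : F))| ≤ k * |L₀| := by
    intro k
    induction k with
    | zero => intro x hx; simp only [pow_zero, Set.mem_one] at hx; simp [hx]
    | succ k ih =>
      intro x hx
      rw [pow_succ] at hx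
      obtain ⟨a, ha, b, hb, rfl⟩ := hx
      have h1 := ih a ha
      have h2 : |Real.log (modulus (b : F))| ≤ |L₀| := by
        have := (le_abs_self _).trans (hL₀ b hb)
        unfold logSize at this
        linarith [le_abs_self L₀]
      show |Real.log (modulus ((a * b : Fˣ) : F))| ≤ _
      rw [Units.val_mul, modulus_mul,
        Real.log_mul (modulus_units_pos a).ne' (modulus_units_pos b).ne']
      push_cast
      linarith [abs_add_le (Real.log (modulus (a : F))) (Real.log (modulus (b : F)))]
  refine ⟨1 + |L₀|, by positivity, fun x => ?_⟩
  classical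
  by_cases h : ∃ k, x ∈ C ^ k
  · have h1 := hL _ x (Nat.find_spec h)
    rw [proximity, dif_pos h, ← div_eq_mul_inv, le_div_iff₀ (logSize_pos _), inv_mul_le_iff₀
      (by positivity), logSize]
    nlinarith [abs_nonneg L₀, (Nat.find h).cast_nonneg (α := ℝ)]
  · rw [proximity, dif_neg h]
    exact mul_nonneg (by positivity) (inv_nonneg.mpr (logSize_pos _).le)

/-- The map `x ↦ (x, x⁻¹)` is a closed embedding, and the set is the preimage of a compact product.
-/
lemma isCompact_modulus_units (R : ℝ) :
    IsCompact {x : Fˣ | modulus (x : F) ≤ R ∧ (modulus (x : F))⁻¹ ≤ R} := by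
  have hK := isCompact_modulus_le (F := F) R
  have := Units.isClosedEmbedding_embedProduct (α := F) |>.isCompact_preimage
    (hK.prod (hK.image MulOpposite.continuous_op))
  convert this using 1
  ext x
  simp only [Units.embedProduct, Set.mem_ofPred_eq, Set.mem_preimage, MonoidHom.coe_mk,
    OneHom.coe_mk, Set.mem_prod, Set.mem_image, and_congr_right_iff, Units.val_inv_eq_inv_val]
  refine fun _ => ⟨fun h => ⟨(x : F)⁻¹, by simpa using h, rfl⟩, ?_⟩
  rintro ⟨y, hy, hyx⟩
  rw [MulOpposite.op_injective hyx, modulus_inv] at hy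
  exact hy

/-- For an annulus `C` whose outer radius is the module of some `t`, each further factor from `C`
enlarges the reachable range of logarithms by `log R`. So word length on `F^×` is comparable to
`logSize`. -/
lemma exists_proximity_ge_logSize_inv :
    ∃ C : Set Fˣ, IsCompact C ∧ ∃ L : ℝ, 0 ≤ L ∧
      ∀ x : Fˣ, (logSize (x : F))⁻¹ ≤ L * proximity C x := by
  obtain ⟨t, ht⟩ := exists_one_lt_modulus (F := F)
  set R := modulus (t : F)
  have hR : 0 < Real.log R := Real.log_pos ht
  set C := {x : Fˣ | modulus (x : F) ≤ R ∧ (modulus (x : F))⁻¹ ≤ R} with hCdef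
  have hmem : ∀ x : Fˣ, x ∈ C ↔ |Real.log (modulus (x : F))| ≤ Real.log R := by
    intro x
    have hx := modulus_units_pos x
    rw [abs_le, hCdef, Set.mem_ofPred_eq, ← Real.log_le_log_iff hx (by linarith),
      ← Real.log_le_log_iff (inv_pos.mpr hx) (by linarith), Real.log_inv, neg_le, and_comm]
  have hk : ∀ k : ℕ, ∀ x : Fˣ, |Real.log (modulus (x : F))| ≤ (k + 1) * Real.log R →
      x ∈ C ^ (k + 1) := by
    intro k
    induction k with
    | zero => intro x hx; rw [zero_add, pow_one, hmem]; simpa using hx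
    | succ k ih =>
      intro x hx
      push_cast at hx
      -- Peel off one factor of `C`: the unit if `x` is already in range, otherwise `t` or `t⁻¹`
      -- according to the sign of the logarithm.
      obtain ⟨s, hs, hsx⟩ : ∃ s ∈ C,
          |Real.log (modulus ((x * s⁻¹ : Fˣ) : F))| ≤ (k + 1) * Real.log R := by
        by_cases h0 : |Real.log (modulus (x : F))| ≤ (k + 1) * Real.log R
        · refine ⟨1, (hmem 1).mpr (by simpa using hR.le), by simpa using h0⟩
        · push Not at h0
          have hkR : 0 ≤ (k : ℝ) * Real.log R := by positivity
          have hpos := modulus_units_pos x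
          rcases le_total 0 (Real.log (modulus (x : F))) with h | h
          · rw [abs_of_nonneg h] at hx h0
            refine ⟨t, (hmem t).mpr (abs_of_pos hR).le, ?_⟩
            simp only [Units.val_mul, Units.val_inv_eq_inv_val, modulus_mul, modulus_inv]
            rw [Real.log_mul hpos.ne' (by positivity), Real.log_inv, abs_le]
            constructor <;> linarith
          · rw [abs_of_nonpos h] at hx h0
            refine ⟨t⁻¹, (hmem t⁻¹).mpr ?_, ?_⟩
            · simp only [Units.val_inv_eq_inv_val, modulus_inv, Real.log_inv, abs_neg]
              exact (abs_of_pos hR).le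
            · simp only [inv_inv, Units.val_mul, modulus_mul]
              rw [Real.log_mul hpos.ne' (by positivity), abs_le]
              constructor <;> linarith
      rw [pow_succ]
      exact ⟨x * s⁻¹, ih _ hsx, s, hs, by simp⟩
  refine ⟨C, isCompact_modulus_units R, (Real.log R)⁻¹ + 2, by positivity, fun x => ?_⟩
  set a := |Real.log (modulus (x : F))| with ha
  set k := ⌊a / Real.log R⌋₊ with hkdef
  have h1 : a ≤ (k + 1) * Real.log R := by
    rw [← div_le_iff₀ hR]
    exact (Nat.lt_floor_add_one _).le
  have h2 : (k : ℝ) ≤ a / Real.log R := Nat.floor_le (by positivity)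
  have h3 := le_proximity (hk k x h1)
  refine le_trans ?_ (mul_le_mul_of_nonneg_left h3 (by positivity))
  rw [← div_eq_mul_inv, le_div_iff₀ (by positivity), inv_mul_le_iff₀ (logSize_pos _), logSize, ← ha]
  push_cast
  have h4 : a / Real.log R = (Real.log R)⁻¹ * a := by ring
  rw [h4] at h2
  have ha0 : 0 ≤ a := abs_nonneg _
  nlinarith [inv_pos.mpr hR]

variable [MeasurableSpace F] [BorelSpace F] (μ : Measure F) [μ.IsAddHaarMeasure]

lemma exists_integrable_logSize_pow :
    ∃ d : ℕ, ∀ n ≥ d, Integrable (fun x : Fˣ => (logSize (x : F))⁻¹ ^ n) (unitsHaar μ) := by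
  obtain ⟨C, hC, L, hL, h⟩ := exists_proximity_ge_logSize_inv (F := F)
  obtain ⟨d, W, hW, hWC⟩ := exists_integrable_ge_proximity_pow (unitsHaar μ) hC
  refine ⟨d, fun n hn => (hW.const_mul (L ^ d)).mono'
    (Measurable.aestronglyMeasurable (by fun_prop)) (ae_of_all _ fun x => ?_)⟩
  have h0 : 0 ≤ (logSize (x : F))⁻¹ := inv_nonneg.mpr (logSize_pos _).le
  rw [Real.norm_of_nonneg (by positivity)]
  calc (logSize (x : F))⁻¹ ^ n ≤ (logSize (x : F))⁻¹ ^ d :=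
        pow_le_pow_of_le_one h0 (inv_le_one_of_one_le₀ (one_le_logSize _)) hn
    _ ≤ (L * proximity C x) ^ d := by gcongr; exact h x
    _ = L ^ d * proximity C x ^ d := mul_pow _ _ _
    _ ≤ L ^ d * W x := by gcongr; exact hWC x

end LogSize

/-! ### Fourier inversion -/

section Inversion

variable {G : Type*} [CommGroup G] [TopologicalSpace G]

@[simp] lemma norm_character (χ : PontryaginDual G) (x : G) : ‖(χ x : ℂ)‖ = 1 := Circle.norm_coe _

lemma character_ne_zero (χ : PontryaginDual G) (x : G) : (χ x : ℂ) ≠ 0 := Circle.coe_ne_zero _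

@[simp] lemma character_mul_apply (χ ψ : PontryaginDual G) (x : G) : (χ * ψ) x = χ x * ψ x := rfl

@[simp] lemma character_inv_apply (χ : PontryaginDual G) (x : G) : χ⁻¹ x = (χ x)⁻¹ := rfl

@[simp] lemma character_div_apply (χ ψ : PontryaginDual G) (x : G) : (χ / ψ) x = χ x / ψ x := by
  rw [div_eq_mul_inv, character_mul_apply, character_inv_apply, div_eq_mul_inv]

lemma continuous_circle_coe : Continuous fun z : Circle => (z : ℂ) := by fun_prop

lemma continuous_dual_eval_const (x : G) : Continuous fun χ : PontryaginDual G => χ x :=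
  (continuous_eval_const (F := C(G, Circle)) x).comp
    (ContinuousMonoidHom.isInducing_toContinuousMap G Circle).continuous

lemma continuous_dual_eval [LocallyCompactSpace G] :
    Continuous fun p : PontryaginDual G × G => p.1 p.2 := by
  have h : Continuous fun p : C(G, Circle) × G => p.1 p.2 := by fun_prop
  exact h.comp ((ContinuousMonoidHom.isInducing_toContinuousMap G Circle).continuous.prodMap
    continuous_id)

lemma continuous_character [LocallyCompactSpace G] {X : Type*} [TopologicalSpace X]
    {χ : X → PontryaginDual G} {g : X → G} (hχ : Continuous χ) (hg : Continuous g) :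
    Continuous fun t => (χ t (g t) : ℂ) :=
  continuous_circle_coe.comp (continuous_dual_eval.comp (hχ.prodMk hg))

lemma secondCountable_dual [LocallyCompactSpace G] [SecondCountableTopology G] :
    SecondCountableTopology (PontryaginDual G) :=
  (ContinuousMonoidHom.isEmbedding_toContinuousMap G Circle).secondCountableTopology

variable [IsTopologicalGroup G] [MeasurableSpace G] [BorelSpace G]
  [MeasurableSpace (PontryaginDual G)] [BorelSpace (PontryaginDual G)]

lemma fourierTransform_mul_left {m : Measure G} [m.IsMulLeftInvariant] (f : G → ℂ) (x : G)
    (χ : PontryaginDual G) :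
    fourierTransform m (fun y => f (x * y)) χ = fourierTransform m f χ * (χ x : ℂ) := by
  unfold fourierTransform
  rw [← integral_mul_const, ← integral_mul_left_eq_self (fun y => f y * (χ y : ℂ)⁻¹ * (χ x : ℂ)) x]
  congr 1
  ext y
  rw [map_mul, Circle.coe_mul]
  have := character_ne_zero χ x
  have := character_ne_zero χ y
  field_simp

lemma integrable_mul_character {ν : Measure (PontryaginDual G)} {f : PontryaginDual G → ℂ}
    (hf : Integrable f ν) (x : G) : Integrable (fun χ => f χ * (χ x : ℂ)) ν := by
  refine hf.mul_of_top_left (memLp_top_of_bound ?_ 1 (ae_of_all _ fun χ => ?_))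
  · exact (continuous_circle_coe.comp (continuous_dual_eval_const x)).measurable.aestronglyMeasurable
  · simp

lemma IsDualNormalized.inversion {m : Measure G} [m.IsMulLeftInvariant]
    {ν : Measure (PontryaginDual G)} (h : IsDualNormalized m ν) {f : G → ℂ} (hf : Continuous f)
    (hfi : Integrable f m) (hft : Integrable (fourierTransform m f) ν) (x : G) :
    ∫ χ, fourierTransform m f χ * (χ x : ℂ) ∂ν = f x := by
  have key := funext (fourierTransform_mul_left (m := m) f x)
  have h1 := h (fun y => f (x * y)) (by fun_prop) (hfi.comp_mul_left x)
    (by rw [key]; exact integrable_mul_character hft x)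
  rw [key] at h1
  simpa using h1

/-- This is the device that converts decay of a Fourier transform into bounds on the function. -/
lemma IsDualNormalized.norm_le {m : Measure G} [m.IsMulLeftInvariant]
    {ν : Measure (PontryaginDual G)} (h : IsDualNormalized m ν) {f : G → ℂ} (hf : Continuous f)
    (hfi : Integrable f m) {b : PontryaginDual G → ℝ} (hb : Integrable b ν)
    (hm : AEStronglyMeasurable (fourierTransform m f) ν)
    (hfb : ∀ χ, ‖fourierTransform m f χ‖ ≤ b χ) (x : G) : ‖f x‖ ≤ ∫ χ, b χ ∂ν := by
  have hft : Integrable (fourierTransform m f) ν := hb.mono' hm (ae_of_all _ hfb)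
  rw [← h.inversion hf hfi hft x]
  refine norm_integral_le_of_norm_le hb (ae_of_all _ fun χ => ?_)
  rw [norm_mul, norm_character, mul_one]
  exact hfb χ

end Inversion

/-! ### The Fourier transform in the dual variables -/

section Partial

variable {F : Type*} [NontriviallyNormedField F] [LocallyCompactSpace F]
  [MeasurableSpace F] [BorelSpace F]
  [MeasurableSpace (PontryaginDual Fˣ)] [BorelSpace (PontryaginDual Fˣ)]
  (μ : Measure F) [μ.IsAddHaarMeasure] (ν : Measure (PontryaginDual Fˣ)) [ν.IsHaarMeasure]

instance secondCountable_dual_units : SecondCountableTopology (PontryaginDual Fˣ) :=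
  secondCountable_dual

/-- The weight `(logSize x)⁻¹ ^ n` on the multiplicative group. -/
def logWeight (n : ℕ) (x : Fˣ) : ℝ := (logSize (x : F))⁻¹ ^ n

lemma logWeight_nonneg (n : ℕ) (x : Fˣ) : 0 ≤ logWeight n x :=
  pow_nonneg (inv_nonneg.mpr (logSize_pos _).le) n

lemma logWeight_le_one (n : ℕ) (x : Fˣ) : logWeight n x ≤ 1 :=
  pow_le_one₀ (inv_nonneg.mpr (logSize_pos _).le) (inv_le_one_of_one_le₀ (one_le_logSize _))

/-- The powers `d₁` and `d₃` of `proximity` are spent on integrability in `α` and `β`, the others on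
decay in `x` and `y`. Since `d₁` and `d₃` are fixed first, `W` does not depend on `n`. -/
lemma RapidlyDecreasing.exists_product_bound
    {Φ : GaussianGroup F × GaussianGroup F → ℂ} (h : RapidlyDecreasing Φ) :
    ∃ W : PontryaginDual Fˣ → ℝ, Integrable W ν ∧ (∀ α, 0 ≤ W α) ∧ ∀ n : ℕ, ∃ M : ℝ, 0 ≤ M ∧
      ∀ α x β y, ‖Φ ((α, x), (β, y))‖ ≤
        M * (W α * W β) * (logWeight n x * logWeight n y) := by
  obtain ⟨C, hC, hb⟩ := h.exists_proximity_bound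
  let P := GaussianGroup F
  let π₁ : P × P →* PontryaginDual Fˣ := (MonoidHom.fst _ _).comp (MonoidHom.fst _ _)
  let π₂ : P × P →* Fˣ := (MonoidHom.snd _ _).comp (MonoidHom.fst _ _)
  let π₃ : P × P →* PontryaginDual Fˣ := (MonoidHom.fst _ _).comp (MonoidHom.snd _ _)
  let π₄ : P × P →* Fˣ := (MonoidHom.snd _ _).comp (MonoidHom.snd _ _)
  have h₁ : IsCompact (π₁ '' C) := hC.image (continuous_fst.comp continuous_fst)
  have h₂ : IsCompact (π₂ '' C) := hC.image (continuous_snd.comp continuous_fst)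
  have h₃ : IsCompact (π₃ '' C) := hC.image (continuous_fst.comp continuous_snd)
  have h₄ : IsCompact (π₄ '' C) := hC.image (continuous_snd.comp continuous_snd)
  obtain ⟨d₁, W₁, hW₁, hp₁⟩ := exists_integrable_ge_proximity_pow ν h₁
  obtain ⟨d₃, W₃, hW₃, hp₃⟩ := exists_integrable_ge_proximity_pow ν h₃
  obtain ⟨L₂, hL₂, hp₂⟩ := exists_logSize_inv_ge_proximity h₂
  obtain ⟨L₄, hL₄, hp₄⟩ := exists_logSize_inv_ge_proximity h₄
  have hW₁0 : ∀ α, 0 ≤ W₁ α := fun α => (pow_nonneg (proximity_nonneg _ _) _).trans (hp₁ α)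
  have hW₃0 : ∀ α, 0 ≤ W₃ α := fun α => (pow_nonneg (proximity_nonneg _ _) _).trans (hp₃ α)
  refine ⟨fun α => W₁ α + W₃ α, hW₁.add hW₃, fun α => add_nonneg (hW₁0 α) (hW₃0 α), fun n => ?_⟩
  obtain ⟨M, hM0, hM⟩ := hb (d₁ + n + (d₃ + n))
  refine ⟨M * (L₂ ^ n * L₄ ^ n), by positivity, fun α x β y => (hM _).trans ?_⟩
  set p := proximity C ((α, x), (β, y))
  have hp0 : 0 ≤ p := proximity_nonneg _ _
  have e₁ : p ^ d₁ ≤ W₁ α + W₃ α :=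
    (pow_le_pow_left₀ hp0 (proximity_le_map π₁ C _) _).trans ((hp₁ α).trans (by linarith [hW₃0 α]))
  have e₃ : p ^ d₃ ≤ W₁ β + W₃ β :=
    (pow_le_pow_left₀ hp0 (proximity_le_map π₃ C _) _).trans ((hp₃ β).trans (by linarith [hW₁0 β]))
  have e₂ : p ^ n ≤ L₂ ^ n * logWeight n x := by
    rw [logWeight, ← mul_pow]
    exact pow_le_pow_left₀ hp0 ((proximity_le_map π₂ C _).trans (hp₂ x)) _
  have e₄ : p ^ n ≤ L₄ ^ n * logWeight n y := by
    rw [logWeight, ← mul_pow]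
    exact pow_le_pow_left₀ hp0 ((proximity_le_map π₄ C _).trans (hp₄ y)) _
  have hx := logWeight_nonneg n x
  calc M * p ^ (d₁ + n + (d₃ + n)) = M * ((p ^ d₁ * p ^ n) * (p ^ d₃ * p ^ n)) := by
        rw [pow_add, pow_add, pow_add]
    _ ≤ M * (((W₁ α + W₃ α) * (L₂ ^ n * logWeight n x)) *
          ((W₁ β + W₃ β) * (L₄ ^ n * logWeight n y))) := by
        have := hW₁0 α
        have := hW₃0 α
        have := add_nonneg (hW₁0 β) (hW₃0 β)
        gcongr
    _ = _ := by ring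

/-- The Fourier transform of `Φ` in the two variables in the dual group. -/
def dualTransform (Φ : GaussianGroup F × GaussianGroup F → ℂ) (u x v y : Fˣ) : ℂ :=
  ∫ p : PontryaginDual Fˣ × PontryaginDual Fˣ,
    Φ ((p.1, x), (p.2, y)) * ((p.1 u : ℂ) * (p.2 v : ℂ))⁻¹ ∂(ν.prod ν)

variable {ν} {Φ : GaussianGroup F × GaussianGroup F → ℂ} {W : PontryaginDual Fˣ → ℝ}

lemma integrable_dualTransform_integrand (hΦ : Continuous Φ) (hW : Integrable W ν)
    {M : ℝ} (hM : ∀ α x β y, ‖Φ ((α, x), (β, y))‖ ≤ M * (W α * W β)) (u x v y : Fˣ) :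
    Integrable (fun p : PontryaginDual Fˣ × PontryaginDual Fˣ =>
      Φ ((p.1, x), (p.2, y)) * ((p.1 u : ℂ) * (p.2 v : ℂ))⁻¹) (ν.prod ν) := by
  refine ((hW.mul_prod hW).const_mul M).mono' ?_ (ae_of_all _ fun p => ?_)
  · refine Continuous.aestronglyMeasurable ?_
    refine Continuous.mul (by fun_prop) (Continuous.inv₀ ((continuous_character continuous_fst
      continuous_const).mul (continuous_character continuous_snd continuous_const)) fun p => ?_)
    exact mul_ne_zero (character_ne_zero _ _) (character_ne_zero _ _)
  · simpa using hM p.1 x p.2 y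

lemma continuous_dualTransform (hΦ : Continuous Φ) (hW : Integrable W ν)
    {M : ℝ} (hM : ∀ α x β y, ‖Φ ((α, x), (β, y))‖ ≤ M * (W α * W β)) :
    Continuous fun t : Fˣ × Fˣ × Fˣ × Fˣ => dualTransform ν Φ t.1 t.2.1 t.2.2.1 t.2.2.2 := by
  unfold dualTransform
  refine continuous_of_dominated
    (fun t => (integrable_dualTransform_integrand hΦ hW hM _ _ _ _).aestronglyMeasurable)
    (fun t => ae_of_all _ fun p => ?_) ((hW.mul_prod hW).const_mul M) (ae_of_all _ fun p => ?_)
  · simpa using hM p.1 t.2.1 p.2 t.2.2.2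
  · refine Continuous.mul (by fun_prop) (Continuous.inv₀ ((continuous_character continuous_const
      (by fun_prop)).mul (continuous_character continuous_const (by fun_prop))) fun p => ?_)
    exact mul_ne_zero (character_ne_zero _ _) (character_ne_zero _ _)

lemma norm_dualTransform_le (hW : Integrable W ν) {M : ℝ} {n : ℕ}
    (hM : ∀ α x β y, ‖Φ ((α, x), (β, y))‖ ≤
        M * (W α * W β) * (logWeight n x * logWeight n y)) (u x v y : Fˣ) :
    ‖dualTransform ν Φ u x v y‖ ≤ M * (∫ α, W α ∂ν) ^ 2 * (logWeight n x * logWeight n y) := by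
  have h : ‖dualTransform ν Φ u x v y‖ ≤ ∫ p : PontryaginDual Fˣ × PontryaginDual Fˣ,
      M * (W p.1 * W p.2) * (logWeight n x * logWeight n y) ∂(ν.prod ν) := by
    refine norm_integral_le_of_norm_le (((hW.mul_prod hW).const_mul M).mul_const _)
      (ae_of_all _ fun p => ?_)
    simpa using hM p.1 x p.2 y
  rw [integral_mul_const, integral_const_mul, integral_prod_mul] at h
  rwa [sq]


lemma measurePreserving_prod_interchange {X Y : Type*} [MeasurableSpace X] [MeasurableSpace Y]
    (κ : Measure X) (m : Measure Y) [SFinite κ] [SFinite m] :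
    MeasurePreserving (fun p : (X × X) × (Y × Y) => ((p.1.1, p.2.1), (p.1.2, p.2.2)))
      ((κ.prod κ).prod (m.prod m)) ((κ.prod m).prod (κ.prod m)) := by
  have h₁ := measurePreserving_prodAssoc κ κ (m.prod m)
  have h₂ := (measurePreserving_prodAssoc κ m m).symm
  have h₃ : MeasurePreserving (Prod.swap : X × Y → Y × X) (κ.prod m) (m.prod κ) :=
    Measure.measurePreserving_swap
  have h₄ := measurePreserving_prodAssoc m κ m
  have h₅ := (measurePreserving_prodAssoc κ m (κ.prod m)).symm
  exact h₅.comp (((MeasurePreserving.id κ).prod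
    (h₄.comp ((h₃.prod (MeasurePreserving.id m)).comp h₂))).comp h₁)

/-- The kernel pairs `α` with `u` and `x` with `ξ`, so by Fubini the full transform is
`dualTransform` followed by a transform in `x` and `y`. -/
lemma fourierA₂_eq (hΦ : Continuous Φ) (hW : Integrable W ν) {M : ℝ} {n : ℕ}
    (hn : Integrable (logWeight n) (unitsHaar μ))
    (hM : ∀ α x β y, ‖Φ ((α, x), (β, y))‖ ≤
        M * (W α * W β) * (logWeight n x * logWeight n y)) (ξ η : PontryaginDual Fˣ) (u v : Fˣ) :
    fourierA₂ (unitsHaar μ) ν Φ ((ξ, u), (η, v)) =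
      ∫ x, (∫ y, dualTransform ν Φ u x v y * (η y : ℂ)⁻¹ ∂(unitsHaar μ)) * (ξ x : ℂ)⁻¹
        ∂(unitsHaar μ) := by
  set m := unitsHaar μ
  set H : GaussianGroup F × GaussianGroup F → ℂ := fun p =>
    Φ p * (fourierKernel p.1 (ξ, u) * fourierKernel p.2 (η, v))⁻¹
  have hH : Continuous H := by
    refine hΦ.mul (Continuous.inv₀ ?_ fun p => ?_)
    · unfold fourierKernel
      refine Continuous.mul (Continuous.mul ?_ ?_) (Continuous.mul ?_ ?_) <;>
        exact continuous_character (by fun_prop) (by fun_prop)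
    · simp [fourierKernel]
  have hmp := measurePreserving_prod_interchange ν m
  have hint : Integrable (fun p : (PontryaginDual Fˣ × PontryaginDual Fˣ) × (Fˣ × Fˣ) =>
      H ((p.1.1, p.2.1), (p.1.2, p.2.2))) ((ν.prod ν).prod (m.prod m)) := by
    refine (((hW.mul_prod hW).const_mul M).mul_prod (hn.mul_prod hn)).mono' ?_
      (ae_of_all _ fun p => ?_)
    · exact (hH.comp (by fun_prop)).aestronglyMeasurable
    · simpa [H, fourierKernel] using hM p.1.1 p.2.1 p.1.2 p.2.2
  have h1 : fourierA₂ m ν Φ ((ξ, u), (η, v)) =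
      ∫ p : (PontryaginDual Fˣ × PontryaginDual Fˣ) × (Fˣ × Fˣ),
        H ((p.1.1, p.2.1), (p.1.2, p.2.2)) ∂((ν.prod ν).prod (m.prod m)) := by
    rw [fourierA₂, ← hmp.map_eq, integral_map hmp.aemeasurable hH.aestronglyMeasurable]
  have h2 := hint.integral_prod_right
  rw [h1, integral_prod_symm _ hint, integral_prod _ h2]
  congr 1
  ext x
  rw [← integral_mul_const]
  congr 1
  ext y
  rw [dualTransform, ← integral_mul_const, ← integral_mul_const]
  congr 1
  ext p
  simp only [H, fourierKernel, mul_inv]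
  ring

/-- Decay in `u` and `v` is visible only in the full transform. Undoing the transforms in `x` and
then in `y`, each by `IsDualNormalized.norm_le`, carries it over to `dualTransform`. -/
lemma norm_dualTransform_le_of_fourier (hν : IsDualNormalized (unitsHaar μ) ν)
    (hΦ : Continuous Φ) (hW : Integrable W ν) {M : ℝ} {n : ℕ} (hM0 : 0 ≤ M)
    (hn : Integrable (logWeight n) (unitsHaar μ))
    (hM : ∀ α x β y, ‖Φ ((α, x), (β, y))‖ ≤
        M * (W α * W β) * (logWeight n x * logWeight n y))
    {V : PontryaginDual Fˣ → ℝ} (hV : Integrable V ν) {N : ℝ} {k : ℕ}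
    (hN : ∀ ξ u η v, ‖fourierA₂ (unitsHaar μ) ν Φ ((ξ, u), (η, v))‖ ≤
        N * (V ξ * V η) * (logWeight k u * logWeight k v)) (u x v y : Fˣ) :
    ‖dualTransform ν Φ u x v y‖ ≤
      N * (∫ ξ, V ξ ∂ν) ^ 2 * (logWeight k u * logWeight k v) := by
  set m := unitsHaar μ
  set K := M * (∫ α, W α ∂ν) ^ 2
  have hK0 : 0 ≤ K := by positivity
  have hMW : ∀ α x β y, ‖Φ ((α, x), (β, y))‖ ≤ M * (W α * W β) := fun α x β y => by
    refine (hM α x β y).trans ?_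
    have h0 : 0 ≤ M * (W α * W β) := by
      -- The weights equal `1` at the unit, so the bound there shows that `M * (W α * W β)` is
      -- nonnegative.
      have h := (norm_nonneg _).trans (hM α 1 β 1)
      simpa [logWeight, logSize] using h
    refine mul_le_of_le_one_right h0 (mul_le_one₀ (logWeight_le_one _ _) (logWeight_nonneg _ _)
      (logWeight_le_one _ _))
  have hf := continuous_dualTransform (ν := ν) hΦ hW hMW
  have hfb : ∀ x y, ‖dualTransform ν Φ u x v y‖ ≤ K * (logWeight n x * logWeight n y) :=
    fun x y => norm_dualTransform_le hW hM u x v y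
  have hfb' : ∀ x y, ‖dualTransform ν Φ u x v y‖ ≤ K * logWeight n y := fun x y => by
    refine (hfb x y).trans ?_
    gcongr
    exact mul_le_of_le_one_left (logWeight_nonneg _ _) (logWeight_le_one _ _)
  set h : PontryaginDual Fˣ → Fˣ → ℂ := fun η x =>
    ∫ y, dualTransform ν Φ u x v y * (η y : ℂ)⁻¹ ∂m
  have hcont : Continuous fun p : PontryaginDual Fˣ × Fˣ => h p.1 p.2 := by
    refine continuous_of_dominated (bound := fun y => K * logWeight n y) (fun p => ?_)
      (fun p => ae_of_all _ fun y => ?_) (hn.const_mul K) (ae_of_all _ fun y => ?_)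
    · refine Continuous.aestronglyMeasurable (Continuous.mul ?_ ?_)
      · exact hf.comp (g := fun t : Fˣ × Fˣ × Fˣ × Fˣ =>
          dualTransform ν Φ t.1 t.2.1 t.2.2.1 t.2.2.2) (f := fun y => (u, p.2, v, y)) (by fun_prop)
      · exact Continuous.inv₀ (continuous_character continuous_const continuous_id)
          fun y => character_ne_zero _ _
    · simpa using hfb' p.2 y
    · refine Continuous.mul ?_ ?_
      · exact hf.comp (g := fun t : Fˣ × Fˣ × Fˣ × Fˣ =>
          dualTransform ν Φ t.1 t.2.1 t.2.2.1 t.2.2.2)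
          (f := fun p : PontryaginDual Fˣ × Fˣ => (u, p.2, v, y)) (by fun_prop)
      · exact Continuous.inv₀ (continuous_character continuous_fst continuous_const)
          fun y => character_ne_zero _ _
  have hhb : ∀ η x, ‖h η x‖ ≤ K * (∫ y, logWeight n y ∂m) * logWeight n x := fun η x => by
    have : ‖h η x‖ ≤ ∫ y, K * (logWeight n x * logWeight n y) ∂m :=
      norm_integral_le_of_norm_le ((hn.const_mul _).const_mul K)
        (ae_of_all _ fun y => by simpa using hfb x y)
    rw [integral_const_mul, integral_const_mul] at this
    linarith
  have hh : ∀ η x, ‖h η x‖ ≤ N * (∫ ξ, V ξ ∂ν) * (logWeight k u * logWeight k v) * V η := by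
    intro η x
    have hc : Continuous (h η) := hcont.comp (f := fun x => (η, x)) (by fun_prop)
    have hi : Integrable (h η) m :=
      (hn.const_mul _).mono' hc.aestronglyMeasurable (ae_of_all _ (hhb η))
    have hFT : ∀ ξ, fourierTransform m (h η) ξ = fourierA₂ m ν Φ ((ξ, u), (η, v)) := fun ξ =>
      (fourierA₂_eq μ hΦ hW hn hM ξ η u v).symm
    have hb : Integrable (fun ξ => N * (logWeight k u * logWeight k v) * V η * V ξ) ν :=
      hV.const_mul _
    have := hν.norm_le hc hi hb ?_ (fun ξ => ?_) x
    · rw [integral_const_mul] at this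
      linarith
    · refine Continuous.aestronglyMeasurable ?_
      refine continuous_of_dominated (fun ξ => ?_) (fun ξ => ae_of_all _ fun y => ?_) hi.norm
        (ae_of_all _ fun y => ?_)
      · exact (hc.mul (Continuous.inv₀ (continuous_character continuous_const continuous_id)
          fun y => character_ne_zero _ _)).aestronglyMeasurable
      · simp
      · exact continuous_const.mul (Continuous.inv₀ (continuous_character continuous_id
          continuous_const) fun y => character_ne_zero _ _)
    · rw [hFT ξ]
      linarith [hN ξ u η v]
  have hc : Continuous fun y => dualTransform ν Φ u x v y :=
    hf.comp (g := fun t : Fˣ × Fˣ × Fˣ × Fˣ =>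
      dualTransform ν Φ t.1 t.2.1 t.2.2.1 t.2.2.2) (f := fun y => (u, x, v, y)) (by fun_prop)
  have hi : Integrable (fun y => dualTransform ν Φ u x v y) m :=
    (hn.const_mul K).mono' hc.aestronglyMeasurable (ae_of_all _ (hfb' x))
  have hFT : fourierTransform m (fun y => dualTransform ν Φ u x v y) = fun η => h η x := rfl
  have := hν.norm_le hc hi (hV.const_mul (N * (∫ ξ, V ξ ∂ν) * (logWeight k u * logWeight k v)))
    (hFT ▸ (hcont.comp (f := fun η => (η, x)) (by fun_prop)).aestronglyMeasurable)
    (fun η => hh η x) y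
  rw [integral_const_mul] at this
  linarith

/-- The transform of a Schwartz-Bruhat function in the dual variables is rapidly decreasing in all
four variables. -/
lemma IsSchwartzBruhat.exists_dualTransform_bound (hν : IsDualNormalized (unitsHaar μ) ν)
    (hΦ : IsSchwartzBruhat (unitsHaar μ) ν Φ) (n : ℕ) :
    ∃ M : ℝ, 0 ≤ M ∧ ∀ u x v y, ‖dualTransform ν Φ u x v y‖ ≤
      M * (logWeight n u * logWeight n x * (logWeight n v * logWeight n y)) := by
  obtain ⟨W, hW, hW0, hWb⟩ := hΦ.rapidlyDecreasing.exists_product_bound ν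
  obtain ⟨V, hV, hV0, hVb⟩ := hΦ.rapidlyDecreasing_fourier.exists_product_bound ν
  obtain ⟨d, hd⟩ := exists_integrable_logSize_pow μ
  obtain ⟨M₀, hM₀, hM₀b⟩ := hWb d
  obtain ⟨M, hM, hMb⟩ := hWb (2 * n)
  obtain ⟨N, hN, hNb⟩ := hVb (2 * n)
  refine ⟨M * (∫ α, W α ∂ν) ^ 2 + N * (∫ α, V α ∂ν) ^ 2, by positivity, fun u x v y => ?_⟩
  have h1 := norm_dualTransform_le hW hMb u x v y
  have h2 := norm_dualTransform_le_of_fourier μ hν hΦ.continuous hW hM₀ (hd d le_rfl) hM₀b hV hNb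
    u x v y
  -- The exponent `2 * n` gives the two bounds `A * p ^ 2` and `B * q ^ 2`; since the smaller of `p
  -- ^ 2` and `q ^ 2` is at most `p * q`, they combine to `(A + B) * (p * q)`.
  have hsq : ∀ a b : Fˣ, logWeight (2 * n) a * logWeight (2 * n) b =
      (logWeight n a * logWeight n b) ^ 2 := fun a b => by
    unfold logWeight
    ring
  rw [hsq] at h1 h2
  set p := logWeight n x * logWeight n y
  set q := logWeight n u * logWeight n v
  have hp : 0 ≤ p := mul_nonneg (logWeight_nonneg _ _) (logWeight_nonneg _ _)
  have hq : 0 ≤ q := mul_nonneg (logWeight_nonneg _ _) (logWeight_nonneg _ _)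
  have hA : 0 ≤ M * (∫ α, W α ∂ν) ^ 2 := by positivity
  have hB : 0 ≤ N * (∫ α, V α ∂ν) ^ 2 := by positivity
  rw [show logWeight n u * logWeight n x * (logWeight n v * logWeight n y) = p * q by
    simp only [p, q]; ring]
  rcases le_total p q with h | h
  · nlinarith [mul_le_mul_of_nonneg_left h hp, mul_nonneg hp hq,
      mul_nonneg hA (mul_nonneg hp (sub_nonneg.mpr h)), mul_nonneg hB (mul_nonneg hp hq)]
  · nlinarith [mul_le_mul_of_nonneg_left h hq, mul_nonneg hp hq,
      mul_nonneg hB (mul_nonneg hq (sub_nonneg.mpr h)), mul_nonneg hA (mul_nonneg hp hq)]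

end Partial

/-! ### An integrable majorant on the multiplicative group -/

section Majorant

variable {F : Type*} [NontriviallyNormedField F] [LocallyCompactSpace F]

/-- The function `(1 + ‖t‖) / ‖1 + t‖`. -/
def poleFactor (t : F) : ℝ := (1 + modulus t) / modulus (1 + t)

lemma poleFactor_nonneg (t : F) : 0 ≤ poleFactor t :=
  div_nonneg (by linarith [modulus_nonneg t]) (modulus_nonneg _)

lemma poleFactor_pos {t : F} (h : 1 + t ≠ 0) : 0 < poleFactor t :=
  div_pos (by linarith [modulus_nonneg t]) (modulus_pos h)

/-- A function with a logarithmically damped pole of order one at `-1`, and logarithmic decay. -/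
def majorant (n k : ℕ) (t : F) : ℝ :=
  (logSize t)⁻¹ ^ n * (poleFactor t * (logSize (1 + t))⁻¹ ^ k + logSize (1 + t) ^ k)

lemma majorant_nonneg (n k : ℕ) (t : F) : 0 ≤ majorant n k t := by
  have h1 := logSize_pos t
  have h2 := logSize_pos (1 + t)
  have h3 := poleFactor_nonneg t
  unfold majorant
  positivity

/-- Take `x ^ k / k! ≤ exp x` at `x = 1 + |log t|`, where `exp x = e / t`. -/
lemma one_add_neg_log_pow_le (k : ℕ) {t : ℝ} (h0 : 0 < t) (h1 : t ≤ 1) :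
    (1 + |Real.log t|) ^ k ≤ k.factorial * Real.exp 1 * t⁻¹ := by
  have hs : |Real.log t| = -Real.log t := abs_of_nonpos (Real.log_nonpos h0.le h1)
  have h := Real.pow_div_factorial_le_exp (1 + |Real.log t|) (by positivity) k
  rw [div_le_iff₀ (by positivity), Real.exp_add, hs, Real.exp_neg, Real.exp_log h0] at h
  rw [hs]
  linarith

-- Near the zero of `1 + t` a pole dominates any power of the logarithm. Where `1 + t` has module at
-- least one, `exists_modulus_one_add_le` compares its logarithm with that of `t`.
variable (F) in
lemma exists_logSize_one_add_pow_le (k : ℕ) :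
    ∃ c : ℝ, 0 ≤ c ∧ ∀ t : F, logSize (1 + t) ^ k ≤
      c * ((modulus (1 + t))⁻¹ * (logSize (1 + t))⁻¹ ^ k + logSize t ^ k) := by
  obtain ⟨K, hK, hKb⟩ := exists_modulus_one_add_le (F := F)
  have hlK : 0 ≤ Real.log K := Real.log_nonneg hK
  refine ⟨(2 * k).factorial * Real.exp 1 + (1 + Real.log K) ^ k, by positivity, fun t => ?_⟩
  set s := 1 + t
  have hs := logSize_pos s
  have ht := logSize_pos t
  have hfirst : 0 ≤ (modulus s)⁻¹ * (logSize s)⁻¹ ^ k := by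
    have := modulus_nonneg s
    positivity
  have htk : 0 ≤ logSize t ^ k := by positivity
  have hc1 : 0 ≤ (2 * k).factorial * Real.exp 1 := by positivity
  have hc2 : 0 ≤ (1 + Real.log K) ^ k := by positivity
  by_cases h0 : s = 0
  -- Here `log 0 = 0` and `0⁻¹ = 0`, so `logSize` is `1` and the pole term vanishes.
  · have h1 : logSize s ^ k = 1 := by simp [h0, logSize]
    have h2 : 1 ≤ logSize t ^ k := one_le_pow₀ (one_le_logSize t)
    have h3 : 1 ≤ (1 + Real.log K) ^ k := one_le_pow₀ (by linarith)
    rw [h1]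
    nlinarith [mul_nonneg hc1 hfirst, mul_nonneg hc2 hfirst, mul_nonneg hc1 htk,
      mul_le_mul h3 h2 zero_le_one hc2]
  · have hpos := modulus_pos h0
    rcases le_total (modulus s) 1 with h | h
    · have h1 := one_add_neg_log_pow_le (2 * k) hpos h
      have h2 : logSize s ^ k = logSize s ^ (2 * k) * (logSize s)⁻¹ ^ k := by
        rw [two_mul, pow_add, mul_assoc, ← mul_pow, mul_inv_cancel₀ hs.ne', one_pow, mul_one]
      have h3 : logSize s ^ k ≤ (2 * k).factorial * Real.exp 1 *
          ((modulus s)⁻¹ * (logSize s)⁻¹ ^ k) := by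
        rw [h2, ← mul_assoc]
        exact mul_le_mul_of_nonneg_right h1 (by positivity)
      nlinarith [mul_nonneg hc2 hfirst, mul_nonneg hc1 htk, mul_nonneg hc2 htk]
    · have h1 : Real.log (modulus s) ≤ Real.log K + |Real.log (modulus t)| := by
        have hmax : Real.log (max 1 (modulus t)) ≤ |Real.log (modulus t)| := by
          rcases le_total (modulus t) 1 with h' | h'
          · rw [max_eq_left h', Real.log_one]
            exact abs_nonneg _
          · rw [max_eq_right h']
            exact le_abs_self _
        have h2 := Real.log_le_log hpos (hKb t)
        rw [Real.log_mul (by positivity) (by positivity)] at h2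
        linarith
      have h3 : logSize s ≤ (1 + Real.log K) * logSize t := by
        unfold logSize
        rw [abs_of_nonneg (Real.log_nonneg h)]
        nlinarith [abs_nonneg (Real.log (modulus t)), mul_nonneg hlK (abs_nonneg
          (Real.log (modulus t)))]
      have h4 : logSize s ^ k ≤ (1 + Real.log K) ^ k * logSize t ^ k := by
        rw [← mul_pow]
        exact pow_le_pow_left₀ hs.le h3 k
      nlinarith [mul_nonneg hc1 hfirst, mul_nonneg hc2 hfirst, mul_nonneg hc1 htk]

variable [MeasurableSpace F] [BorelSpace F] (μ : Measure F) [μ.IsAddHaarMeasure]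

@[fun_prop]
lemma measurable_poleFactor : Measurable (poleFactor : F → ℝ) := by
  unfold poleFactor
  fun_prop

@[fun_prop]
lemma measurable_majorant (n k : ℕ) : Measurable (majorant n k : F → ℝ) := by
  unfold majorant
  fun_prop

/-- The shift by `1` carries an integrable power of `logSize` to a logarithmically damped simple
pole at `-1`. -/
lemma integrable_pole_one_add {k : ℕ}
    (hk : Integrable (fun x : Fˣ => (logSize (x : F))⁻¹ ^ k) (unitsHaar μ)) :
    Integrable (fun x : Fˣ => modulus (x : F) / modulus (1 + x : F) *
      (logSize (1 + x : F))⁻¹ ^ k) (unitsHaar μ) := by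
  have hnn : ∀ x : F, 0 ≤ (logSize x)⁻¹ ^ k := fun x =>
    pow_nonneg (inv_nonneg.mpr (logSize_pos _).le) _
  refine ⟨Measurable.aestronglyMeasurable (by fun_prop), ?_⟩
  have h1 := hk.2
  rw [hasFiniteIntegral_iff_ofReal (ae_of_all _ fun x => hnn _),
    lintegral_one_add μ (by fun_prop)] at h1
  rw [hasFiniteIntegral_iff_ofReal (ae_of_all _ fun x =>
    mul_nonneg (div_nonneg (modulus_nonneg _) (modulus_nonneg _)) (hnn _))]
  refine lt_of_eq_of_lt (lintegral_congr fun x => ?_) h1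
  rw [ENNReal.ofReal_mul (div_nonneg (modulus_nonneg _) (modulus_nonneg _))]
  by_cases h : (1 + x : F) = 0
  · simp [h]
  · rw [coe_toUnit h]

/-- Inversion on `F^×` exchanges `‖x‖ / ‖1 + x‖` and `1 / ‖1 + x‖`, at the cost of powers of
`logSize x`. -/
lemma integrable_pole_inv_one_add {k : ℕ}
    (hk : Integrable (fun x : Fˣ => (logSize (x : F))⁻¹ ^ k) (unitsHaar μ)) :
    Integrable (fun x : Fˣ => (modulus (1 + x : F))⁻¹ *
      ((logSize (x : F))⁻¹ ^ k * (logSize (1 + x : F))⁻¹ ^ k)) (unitsHaar μ) := by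
  have h1 := (integrable_pole_one_add μ hk).comp_inv
  refine h1.mono' (Measurable.aestronglyMeasurable (by fun_prop)) (ae_of_all _ fun x => ?_)
  have hx := modulus_units_pos x
  have hinv : (1 : F) + ((x⁻¹ : Fˣ) : F) = (1 + x) / x := by
    rw [Units.val_inv_eq_inv_val, add_div, div_self x.ne_zero, one_div, add_comm]
  have h2 := logSize_div_le (1 + x : F) x
  have e1 := logSize_pos (x : F)
  have e2 := logSize_pos (1 + x : F)
  have e3 := logSize_pos ((1 + x) / x : F)
  have e4 := modulus_nonneg (1 + x : F)
  rw [Real.norm_of_nonneg (by positivity), hinv, ← mul_pow, ← mul_inv, modulus_div,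
    Units.val_inv_eq_inv_val, modulus_inv]
  have h3 : (modulus (x : F))⁻¹ / (modulus (1 + x : F) / modulus (x : F)) =
      (modulus (1 + x : F))⁻¹ := by
    field_simp
  rw [h3, mul_comm (logSize (x : F))]
  gcongr

/-- The majorant is integrable for suitable exponents. -/
lemma exists_integrable_majorant :
    ∃ n k : ℕ, Integrable (fun x : Fˣ => majorant n k (x : F)) (unitsHaar μ) := by
  obtain ⟨d, hd⟩ := exists_integrable_logSize_pow μ
  obtain ⟨c, hc, hcb⟩ := exists_logSize_one_add_pow_le F d
  have hA := integrable_pole_one_add μ (hd d le_rfl)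
  have hB := integrable_pole_inv_one_add μ (hd d le_rfl)
  -- Of the `d + d` inverse powers of `logSize x`, one `d` cancels the growth allowed by `hcb` and
  -- the other gives integrability.
  refine ⟨d + d, d, (hA.add ((hB.const_mul (1 + c)).add ((hd d le_rfl).const_mul c))).mono'
    (Measurable.aestronglyMeasurable (by fun_prop)) (ae_of_all _ fun x => ?_)⟩
  have e1 := logSize_pos (x : F)
  have e2 := logSize_pos (1 + x : F)
  have e4 := modulus_nonneg (1 + x : F)
  have e5 := modulus_nonneg (x : F)
  rw [Real.norm_of_nonneg (majorant_nonneg _ _ _)]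
  simp only [majorant, Pi.add_apply, pow_add, poleFactor]
  set w := (logSize (x : F))⁻¹ ^ d with hw
  set w' := (logSize (1 + x : F))⁻¹ ^ d
  have hw0 : 0 ≤ w := by positivity
  have hw1 : w ≤ 1 := pow_le_one₀ (inv_nonneg.mpr e1.le) (inv_le_one_of_one_le₀ (one_le_logSize _))
  have hw'0 : 0 ≤ w' := by positivity
  have hwl : w * logSize (x : F) ^ d = 1 := by
    rw [hw, ← mul_pow, inv_mul_cancel₀ e1.ne', one_pow]
  have h1 : w * w * (modulus (x : F) / modulus (1 + x : F) * w') ≤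
      modulus (x : F) / modulus (1 + x : F) * w' :=
    mul_le_of_le_one_left (by positivity) (mul_le_one₀ hw1 hw0 hw1)
  have h2 : w * w * ((modulus (1 + x : F))⁻¹ * w') ≤ (modulus (1 + x : F))⁻¹ * (w * w') := by
    calc w * w * ((modulus (1 + x : F))⁻¹ * w') = w * ((modulus (1 + x : F))⁻¹ * (w * w')) := by
          ring
      _ ≤ _ := mul_le_of_le_one_left (by positivity) hw1
  have h3 : w * w * logSize (1 + x : F) ^ d ≤
      c * ((modulus (1 + x : F))⁻¹ * (w * w')) + c * w := by
    calc w * w * logSize (1 + x : F) ^ d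
        ≤ w * w * (c * ((modulus (1 + x : F))⁻¹ * w' + logSize (x : F) ^ d)) := by
          gcongr
          exact hcb x
      _ = c * (w * w * ((modulus (1 + x : F))⁻¹ * w')) + c * w * (w * logSize (x : F) ^ d) := by
          ring
      _ ≤ _ := by
          rw [hwl, mul_one]
          gcongr
  calc w * w * ((1 + modulus (x : F)) / modulus (1 + x : F) * w' + logSize (1 + x : F) ^ d)
      = w * w * (modulus (x : F) / modulus (1 + x : F) * w') +
        w * w * ((modulus (1 + x : F))⁻¹ * w') + w * w * logSize (1 + x : F) ^ d := by ring
    _ ≤ _ := by linarith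

end Majorant

/-! ### Changes of variables -/

section Transport

variable {X Y : Type*} [MeasurableSpace X] [MeasurableSpace Y] {κ : Measure X} {m : Measure Y}

/-- The substitution rule for nonnegative functions already identifies `m` as a pushforward, so
neither injectivity nor an inverse of `θ` is needed to pass to complex integrands. -/
lemma map_withDensity_eq_of_lintegral {θ : X → Y} (hθ : Measurable θ) {δ : X → ℝ}
    (hδ : Measurable δ)
    (h : ∀ H : Y → ENNReal, Measurable H →
      ∫⁻ y, H y ∂m = ∫⁻ x, ENNReal.ofReal (δ x) * H (θ x) ∂κ) :
    (κ.withDensity fun x => ENNReal.ofReal (δ x)).map θ = m := by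
  refine Measure.ext_of_lintegral _ fun H hH => ?_
  rw [lintegral_map hH hθ, lintegral_withDensity_eq_lintegral_mul _ hδ.ennreal_ofReal
      (g := fun x => H (θ x)) (by fun_prop),
    h H hH]
  rfl

lemma integrable_iff_of_lintegral {θ : X → Y} (hθ : Measurable θ) {δ : X → ℝ}
    (hδ : Measurable δ) (hδ0 : ∀ x, 0 ≤ δ x)
    (h : ∀ H : Y → ENNReal, Measurable H →
      ∫⁻ y, H y ∂m = ∫⁻ x, ENNReal.ofReal (δ x) * H (θ x) ∂κ)
    {f : Y → ℂ} (hf : Measurable f) :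
    Integrable f m ↔ Integrable (fun x => (δ x : ℂ) * f (θ x)) κ := by
  conv_lhs => rw [← map_withDensity_eq_of_lintegral hθ hδ h]
  rw [integrable_map_measure hf.aestronglyMeasurable hθ.aemeasurable,
    integrable_withDensity_iff_integrable_smul' hδ.ennreal_ofReal
      (ae_of_all _ fun _ => ENNReal.ofReal_lt_top)]
  refine iff_of_eq (congrArg (Integrable · κ) (funext fun x => ?_))
  rw [ENNReal.toReal_ofReal (hδ0 x), Complex.real_smul]
  rfl

lemma integral_eq_of_lintegral {θ : X → Y} (hθ : Measurable θ) {δ : X → ℝ}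
    (hδ : Measurable δ) (hδ0 : ∀ x, 0 ≤ δ x)
    (h : ∀ H : Y → ENNReal, Measurable H →
      ∫⁻ y, H y ∂m = ∫⁻ x, ENNReal.ofReal (δ x) * H (θ x) ∂κ)
    {f : Y → ℂ} (hf : Measurable f) :
    ∫ y, f y ∂m = ∫ x, (δ x : ℂ) * f (θ x) ∂κ := by
  conv_lhs => rw [← map_withDensity_eq_of_lintegral hθ hδ h]
  rw [integral_map hθ.aemeasurable hf.aestronglyMeasurable,
    integral_withDensity_eq_integral_toReal_smul hδ.ennreal_ofReal
      (ae_of_all _ fun _ => ENNReal.ofReal_lt_top)]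
  congr 1
  ext x
  rw [ENNReal.toReal_ofReal (hδ0 x), Complex.real_smul]

end Transport

section Substitution

variable {F : Type*} [NontriviallyNormedField F] [LocallyCompactSpace F]
  [MeasurableSpace F] [BorelSpace F] (μ : Measure F) [μ.IsAddHaarMeasure]

/-- The density `‖t‖ / ‖1 + t‖` of the substitution `t ↦ 1 + t` for the multiplicative measure. -/
def shiftDensity (t : F) : ℝ := modulus t / modulus (1 + t)

lemma shiftDensity_nonneg (t : F) : 0 ≤ shiftDensity t :=
  div_nonneg (modulus_nonneg _) (modulus_nonneg _)

@[fun_prop]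
lemma measurable_shiftDensity : Measurable (shiftDensity : F → ℝ) := by
  unfold shiftDensity
  fun_prop

lemma lintegral_div_one_add (w : Fˣ) {h : Fˣ → ENNReal} (hh : Measurable h) :
    ∫⁻ x, h x ∂(unitsHaar μ) =
      ∫⁻ s : Fˣ, ENNReal.ofReal (shiftDensity (s : F)) * h (w / toUnit (1 + s : F))
        ∂(unitsHaar μ) := by
  rw [← lintegral_div_left_eq_self h w,
    lintegral_one_add μ (h := fun x => h (w / x)) (by fun_prop)]
  rfl

lemma lintegral_one_sub (w : Fˣ) {h : Fˣ → ENNReal} (hh : Measurable h) :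
    ∫⁻ x, h x ∂(unitsHaar μ) =
      ∫⁻ r : Fˣ, ENNReal.ofReal (shiftDensity (-r : F)) * h (toUnit (1 - r : F) / w)
        ∂(unitsHaar μ) := by
  rw [← lintegral_div_right_eq_self h w,
    lintegral_one_add μ (h := fun x => h (x / w)) (by fun_prop),
    ← lintegral_mul_left_eq_self _ (-1 : Fˣ)]
  simp [shiftDensity, sub_eq_add_neg]

/-- This order, read with `(g, r, s)` in place of `(x, y, z)`, puts `g` innermost, where `r` and `s`
are fixed. -/
lemma lintegral_triple {f : Fˣ × Fˣ × Fˣ → ENNReal} (hf : Measurable f) :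
    ∫⁻ p, f p ∂((unitsHaar μ).prod ((unitsHaar μ).prod (unitsHaar μ))) =
      ∫⁻ y, ∫⁻ z, ∫⁻ x, f (x, y, z) ∂(unitsHaar μ) ∂(unitsHaar μ) ∂(unitsHaar μ) := by
  rw [lintegral_prod_symm _ hf.aemeasurable, lintegral_prod _ (by fun_prop)]

/-- The substitution for the integration variables `(x, y, z)` on the right hand side of the
pentagon relation, in terms of the argument `g` of the delta sequence. -/
def tripleSubst (A₀ A₂ A₄ : Fˣ) (p : Fˣ × Fˣ × Fˣ) : Fˣ × Fˣ × Fˣ :=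
  (toUnit (1 - p.2.1 : F) / A₂ / A₀ / toUnit (1 + p.2.2 : F),
    toUnit (1 - p.2.1 : F) / A₂ / A₄ / toUnit (1 + (p.1 * (p.2.1 / p.2.2) : Fˣ) : F),
    toUnit (1 - p.2.1 : F) / A₂)

/-- The density of `tripleSubst`. -/
def tripleDensity (p : Fˣ × Fˣ × Fˣ) : ℝ :=
  shiftDensity (-p.2.1 : F) * (shiftDensity (p.2.2 : F) *
    shiftDensity ((p.1 * (p.2.1 / p.2.2) : Fˣ) : F))

@[fun_prop]
lemma measurable_val : Measurable (Units.val : Fˣ → F) := measurableEmbedding_val.measurable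

lemma measurable_tripleSubst (A₀ A₂ A₄ : Fˣ) : Measurable (tripleSubst A₀ A₂ A₄) := by
  unfold tripleSubst
  fun_prop

lemma measurable_tripleDensity : Measurable (tripleDensity : Fˣ × Fˣ × Fˣ → ℝ) := by
  unfold tripleDensity
  fun_prop

lemma tripleDensity_nonneg (p : Fˣ × Fˣ × Fˣ) : 0 ≤ tripleDensity p :=
  mul_nonneg (shiftDensity_nonneg _) (mul_nonneg (shiftDensity_nonneg _) (shiftDensity_nonneg _))

/-- The substitution is triangular: `z` through `r`, then `x` through `s`, then `y` through `t`;
Haar invariance replaces `t` by `g * (r / s)`. -/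
lemma lintegral_tripleSubst (A₀ A₂ A₄ : Fˣ) (H : Fˣ × Fˣ × Fˣ → ENNReal) (hH : Measurable H) :
    ∫⁻ p, H p ∂((unitsHaar μ).prod ((unitsHaar μ).prod (unitsHaar μ))) =
      ∫⁻ p, ENNReal.ofReal (tripleDensity p) * H (tripleSubst A₀ A₂ A₄ p)
        ∂((unitsHaar μ).prod ((unitsHaar μ).prod (unitsHaar μ))) := by
  have hθ := measurable_tripleSubst A₀ A₂ A₄
  have hδ := measurable_tripleDensity (F := F)
  rw [lintegral_triple μ hH, lintegral_triple μ (f := fun p => ENNReal.ofReal (tripleDensity p) *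
    H (tripleSubst A₀ A₂ A₄ p)) (by fun_prop), lintegral_lintegral_swap (by fun_prop),
    lintegral_one_sub μ A₂ (by fun_prop)]
  refine lintegral_congr fun r => ?_
  set z : Fˣ := toUnit (1 - r : F) / A₂
  rw [lintegral_lintegral_swap (by fun_prop), lintegral_div_one_add μ (z / A₀) (by fun_prop),
    ← lintegral_const_mul _ (by fun_prop)]
  refine lintegral_congr fun s => ?_
  rw [lintegral_div_one_add μ (z / A₄) (by fun_prop), ← lintegral_mul_right_eq_self _ (r / s),
    ← lintegral_const_mul _ (by fun_prop), ← lintegral_const_mul _ (by fun_prop)]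
  refine lintegral_congr fun g => ?_
  rw [tripleDensity, ENNReal.ofReal_mul (shiftDensity_nonneg _),
    ENNReal.ofReal_mul (shiftDensity_nonneg _), mul_assoc, mul_assoc]
  rfl

/-- The substitution for the integration variables `(x, y)` on the left hand side of the pentagon
relation. -/
def pairSubst (A₁ A₃ : Fˣ) (p : Fˣ × Fˣ) : Fˣ × Fˣ :=
  (toUnit (1 - p.1 : F) / A₁ / toUnit (1 + p.2 : F),
    toUnit (1 - p.1 : F) / A₃ / toUnit (1 + (p.1 / p.2 : Fˣ) : F))

lemma measurable_pairSubst (A₁ A₃ : Fˣ) : Measurable (pairSubst A₁ A₃) := by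
  unfold pairSubst
  fun_prop

/-- Done in two one-variable steps: for fixed `x` put `A₃ y = 1 - r / (1 - A₁ x)`, then for fixed
`r` put `A₁ x = (1 - r) / (1 + s)`. The two Jacobians multiply to a density in `r` alone. -/
lemma lintegral_pairSubst (A₁ A₃ : Fˣ) (H : Fˣ × Fˣ → ENNReal) (hH : Measurable H) :
    ∫⁻ p, H p ∂((unitsHaar μ).prod (unitsHaar μ)) =
      ∫⁻ p, ENNReal.ofReal (shiftDensity (-p.1 : F)) * H (pairSubst A₁ A₃ p)
        ∂((unitsHaar μ).prod (unitsHaar μ)) := by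
  have hθ := measurable_pairSubst A₁ A₃
  have h1 : ∀ x : Fˣ, ∫⁻ y, H (x, y) ∂(unitsHaar μ) =
      ∫⁻ r : Fˣ, ENNReal.ofReal (shiftDensity (-(r / toUnit (1 - A₁ * x : F) : Fˣ) : F)) *
        H (x, toUnit (1 - (r / toUnit (1 - A₁ * x : F) : Fˣ) : F) / A₃) ∂(unitsHaar μ) := by
    intro x
    -- Haar invariance allows division by any unit, so the default value of `toUnit` at `A₁ x = 1`
    -- does no harm.
    rw [lintegral_one_sub μ A₃ (by fun_prop),
      ← lintegral_div_right_eq_self _ (toUnit (1 - A₁ * x : F))]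
  rw [lintegral_prod _ hH.aemeasurable, lintegral_prod _ (by fun_prop), funext h1,
    lintegral_lintegral_swap (by fun_prop)]
  refine lintegral_congr_ae ?_
  filter_upwards [compl_mem_ae_iff.mpr (measure_singleton (μ := unitsHaar μ) (1 : Fˣ))] with r hr
  have hr1 : (1 - r : F) ≠ 0 := fun h => hr (by
    rw [Set.mem_singleton_iff]
    ext
    rw [Units.val_one]
    linear_combination -h)
  rw [lintegral_div_one_add μ (toUnit (1 - r : F) / A₁) (by fun_prop)]
  refine lintegral_congr_ae ?_
  filter_upwards [compl_mem_ae_iff.mpr (measure_singleton (μ := unitsHaar μ) (-1 : Fˣ)),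
    compl_mem_ae_iff.mpr (measure_singleton (μ := unitsHaar μ) (-r : Fˣ))] with s hs hs'
  have hs1 : (1 + s : F) ≠ 0 := fun h => hs (by
    rw [Set.mem_singleton_iff]
    ext
    rw [Units.val_neg, Units.val_one]
    linear_combination h)
  have hsr : (s + r : F) ≠ 0 := fun h => hs' (by
    rw [Set.mem_singleton_iff]
    ext
    rw [Units.val_neg]
    linear_combination h)
  have hs0 := s.ne_zero
  have hr0 := r.ne_zero
  have hA := A₁.ne_zero
  set x : Fˣ := toUnit (1 - r : F) / A₁ / toUnit (1 + s : F) with hx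
  have hxv : (A₁ * x : F) = (1 - r) / (1 + s) := by
    rw [hx]
    simp only [Units.val_div_eq_div_val, coe_toUnit hr1, coe_toUnit hs1]
    field_simp
  have hU : (1 - A₁ * x : F) = (s + r) / (1 + s) := by
    rw [hxv]
    field_simp
    ring
  have hU0 : (1 - A₁ * x : F) ≠ 0 := by
    rw [hU]
    exact div_ne_zero hsr hs1
  have hV : ((r / toUnit (1 - A₁ * x : F) : Fˣ) : F) = r * (1 + s) / (s + r) := by
    rw [Units.val_div_eq_div_val, coe_toUnit hU0, hU]
    field_simp
  have hV1 : (1 - (r / toUnit (1 - A₁ * x : F) : Fˣ) : F) = s * (1 - r) / (s + r) := by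
    rw [hV]
    field_simp
    ring
  have hT : (1 + (r / s : Fˣ) : F) = (s + r) / s := by
    rw [Units.val_div_eq_div_val]
    field_simp
  have hT0 : (1 + (r / s : Fˣ) : F) ≠ 0 := by
    rw [hT]
    exact div_ne_zero hsr hs0
  have hy : toUnit (1 - (r / toUnit (1 - A₁ * x : F) : Fˣ) : F) / A₃ =
      toUnit (1 - r : F) / A₃ / toUnit (1 + (r / s : Fˣ) : F) := by
    ext
    simp only [Units.val_div_eq_div_val] at hV1 hT hT0 ⊢
    rw [coe_toUnit hr1, coe_toUnit hT0, coe_toUnit (by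
      rw [hV1]; exact div_ne_zero (mul_ne_zero hs0 hr1) hsr), hV1, hT]
    have := A₃.ne_zero
    field_simp
  have hd : shiftDensity (s : F) * shiftDensity (-(r / toUnit (1 - A₁ * x : F) : Fˣ) : F) =
      shiftDensity (-r : F) := by
    unfold shiftDensity
    rw [← sub_eq_add_neg, ← sub_eq_add_neg, hV1, modulus_neg, modulus_neg, hV]
    simp only [modulus_mul, modulus_div]
    have e1 := (modulus_pos hs1).ne'
    have e2 := (modulus_pos hs0).ne'
    have e3 := (modulus_pos hr1).ne'
    have e4 := (modulus_pos hsr).ne'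
    have e5 := (modulus_pos hr0).ne'
    field_simp
  rw [← mul_assoc, ← ENNReal.ofReal_mul (shiftDensity_nonneg _), hd, hy]
  rfl

/-- The involution that exchanges the two factors `s` and `t` of `g * r = s * t`. -/
def factorSwap (p : Fˣ × Fˣ × Fˣ) : Fˣ × Fˣ × Fˣ := (p.1, p.2.1, p.1 * (p.2.1 / p.2.2))

/-- For fixed `g` and `r`, the map `s ↦ g * r / s` is inversion followed by translation. -/
lemma measurePreserving_factorSwap_fiber (g : Fˣ) :
    MeasurePreserving (fun p : Fˣ × Fˣ => (p.1, g * (p.1 / p.2)))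
      ((unitsHaar μ).prod (unitsHaar μ)) ((unitsHaar μ).prod (unitsHaar μ)) := by
  refine (MeasurePreserving.id (unitsHaar μ)).skew_product (g := fun r s => g * (r / s))
    (by fun_prop) (ae_of_all _ fun r => ?_)
  have := (measurePreserving_mul_left (unitsHaar μ) g).comp
    (Measure.measurePreserving_div_left (unitsHaar μ) r)
  exact this.map_eq

lemma measurePreserving_factorSwap :
    MeasurePreserving (factorSwap : Fˣ × Fˣ × Fˣ → Fˣ × Fˣ × Fˣ)
      ((unitsHaar μ).prod ((unitsHaar μ).prod (unitsHaar μ)))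
      ((unitsHaar μ).prod ((unitsHaar μ).prod (unitsHaar μ))) := by
  refine (MeasurePreserving.id (unitsHaar μ)).skew_product
    (g := fun g (p : Fˣ × Fˣ) => (p.1, g * (p.1 / p.2)))
    (by fun_prop) (ae_of_all _ fun g => (measurePreserving_factorSwap_fiber μ g).map_eq)

end Substitution

/-! ### The integrals over the dual variables -/

section Inner

variable {F : Type*} [NontriviallyNormedField F]

lemma charValue_coe (α : PontryaginDual Fˣ) (u : Fˣ) : charValue α (u : F) = (α u : ℂ) := by
  rw [charValue, dif_neg u.ne_zero, Units.mk0_val]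

lemma Angle.unit_add (a b : Angle F) : Angle.unit (a + b) = Angle.unit a * Angle.unit b := rfl

lemma Angle.re_third (a c : Angle F) : Angle.re (Angle.third a c) = 1 - Angle.re a - Angle.re c :=
  rfl

variable [LocallyCompactSpace F]

lemma Psi_eq {a c : Angle F} {x p : Fˣ} (hp : (1 - Angle.unit a * x : F) = p)
    (α : PontryaginDual Fˣ) :
    Psi a c (α, x) = (α (p * Angle.unit c) : ℂ)⁻¹ *
      ((modulus (Angle.unit a * x : F) ^ Angle.re c / modulus (p : F) ^ (1 - Angle.re a) : ℝ) :
        ℂ) := by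
  rw [Psi, hp, ← Units.val_mul, charValue_coe]

lemma Psi_eq_zero {a c : Angle F} {x : Fˣ} (hp : (1 - Angle.unit a * x : F) = 0)
    (α : PontryaginDual Fˣ) : Psi a c (α, x) = 0 := by
  simp [Psi, hp, charValue]

/-- The product of the absolute values on the right hand side of the pentagon relation, where `p`,
`q` and `r` are the three factors of the form `1 - a'' x`. -/
def rightWeight (a c : Fin 5 → Angle F) (p q r : F) (x y z : Fˣ) : ℝ :=
  modulus (Angle.unit (a 0) * (x / z : Fˣ) : F) ^ Angle.re (c 0) / modulus p ^ (1 - Angle.re (a 0)) *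
  (modulus (Angle.unit (a 2) * z : F) ^ Angle.re (c 2) / modulus r ^ (1 - Angle.re (a 2))) *
  (modulus (Angle.unit (a 4) * (y / z : Fˣ) : F) ^ Angle.re (c 4) /
    modulus q ^ (1 - Angle.re (a 4)))

/-- The product of the absolute values on the left hand side of the pentagon relation. -/
def leftWeight (a c : Fin 5 → Angle F) (p q : F) (x y : Fˣ) : ℝ :=
  modulus (Angle.unit (a 1) * x : F) ^ Angle.re (c 1) / modulus p ^ (1 - Angle.re (a 1)) *
  (modulus (Angle.unit (a 3) * y : F) ^ Angle.re (c 3) / modulus q ^ (1 - Angle.re (a 3)))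

/-- All characters combine to one value for each of `α`, `β`, `γ`. The argument of `γ` is the future
coordinate `g`. -/
lemma pentagonIntegrand_eq {a c : Fin 5 → Angle F} {x y z p q r : Fˣ}
    (hp : (1 - Angle.unit (a 0) * (x / z : Fˣ) : F) = p)
    (hq : (1 - Angle.unit (a 4) * (y / z : Fˣ) : F) = q)
    (hr : (1 - Angle.unit (a 2) * z : F) = r) (α β γ : PontryaginDual Fˣ) :
    pentagonIntegrand a c α β γ x y z = (rightWeight a c p q r x y z : ℂ) *
      (((α (p * Angle.unit (c 0) * (z / y)) : ℂ) * (β (q * Angle.unit (c 4) * (z / x)) : ℂ))⁻¹ *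
        (γ (p * Angle.unit (c 0) * (q * Angle.unit (c 4)) / (r * Angle.unit (c 2)) *
          (z ^ 2 / (x * y))) : ℂ)) := by
  rw [pentagonIntegrand, Psi_eq hp, Psi_eq hq, Psi_eq hr, rightWeight]
  simp only [character_div_apply, map_mul, map_div, map_pow, Circle.coe_mul, Circle.coe_div,
    Circle.coe_pow, Complex.ofReal_mul]
  have h := fun (χ : PontryaginDual Fˣ) (u : Fˣ) => character_ne_zero χ u
  field_simp [h]

lemma leftIntegrand_eq {a c : Fin 5 → Angle F} {x y p q : Fˣ}
    (hp : (1 - Angle.unit (a 1) * x : F) = p) (hq : (1 - Angle.unit (a 3) * y : F) = q)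
    (α β : PontryaginDual Fˣ) :
    Psi (a 1) (c 1) (α, x) * Psi (a 3) (c 3) (β, y) = (leftWeight a c p q x y : ℂ) *
      ((α (p * Angle.unit (c 1)) : ℂ) * (β (q * Angle.unit (c 3)) : ℂ))⁻¹ := by
  rw [Psi_eq hp, Psi_eq hq, leftWeight, mul_inv, Complex.ofReal_mul]
  ring

section Product

variable {X : Type*} [MeasurableSpace X] {κ : Measure X} [SFinite κ]
  {f : X × X → ℂ} {h : X → ℂ}

lemma integrable_triple_mul (hf : Integrable f (κ.prod κ)) (hh : Integrable h κ) :
    Integrable (fun χ : X × X × X => f (χ.1, χ.2.1) * h χ.2.2) (κ.prod (κ.prod κ)) := by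
  have := (measurePreserving_prodAssoc κ κ κ).symm
  exact (this.integrable_comp_emb (MeasurableEquiv.measurableEmbedding _)).mpr (hf.mul_prod hh)

lemma integral_triple_mul :
    ∫ χ : X × X × X, f (χ.1, χ.2.1) * h χ.2.2 ∂(κ.prod (κ.prod κ)) =
      (∫ p, f p ∂(κ.prod κ)) * ∫ x, h x ∂κ := by
  have := (measurePreserving_prodAssoc κ κ κ).symm
  rw [← integral_prod_mul,
    ← this.integral_comp (MeasurableEquiv.measurableEmbedding _) (fun z => f z.1 * h z.2)]
  rfl

end Product

variable [MeasurableSpace F] [BorelSpace F]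
  [MeasurableSpace (PontryaginDual Fˣ)] [BorelSpace (PontryaginDual Fˣ)]
  (μ : Measure F) [μ.IsAddHaarMeasure] (ν : Measure (PontryaginDual Fˣ)) [ν.IsHaarMeasure]

open Classical in
/-- The integral over the dual variables on the right hand side of the pentagon relation. -/
def rightOuter (a c : Fin 5 → Angle F) (Φ : GaussianGroup F × GaussianGroup F → ℂ) (ρ : Fˣ → ℝ)
    (t : Fˣ × Fˣ × Fˣ) : ℂ :=
  let p := (1 - Angle.unit (a 0) * (t.1 / t.2.2 : Fˣ) : F)
  let q := (1 - Angle.unit (a 4) * (t.2.1 / t.2.2 : Fˣ) : F)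
  let r := (1 - Angle.unit (a 2) * t.2.2 : F)
  if p = 0 ∨ q = 0 ∨ r = 0 then 0 else
    (rightWeight a c p q r t.1 t.2.1 t.2.2 : ℂ) *
      (dualTransform ν Φ (toUnit p * Angle.unit (c 0) * (t.2.2 / t.2.1)) t.1
        (toUnit q * Angle.unit (c 4) * (t.2.2 / t.1)) t.2.1 *
      (ρ (toUnit p * Angle.unit (c 0) * (toUnit q * Angle.unit (c 4)) /
        (toUnit r * Angle.unit (c 2)) * (t.2.2 ^ 2 / (t.1 * t.2.1))) : ℂ))

open Classical in
/-- The integral over the dual variables on the left hand side of the pentagon relation. -/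
def leftOuter (a c : Fin 5 → Angle F) (Φ : GaussianGroup F × GaussianGroup F → ℂ)
    (t : Fˣ × Fˣ) : ℂ :=
  let p := (1 - Angle.unit (a 1) * t.1 : F)
  let q := (1 - Angle.unit (a 3) * t.2 : F)
  if p = 0 ∨ q = 0 then 0 else
    (leftWeight a c p q t.1 t.2 : ℂ) *
      dualTransform ν Φ (toUnit p * Angle.unit (c 1)) t.1 (toUnit q * Angle.unit (c 3)) t.2

variable {ν} {Φ : GaussianGroup F × GaussianGroup F → ℂ} {W : PontryaginDual Fˣ → ℝ}

lemma left_inner (a c : Fin 5 → Angle F) (hΦ : Continuous Φ) (hW : Integrable W ν) {M : ℝ}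
    (hM : ∀ α x β y, ‖Φ ((α, x), (β, y))‖ ≤ M * (W α * W β)) (t : Fˣ × Fˣ) :
    Integrable (fun χ : PontryaginDual Fˣ × PontryaginDual Fˣ =>
      Psi (a 1) (c 1) (χ.1, t.1) * Psi (a 3) (c 3) (χ.2, t.2) * Φ ((χ.1, t.1), (χ.2, t.2)))
      (ν.prod ν) ∧
    ∫ χ : PontryaginDual Fˣ × PontryaginDual Fˣ,
      Psi (a 1) (c 1) (χ.1, t.1) * Psi (a 3) (c 3) (χ.2, t.2) * Φ ((χ.1, t.1), (χ.2, t.2))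
      ∂(ν.prod ν) = leftOuter ν a c Φ t := by
  simp only [leftOuter]
  split_ifs with h
  · have h0 : ∀ χ : PontryaginDual Fˣ × PontryaginDual Fˣ,
        Psi (a 1) (c 1) (χ.1, t.1) * Psi (a 3) (c 3) (χ.2, t.2) * Φ ((χ.1, t.1), (χ.2, t.2)) = 0 := by
      intro χ
      rcases h with h | h <;> simp [Psi_eq_zero h]
    simp [h0]
  · push Not at h
    have key := fun χ : PontryaginDual Fˣ × PontryaginDual Fˣ =>
      leftIntegrand_eq (c := c) (coe_toUnit h.1).symm (coe_toUnit h.2).symm χ.1 χ.2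
    rw [coe_toUnit h.1, coe_toUnit h.2] at key
    simp only [key]
    set p := (1 - Angle.unit (a 1) * t.1 : F)
    set q := (1 - Angle.unit (a 3) * t.2 : F)
    have hi := (integrable_dualTransform_integrand hΦ hW hM (toUnit p * Angle.unit (c 1)) t.1
      (toUnit q * Angle.unit (c 3)) t.2).const_mul (leftWeight a c p q t.1 t.2 : ℂ)
    constructor
    · refine hi.congr (ae_of_all _ fun χ => ?_)
      simp only
      ring
    · rw [dualTransform, ← integral_const_mul]
      congr 1
      ext χ
      ring

/-- The integral over `α, β` is a value of `dualTransform`, and the one over `γ` is Fourier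
inversion for `ρ`. At a pole both sides vanish, since `Psi` is `0` there. -/
lemma right_inner (a c : Fin 5 → Angle F) (hν : IsDualNormalized (unitsHaar μ) ν)
    (hΦ : Continuous Φ) (hW : Integrable W ν) {M : ℝ}
    (hM : ∀ α x β y, ‖Φ ((α, x), (β, y))‖ ≤ M * (W α * W β)) {ρ : Fˣ → ℝ} (hρ : Continuous ρ)
    (hρc : HasCompactSupport ρ)
    (hρi : Integrable (fourierTransform (unitsHaar μ) fun x => (ρ x : ℂ)) ν) (t : Fˣ × Fˣ × Fˣ) :
    Integrable (fun χ : PontryaginDual Fˣ × PontryaginDual Fˣ × PontryaginDual Fˣ =>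
      pentagonIntegrand a c χ.1 χ.2.1 χ.2.2 t.1 t.2.1 t.2.2 *
        fourierTransform (unitsHaar μ) (fun x => (ρ x : ℂ)) χ.2.2 *
        Φ ((χ.1, t.1), (χ.2.1, t.2.1))) (ν.prod (ν.prod ν)) ∧
    ∫ χ : PontryaginDual Fˣ × PontryaginDual Fˣ × PontryaginDual Fˣ,
      pentagonIntegrand a c χ.1 χ.2.1 χ.2.2 t.1 t.2.1 t.2.2 *
        fourierTransform (unitsHaar μ) (fun x => (ρ x : ℂ)) χ.2.2 *
        Φ ((χ.1, t.1), (χ.2.1, t.2.1)) ∂(ν.prod (ν.prod ν)) = rightOuter ν a c Φ ρ t := by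
  simp only [rightOuter]
  split_ifs with h
  · have h0 : ∀ χ : PontryaginDual Fˣ × PontryaginDual Fˣ × PontryaginDual Fˣ,
        pentagonIntegrand a c χ.1 χ.2.1 χ.2.2 t.1 t.2.1 t.2.2 = 0 := by
      intro χ
      unfold pentagonIntegrand
      rcases h with h | h | h <;> simp [Psi_eq_zero h]
    simp [h0]
  · push Not at h
    obtain ⟨hp, hq, hr⟩ := h
    have key := fun χ : PontryaginDual Fˣ × PontryaginDual Fˣ × PontryaginDual Fˣ =>
      pentagonIntegrand_eq (c := c) (coe_toUnit hp).symm (coe_toUnit hq).symm (coe_toUnit hr).symm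
        χ.1 χ.2.1 χ.2.2
    rw [coe_toUnit hp, coe_toUnit hq, coe_toUnit hr] at key
    simp only [key]
    set p := (1 - Angle.unit (a 0) * (t.1 / t.2.2 : Fˣ) : F)
    set q := (1 - Angle.unit (a 4) * (t.2.1 / t.2.2 : Fˣ) : F)
    set r := (1 - Angle.unit (a 2) * t.2.2 : F)
    set g := toUnit p * Angle.unit (c 0) * (toUnit q * Angle.unit (c 4)) /
        (toUnit r * Angle.unit (c 2)) * (t.2.2 ^ 2 / (t.1 * t.2.1))
    set ρ' := fourierTransform (unitsHaar μ) fun x => (ρ x : ℂ)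
    have hρ1 : Continuous fun x => (ρ x : ℂ) := by fun_prop
    have hρ2 : Integrable (fun x => (ρ x : ℂ)) (unitsHaar μ) :=
      hρ1.integrable_of_hasCompactSupport (hρc.comp_left Complex.ofReal_zero)
    have hi₁ := integrable_dualTransform_integrand hΦ hW hM (toUnit p * Angle.unit (c 0) *
      (t.2.2 / t.2.1)) t.1 (toUnit q * Angle.unit (c 4) * (t.2.2 / t.1)) t.2.1
    have hi₂ := integrable_mul_character hρi g
    have hρg : ∫ χ, ρ' χ * (χ g : ℂ) ∂ν = ρ g := hν.inversion hρ1 hρ2 hρi g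
    constructor
    · refine ((integrable_triple_mul hi₁ hi₂).const_mul
        (rightWeight a c p q r t.1 t.2.1 t.2.2 : ℂ)).congr (ae_of_all _ fun χ => ?_)
      simp only
      ring
    · rw [← hρg, dualTransform, ← integral_triple_mul, ← integral_const_mul]
      congr 1
      ext χ
      ring

lemma measurable_dualTransform (hΦ : Continuous Φ) (hW : Integrable W ν)
    {M : ℝ} (hM : ∀ α x β y, ‖Φ ((α, x), (β, y))‖ ≤ M * (W α * W β)) {X : Type*}
    [MeasurableSpace X] {u x v y : X → Fˣ} (hu : Measurable u) (hx : Measurable x)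
    (hv : Measurable v) (hy : Measurable y) :
    Measurable fun t => dualTransform ν Φ (u t) (x t) (v t) (y t) :=
  (continuous_dualTransform hΦ hW hM).measurable.comp (hu.prodMk (hx.prodMk (hv.prodMk hy)))

lemma measurable_leftOuter (a c : Fin 5 → Angle F) (hΦ : Continuous Φ) (hW : Integrable W ν)
    {M : ℝ} (hM : ∀ α x β y, ‖Φ ((α, x), (β, y))‖ ≤ M * (W α * W β)) :
    Measurable (leftOuter ν a c Φ) := by
  unfold leftOuter leftWeight
  refine Measurable.ite ?_ measurable_const (Measurable.mul (by fun_prop)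
    (measurable_dualTransform hΦ hW hM (by fun_prop) (by fun_prop) (by fun_prop) (by fun_prop)))
  exact (measurableSet_eq_fun (by fun_prop) (by fun_prop)).union
    (measurableSet_eq_fun (by fun_prop) (by fun_prop))

lemma measurable_rightOuter (a c : Fin 5 → Angle F) (hΦ : Continuous Φ) (hW : Integrable W ν)
    {M : ℝ} (hM : ∀ α x β y, ‖Φ ((α, x), (β, y))‖ ≤ M * (W α * W β)) {ρ : Fˣ → ℝ}
    (hρ : Continuous ρ) : Measurable (rightOuter ν a c Φ ρ) := by
  have hρm := hρ.measurable
  unfold rightOuter rightWeight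
  refine Measurable.ite ?_ measurable_const (Measurable.mul (by fun_prop) (Measurable.mul
    (measurable_dualTransform hΦ hW hM (by fun_prop) (by fun_prop) (by fun_prop) (by fun_prop))
    (by fun_prop)))
  exact (measurableSet_eq_fun (by fun_prop) (by fun_prop)).union
    ((measurableSet_eq_fun (by fun_prop) (by fun_prop)).union
    (measurableSet_eq_fun (by fun_prop) (by fun_prop)))

end Inner

/-! ### The common integrand of both sides -/

section Core

/-- The weight that both sides of the pentagon relation have in the coordinates `s`, `t`, `r`, where
`p`, `q`, `z` stand for `1 + s`, `1 + t`, `1 - r`. -/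
def coreWeight (a₀ c₀ a₄ c₄ a₂ c₂ s p t q r z : ℝ) : ℝ :=
  s ^ a₀ * p ^ (-(a₀ + c₀)) * (t ^ a₄ * q ^ (-(a₄ + c₄))) * (r ^ a₂ * z ^ (c₂ - 1))

/-- The first three quotients are the Jacobian of the substitution. Writing positive numbers as
exponentials reduces this identity of monomials to a linear one between exponents. -/
lemma coreWeight_eq_right (a₀ c₀ a₄ c₄ a₂ c₂ : ℝ) {s p t q r z : ℝ} (hs : 0 < s) (hp : 0 < p)
    (ht : 0 < t) (hq : 0 < q) (hr : 0 < r) (hz : 0 < z) :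
    r / z * (s / p * (t / q)) * (p⁻¹ ^ c₀ / (s / p) ^ (1 - a₀) * (z ^ c₂ / r ^ (1 - a₂)) *
      (q⁻¹ ^ c₄ / (t / q) ^ (1 - a₄))) = coreWeight a₀ c₀ a₄ c₄ a₂ c₂ s p t q r z := by
  unfold coreWeight
  rw [← Real.exp_log hs, ← Real.exp_log hp, ← Real.exp_log ht, ← Real.exp_log hq,
    ← Real.exp_log hr, ← Real.exp_log hz]
  simp only [← Real.exp_neg, ← Real.exp_sub, ← Real.exp_add, ← Real.exp_mul]
  congr 1
  ring

/-- In contrast to the right hand side, this uses both `r = s * t` and the relation between the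
angles. -/
lemma coreWeight_eq_left (a₀ c₀ a₄ c₄ a₂ c₂ : ℝ) {s p t q r z : ℝ} (hs : 0 < s) (hp : 0 < p)
    (ht : 0 < t) (hq : 0 < q) (hr : r = s * t) (hz : 0 < z) (hc : c₂ = c₀ + a₄ + (a₀ + c₄)) :
    r / z * ((z / p) ^ (c₀ + a₄) / (s * (q / p)) ^ (1 - (a₀ + a₂)) *
      ((z / q) ^ (a₀ + c₄) / (t * (p / q)) ^ (1 - (a₂ + a₄)))) =
      coreWeight a₀ c₀ a₄ c₄ a₂ c₂ s p t q r z := by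
  unfold coreWeight
  rw [hr, hc, ← Real.exp_log hs, ← Real.exp_log hp, ← Real.exp_log ht, ← Real.exp_log hq,
    ← Real.exp_log hz]
  simp only [← Real.exp_sub, ← Real.exp_add, ← Real.exp_mul]
  congr 1
  ring

lemma coreWeight_nonneg (a₀ c₀ a₄ c₄ a₂ c₂ : ℝ) {s p t q r z : ℝ} (hs : 0 ≤ s) (hp : 0 ≤ p)
    (ht : 0 ≤ t) (hq : 0 ≤ q) (hr : 0 ≤ r) (hz : 0 ≤ z) :
    0 ≤ coreWeight a₀ c₀ a₄ c₄ a₂ c₂ s p t q r z := by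
  unfold coreWeight
  positivity

/-- The arithmetic-geometric mean inequality separates the three poles of the weight. -/
lemma coreWeight_le {a₀ c₀ a₄ c₄ a₂ c₂ : ℝ} (ha₀ : 0 ≤ a₀) (hc₀ : 0 ≤ c₀) (ha₄ : 0 ≤ a₄)
    (hc₄ : 0 ≤ c₄) (ha₂ : 0 ≤ a₂) (hb₂ : a₂ + c₂ ≤ 1) (hc : c₂ = c₀ + a₄ + (a₀ + c₄))
    {s p t q r z : ℝ} (hs : 0 < s) (hp : 0 < p) (ht : 0 < t) (hq : 0 < q) (hr : 0 < r)
    (hz : 0 < z) :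
    coreWeight a₀ c₀ a₄ c₄ a₂ c₂ s p t q r z ≤ (1 + s) / p + (1 + r) / z + (1 + t) / q := by
  have key : ∀ {a e x y : ℝ}, 0 ≤ a → a ≤ e → 0 < x → 0 < y →
      x ^ a * y ^ (-e) ≤ ((1 + x) / y) ^ e := by
    intro a e x y ha hae hx hy
    rw [Real.div_rpow (by linarith) hy.le, Real.rpow_neg hy.le, div_eq_mul_inv]
    gcongr
    calc x ^ a ≤ (1 + x) ^ a := Real.rpow_le_rpow hx.le (by linarith) ha
      _ ≤ (1 + x) ^ e := Real.rpow_le_rpow_of_exponent_le (by linarith) hae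
  have h1 := key ha₀ (show a₀ ≤ a₀ + c₀ by linarith) hs hp
  have h2 := key ha₄ (show a₄ ≤ a₄ + c₄ by linarith) ht hq
  -- The inequality `a₂ ≤ 1 - c₂` says that the third angle `b₂` is nonnegative.
  have h3 := key ha₂ (show a₂ ≤ 1 - c₂ by linarith) hr hz
  rw [neg_sub] at h3
  have e1 : 0 ≤ (1 + s) / p := by positivity
  have e2 : 0 ≤ (1 + t) / q := by positivity
  have e3 : 0 ≤ (1 + r) / z := by positivity
  -- The three exponents add up to one by `hc`; this is why only simple poles occur.
  have h4 := Real.geom_mean_le_arith_mean3_weighted (w₁ := a₀ + c₀) (w₂ := a₄ + c₄) (w₃ := 1 - c₂)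
    (by linarith) (by linarith) (by linarith) e1 e2 e3 (by linarith)
  have h5 : coreWeight a₀ c₀ a₄ c₄ a₂ c₂ s p t q r z ≤
      ((1 + s) / p) ^ (a₀ + c₀) * ((1 + t) / q) ^ (a₄ + c₄) * ((1 + r) / z) ^ (1 - c₂) := by
    unfold coreWeight
    gcongr
  have h6 : (a₀ + c₀) * ((1 + s) / p) ≤ (1 + s) / p := mul_le_of_le_one_left e1 (by linarith)
  have h7 : (a₄ + c₄) * ((1 + t) / q) ≤ (1 + t) / q := mul_le_of_le_one_left e2 (by linarith)
  have h8 : (1 - c₂) * ((1 + r) / z) ≤ (1 + r) / z := mul_le_of_le_one_left e3 (by linarith)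
  linarith

variable {F : Type*} [NontriviallyNormedField F]

/-- The conditions on the angles in the pentagon relation. -/
structure PentagonAngles (a c : Fin 5 → Angle F) : Prop where
  positive : ∀ i, Angle.Positive (a i) (c i)
  a₃ : a 3 = a 2 + a 4
  c₃ : c 3 = a 0 + c 4
  c₁ : c 1 = c 0 + a 4
  a₁ : a 1 = a 0 + a 2
  c₂ : c 2 = c 1 + c 3

/-- The coordinates `(g, r, s)` for which the points `s`, `r`, `t = g r / s` avoid the poles. -/
def Admissible (p : Fˣ × Fˣ × Fˣ) : Prop :=
  (1 + p.2.2 : F) ≠ 0 ∧ (1 - p.2.1 : F) ≠ 0 ∧ (1 + (p.1 * (p.2.1 / p.2.2) : Fˣ) : F) ≠ 0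

variable [LocallyCompactSpace F] [MeasurableSpace (PontryaginDual Fˣ)]
  (ν : Measure (PontryaginDual Fˣ))

open Classical in
/-- The integrand of both sides of the pentagon relation, without the delta sequence, in the
coordinates `(g, r, s)`. -/
def core (a c : Fin 5 → Angle F) (Φ : GaussianGroup F × GaussianGroup F → ℂ)
    (p : Fˣ × Fˣ × Fˣ) : ℂ :=
  let s := p.2.2
  let t := p.1 * (p.2.1 / p.2.2)
  let P := toUnit (1 + s : F)
  let Q := toUnit (1 + t : F)
  let Z := toUnit (1 - p.2.1 : F)
  if Admissible p then
    (coreWeight (Angle.re (a 0)) (Angle.re (c 0)) (Angle.re (a 4)) (Angle.re (c 4))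
      (Angle.re (a 2)) (Angle.re (c 2)) (modulus (s : F)) (modulus (1 + s : F)) (modulus (t : F))
      (modulus (1 + t : F)) (modulus (p.2.1 : F)) (modulus (1 - p.2.1 : F)) : ℂ) *
    dualTransform ν Φ (Angle.unit (c 1) * (s * (Q / P))) (Z / Angle.unit (a 1) / P)
      (Angle.unit (c 3) * (t * (P / Q))) (Z / Angle.unit (a 3) / Q)
  else 0

variable {ν}

lemma shiftDensity_eq_zero {t : F} (h : 1 + t = 0) : shiftDensity t = 0 := by
  simp [shiftDensity, h]

/-- In these coordinates the three factors `1 - a'' x` become `s / P`, `t / Q` and `r`. The `F^×`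
components of the angle relations then give the arguments in `core`, and `s * t = g * r` makes the
argument of `ρ` equal to `g`. -/
lemma tripleDensity_mul_rightOuter {a c : Fin 5 → Angle F} (h : PentagonAngles a c)
    (Φ : GaussianGroup F × GaussianGroup F → ℂ) (ρ : Fˣ → ℝ) (p : Fˣ × Fˣ × Fˣ) :
    (tripleDensity p : ℂ) * rightOuter ν a c Φ ρ
      (tripleSubst (Angle.unit (a 0)) (Angle.unit (a 2)) (Angle.unit (a 4)) p) =
      (ρ p.1 : ℂ) * core ν a c Φ p := by
  obtain ⟨g, r, s⟩ := p
  by_cases hadm : Admissible (g, r, s)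
  · rw [core, if_pos hadm]
    obtain ⟨hP, hZ, hQ⟩ := hadm
    simp only at hP hZ hQ ⊢
    simp only [tripleDensity, tripleSubst]
    have hst : (s : F) * ((g * (r / s) : Fˣ) : F) = g * r := by
      simp only [Units.val_mul, Units.val_div_eq_div_val]
      field_simp
    set t := g * (r / s) with ht
    obtain ⟨P, hPv⟩ : ∃ P : Fˣ, (P : F) = 1 + s := ⟨Units.mk0 _ hP, rfl⟩
    obtain ⟨Q, hQv⟩ : ∃ Q : Fˣ, (Q : F) = 1 + t := ⟨Units.mk0 _ hQ, rfl⟩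
    obtain ⟨Z, hZv⟩ : ∃ Z : Fˣ, (Z : F) = 1 - r := ⟨Units.mk0 _ hZ, rfl⟩
    rw [← hPv, ← hQv, ← hZv]
    simp only [toUnit_coe]
    set A₀ := Angle.unit (a 0)
    set A₂ := Angle.unit (a 2)
    set A₄ := Angle.unit (a 4)
    set z := Z / A₂ with hz
    set x := z / A₀ / P with hx
    set y := z / A₄ / Q with hy
    have e1 : (A₀ : F) * (x / z : Fˣ) = (P⁻¹ : Fˣ) := by
      simp only [hx, Units.val_div_eq_div_val, Units.val_inv_eq_inv_val]
      field_simp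
    have e2 : (A₄ : F) * (y / z : Fˣ) = (Q⁻¹ : Fˣ) := by
      simp only [hy, Units.val_div_eq_div_val, Units.val_inv_eq_inv_val]
      field_simp
    have e3 : (A₂ : F) * z = Z := by
      simp only [hz, Units.val_div_eq_div_val]
      field_simp
    have hp : (1 - A₀ * (x / z : Fˣ) : F) = (s / P : Fˣ) := by
      rw [e1, Units.val_inv_eq_inv_val, Units.val_div_eq_div_val]
      field_simp
      rw [hPv]
      ring
    have hq : (1 - A₄ * (y / z : Fˣ) : F) = (t / Q : Fˣ) := by
      rw [e2, Units.val_inv_eq_inv_val, Units.val_div_eq_div_val]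
      field_simp
      rw [hQv]
      ring
    have hr : (1 - A₂ * z : F) = r := by
      rw [e3, hZv]
      ring
    have hnot : ¬(((s / P : Fˣ) : F) = 0 ∨ ((t / Q : Fˣ) : F) = 0 ∨ (r : F) = 0) := by
      push Not
      exact ⟨Units.ne_zero _, Units.ne_zero _, Units.ne_zero _⟩
    have hA₁ : Angle.unit (a 1) = A₀ * A₂ := by rw [h.a₁]; rfl
    have hA₃ : Angle.unit (a 3) = A₂ * A₄ := by rw [h.a₃]; rfl
    have hC₁ : Angle.unit (c 1) = Angle.unit (c 0) * A₄ := by rw [h.c₁]; rfl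
    have hC₃ : Angle.unit (c 3) = A₀ * Angle.unit (c 4) := by rw [h.c₃]; rfl
    have hC₂ : Angle.unit (c 2) = Angle.unit (c 0) * A₄ * (A₀ * Angle.unit (c 4)) := by
      rw [h.c₂, Angle.unit_add, hC₁, hC₃]
    simp only [rightOuter]
    rw [hp, hq, hr, if_neg hnot]
    simp only [toUnit_coe]
    have eu : s / P * Angle.unit (c 0) * (z / y) = Angle.unit (c 1) * (s * (Q / P)) := by
      rw [hC₁, hy]
      ext
      simp only [Units.val_mul, Units.val_div_eq_div_val]
      field_simp
    have ev : t / Q * Angle.unit (c 4) * (z / x) = Angle.unit (c 3) * (t * (P / Q)) := by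
      rw [hC₃, hx]
      ext
      simp only [Units.val_mul, Units.val_div_eq_div_val]
      field_simp
    have ex : x = Z / Angle.unit (a 1) / P := by
      rw [hx, hz, hA₁, div_div Z, mul_comm]
    have ey : y = Z / Angle.unit (a 3) / Q := by
      rw [hy, hz, hA₃, div_div Z]
    have eg : s / P * Angle.unit (c 0) * (t / Q * Angle.unit (c 4)) / (r * Angle.unit (c 2)) *
        (z ^ 2 / (x * y)) = g := by
      rw [hC₂, hx, hy]
      ext
      simp only [Units.val_mul, Units.val_div_eq_div_val, Units.val_pow_eq_pow_val]
      field_simp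
      linear_combination hst
    have ew : tripleDensity (g, r, s) * rightWeight a c (s / P : Fˣ) (t / Q : Fˣ) r x y z =
        coreWeight (Angle.re (a 0)) (Angle.re (c 0)) (Angle.re (a 4)) (Angle.re (c 4))
          (Angle.re (a 2)) (Angle.re (c 2)) (modulus (s : F)) (modulus (P : F)) (modulus (t : F))
          (modulus (Q : F)) (modulus (r : F)) (modulus (Z : F)) := by
      rw [← coreWeight_eq_right _ _ _ _ _ _ (modulus_units_pos _) (modulus_units_pos _)
        (modulus_units_pos _) (modulus_units_pos _) (modulus_units_pos _) (modulus_units_pos _),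
        tripleDensity, rightWeight]
      simp only
      rw [e1, e2, e3]
      simp only [shiftDensity, ← ht, ← hPv, ← hQv, ← sub_eq_add_neg, ← hZv, modulus_neg,
        Units.val_div_eq_div_val, Units.val_inv_eq_inv_val, modulus_div, modulus_inv]
    rw [eg, eu, ev, ← ew]
    simp only [tripleDensity, ← ht, ← ex, ← ey]
    push_cast
    ring
  · rw [core, if_neg hadm, mul_zero]
    -- Off the admissible set a denominator vanishes, and the density is `0` by convention.
    have h0 : tripleDensity (g, r, s) = 0 := by
      unfold Admissible at hadm
      unfold tripleDensity
      simp only at hadm ⊢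
      by_cases h1 : (1 + s : F) = 0
      · rw [shiftDensity_eq_zero h1]; ring
      by_cases h2 : (1 - r : F) = 0
      · rw [shiftDensity_eq_zero (t := (-r : F)) (by rw [← h2]; ring)]; ring
      by_cases h3 : (1 + (g * (r / s) : Fˣ) : F) = 0
      · rw [shiftDensity_eq_zero h3]; ring
      exact absurd ⟨h1, h2, h3⟩ hadm
    rw [h0]
    simp

/-- For `r = s * t` one has `1 - (1 - r) / (1 + s) = s * (1 + t) / (1 + s)`, and likewise with `s`
and `t` exchanged; these are the arguments found on the right at `g = 1`. -/
lemma shiftDensity_mul_leftOuter {a c : Fin 5 → Angle F} (h : PentagonAngles a c)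
    (Φ : GaussianGroup F × GaussianGroup F → ℂ) {p : Fˣ × Fˣ} (hadm : Admissible (1, p)) :
    (shiftDensity (-p.1 : F) : ℂ) * leftOuter ν a c Φ
      (pairSubst (Angle.unit (a 1)) (Angle.unit (a 3)) p) = core ν a c Φ (1, p) := by
  obtain ⟨r, s⟩ := p
  rw [core, if_pos hadm]
  obtain ⟨hP, hZ, hQ⟩ := hadm
  simp only [one_mul] at hP hZ hQ ⊢
  simp only [pairSubst]
  have hst : (r : F) = s * ((r / s : Fˣ) : F) := by
    simp only [Units.val_div_eq_div_val]
    field_simp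
  generalize r / s = t at *
  obtain ⟨P, hPv⟩ : ∃ P : Fˣ, (P : F) = 1 + s := ⟨Units.mk0 _ hP, rfl⟩
  obtain ⟨Q, hQv⟩ : ∃ Q : Fˣ, (Q : F) = 1 + t := ⟨Units.mk0 _ hQ, rfl⟩
  obtain ⟨Z, hZv⟩ : ∃ Z : Fˣ, (Z : F) = 1 - r := ⟨Units.mk0 _ hZ, rfl⟩
  rw [← hPv, ← hQv, ← hZv]
  simp only [toUnit_coe]
  set A₁ := Angle.unit (a 1)
  set A₃ := Angle.unit (a 3)
  set x := Z / A₁ / P with hx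
  set y := Z / A₃ / Q with hy
  have e1 : (A₁ : F) * x = (Z / P : Fˣ) := by
    simp only [hx, Units.val_div_eq_div_val]
    field_simp
  have e2 : (A₃ : F) * y = (Z / Q : Fˣ) := by
    simp only [hy, Units.val_div_eq_div_val]
    field_simp
  have hp : (1 - A₁ * x : F) = (s * (Q / P) : Fˣ) := by
    rw [e1]
    simp only [Units.val_mul, Units.val_div_eq_div_val]
    field_simp
    rw [hPv, hZv, hQv, hst]
    ring
  have hq : (1 - A₃ * y : F) = (t * (P / Q) : Fˣ) := by
    rw [e2]
    simp only [Units.val_mul, Units.val_div_eq_div_val]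
    field_simp
    rw [hPv, hZv, hQv, hst]
    ring
  have hnot : ¬(((s * (Q / P) : Fˣ) : F) = 0 ∨ ((t * (P / Q) : Fˣ) : F) = 0) := by
    push Not
    exact ⟨Units.ne_zero _, Units.ne_zero _⟩
  have ew : shiftDensity (-r : F) * leftWeight a c (s * (Q / P) : Fˣ) (t * (P / Q) : Fˣ) x y =
      coreWeight (Angle.re (a 0)) (Angle.re (c 0)) (Angle.re (a 4)) (Angle.re (c 4))
        (Angle.re (a 2)) (Angle.re (c 2)) (modulus (s : F)) (modulus (P : F)) (modulus (t : F))
        (modulus (Q : F)) (modulus (r : F)) (modulus (Z : F)) := by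
    have hc₂ : Angle.re (c 2) = Angle.re (c 0) + Angle.re (a 4) +
        (Angle.re (a 0) + Angle.re (c 4)) := by rw [h.c₂, h.c₁, h.c₃]; rfl
    have ha₁ : Angle.re (a 1) = Angle.re (a 0) + Angle.re (a 2) := by rw [h.a₁]; rfl
    have ha₃ : Angle.re (a 3) = Angle.re (a 2) + Angle.re (a 4) := by rw [h.a₃]; rfl
    have hc₁ : Angle.re (c 1) = Angle.re (c 0) + Angle.re (a 4) := by rw [h.c₁]; rfl
    have hc₃ : Angle.re (c 3) = Angle.re (a 0) + Angle.re (c 4) := by rw [h.c₃]; rfl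
    rw [← coreWeight_eq_left _ _ _ _ _ _ (modulus_units_pos _) (modulus_units_pos _)
      (modulus_units_pos _) (modulus_units_pos _) (by rw [hst, modulus_mul]) (modulus_units_pos _)
      hc₂, leftWeight, e1, e2, ha₁, ha₃, hc₁, hc₃]
    simp only [shiftDensity, ← sub_eq_add_neg, ← hZv, modulus_neg, Units.val_mul,
      Units.val_div_eq_div_val, modulus_div, modulus_mul]
  simp only [leftOuter]
  rw [hp, hq, if_neg hnot]
  simp only [toUnit_coe]
  rw [← ew, mul_comm (s * (Q / P)), mul_comm (t * (P / Q))]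
  push_cast
  ring

end Core

/-! ### Delta sequences -/

section Delta

variable {G : Type*} [CommGroup G] [TopologicalSpace G] [IsTopologicalGroup G] [MeasurableSpace G]
  [BorelSpace G] [SecondCountableTopology G]
  [MeasurableSpace (PontryaginDual G)] {m : Measure G} [IsFiniteMeasureOnCompacts m] [SFinite m]
  {ν : Measure (PontryaginDual G)} {ρ : ℕ → G → ℝ}
  {X : Type*} [MeasurableSpace X] {κ : Measure X} [SFinite κ]

lemma integrable_mul_of_fiber_bound {ρ : G → ℝ} (hρ : Continuous ρ) (hρc : HasCompactSupport ρ)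
    {f : G × X → ℂ} (hf : Measurable f) {H : X → ℝ} (hH : Integrable H κ) {b : G → ℝ}
    (hb : Continuous b) (hfb : ∀ p, ‖f p‖ ≤ b p.1 * H p.2) :
    Integrable (fun p => (ρ p.1 : ℂ) * f p) (m.prod κ) := by
  have h1 : Integrable (fun g => |ρ g| * b g) m :=
    (hρ.abs.mul hb).integrable_of_hasCompactSupport
      (HasCompactSupport.mul_right (hρc.comp_left (g := fun x => |x|) abs_zero))
  refine (h1.mul_prod hH).mono' ?_ (ae_of_all _ fun p => ?_)
  · have := hρ.measurable
    exact Measurable.aestronglyMeasurable (by fun_prop)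
  · rw [norm_mul, Complex.norm_real, Real.norm_eq_abs, mul_assoc]
    exact mul_le_mul_of_nonneg_left (hfb p) (abs_nonneg _)

/-- Dominated convergence makes the fibre integral continuous at `g = 1`, and `ρ n` averages it over
shrinking neighbourhoods of `1`. -/
lemma IsDeltaSequence.tendsto_integral (hρ : IsDeltaSequence m ν ρ)
    {f : G × X → ℂ} (hf : Measurable f) {H : X → ℝ} (hH : Integrable H κ) {b : G → ℝ}
    (hb : Continuous b) (hfb : ∀ p, ‖f p‖ ≤ b p.1 * H p.2)
    (hc : ∀ᵐ x ∂κ, ContinuousAt (fun g => f (g, x)) 1) :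
    Tendsto (fun n => ∫ p, (ρ n p.1 : ℂ) * f p ∂(m.prod κ)) atTop (𝓝 (∫ x, f (1, x) ∂κ)) := by
  set I : G → ℂ := fun g => ∫ x, f (g, x) ∂κ
  have hint : ∀ n, Integrable (fun p => (ρ n p.1 : ℂ) * f p) (m.prod κ) := fun n =>
    integrable_mul_of_fiber_bound (hρ.continuous n) (hρ.hasCompactSupport n) hf hH hb hfb
  have hI : ContinuousAt I 1 := by
    refine continuousAt_of_dominated (bound := fun x => (|b 1| + 1) * |H x|)
      (Eventually.of_forall fun g => (hf.comp measurable_prodMk_left).aestronglyMeasurable)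
      ?_ (hH.abs.const_mul _) hc
    have h1 : ∀ᶠ g in 𝓝 (1 : G), |b g| < |b 1| + 1 :=
      hb.abs.continuousAt.eventually (gt_mem_nhds (lt_add_one _))
    filter_upwards [h1] with g hg
    refine ae_of_all _ fun x => (hfb (g, x)).trans ((le_abs_self _).trans ?_)
    rw [abs_mul]
    exact mul_le_mul_of_nonneg_right hg.le (abs_nonneg _)
  have hJ : ∀ n, ∫ p, (ρ n p.1 : ℂ) * f p ∂(m.prod κ) = ∫ g, (ρ n g : ℂ) * I g ∂m := fun n => by
    rw [integral_prod _ (hint n)]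
    simp only [I, integral_const_mul]
  have hJi : ∀ n, Integrable (fun g => (ρ n g : ℂ) * I g) m := fun n => by
    refine (hint n).integral_prod_left.congr (ae_of_all _ fun g => ?_)
    simp only [I, integral_const_mul]
  have hρi : ∀ n, Integrable (fun g => ρ n g) m := fun n =>
    (hρ.continuous n).integrable_of_hasCompactSupport (hρ.hasCompactSupport n)
  simp only [hJ]
  rw [Metric.tendsto_atTop']
  intro ε hε
  have hU : {g | dist (I g) (I 1) < ε / 2} ∈ 𝓝 (1 : G) :=
    hI.eventually (Metric.ball_mem_nhds _ (half_pos hε))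
  obtain ⟨N, hN⟩ := eventually_atTop.mp (hρ.support_shrinks _ hU)
  refine ⟨N, fun n hn => ?_⟩
  have h1 : ∫ g, (ρ n g : ℂ) * I g ∂m - I 1 = ∫ g, (ρ n g : ℂ) * (I g - I 1) ∂m := by
    have h2 : ∫ g, (ρ n g : ℂ) * I 1 ∂m = I 1 := by
      rw [integral_mul_const, integral_complex_ofReal, hρ.integral_eq_one n, Complex.ofReal_one,
        one_mul]
    conv_lhs => rw [← h2]
    have h4 : Integrable (fun g => (ρ n g : ℂ) * I 1) m := (hρi n).ofReal.mul_const _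
    rw [← integral_sub (hJi n) h4]
    simp only [mul_sub]
  rw [dist_eq_norm, h1]
  have h3 : ‖∫ g, (ρ n g : ℂ) * (I g - I 1) ∂m‖ ≤ ∫ g, ρ n g * (ε / 2) ∂m := by
    refine norm_integral_le_of_norm_le ((hρi n).mul_const _) (ae_of_all _ fun g => ?_)
    rw [norm_mul, Complex.norm_real, Real.norm_of_nonneg (hρ.nonneg n g)]
    by_cases hg : ρ n g = 0
    · simp [hg]
    · have : dist (I g) (I 1) < ε / 2 := hN n hn.le hg
      rw [dist_eq_norm] at this
      exact mul_le_mul_of_nonneg_left this.le (hρ.nonneg n g)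
  rw [integral_mul_const, hρ.integral_eq_one n, one_mul] at h3
  linarith

end Delta

/-! ### Domination of the common integrand -/

section Domination

variable {F : Type*} [NontriviallyNormedField F] [LocallyCompactSpace F]

/-- Of the `3 * n + k` powers of `Λ⁻¹`, `n` give decay in `s` and `2 * n` decay in `r`, since
`logSize r` costs `Λ ^ 2`. The last `k` damp the pole at one point at the cost of a power of
`logSize` at the other, whichever of the two poles is present. -/
lemma mul_poles_le_majorants {n k : ℕ} {s r g : F} {φ M κ Λ : ℝ} (hM : 0 ≤ M) (hκ : 0 < κ)
    (hΛ : 0 < Λ) (hφ : φ ≤ M * Λ⁻¹ ^ (3 * n + k)) (hs : logSize s ≤ κ * Λ)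
    (hr : logSize r ≤ κ * Λ ^ 2 * logSize g) (hP : logSize (1 + s) ≤ κ * logSize (1 - r) * Λ)
    (hZ : logSize (1 - r) ≤ κ * logSize (1 + s) * Λ) :
    φ * (poleFactor s + poleFactor (-r)) ≤
      M * κ ^ (2 * n + k) * logSize g ^ n * (majorant n k s * majorant n k (-r)) := by
  unfold majorant
  rw [logSize_neg, ← sub_eq_add_neg]
  have ls := logSize_pos s
  have lr := logSize_pos r
  have lg := logSize_pos g
  have lP := logSize_pos (1 + s)
  have lZ := logSize_pos (1 - r)
  have hD := poleFactor_nonneg s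
  have hD' := poleFactor_nonneg (-r)
  set D := poleFactor s
  set D' := poleFactor (-r)
  set a := logSize s
  set b := logSize r
  set c := logSize g
  set p := logSize (1 + s)
  set z := logSize (1 - r)
  have h1 : Λ⁻¹ ≤ κ * a⁻¹ := by
    rw [← div_eq_mul_inv, le_div_iff₀ ls, inv_mul_le_iff₀ hΛ]
    linarith
  have h2 : Λ⁻¹ ^ 2 ≤ κ * c * b⁻¹ := by
    rw [← div_eq_mul_inv, le_div_iff₀ lr, inv_pow, inv_mul_le_iff₀ (by positivity)]
    linarith
  have h3 : Λ⁻¹ ≤ κ * z * p⁻¹ := by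
    rw [← div_eq_mul_inv, le_div_iff₀ lP, inv_mul_le_iff₀ hΛ]
    linarith
  have h4 : Λ⁻¹ ≤ κ * p * z⁻¹ := by
    rw [← div_eq_mul_inv, le_div_iff₀ lZ, inv_mul_le_iff₀ hΛ]
    linarith
  have hsplit : Λ⁻¹ ^ (3 * n + k) = Λ⁻¹ ^ n * (Λ⁻¹ ^ 2) ^ n * Λ⁻¹ ^ k := by
    rw [← pow_mul, ← pow_add, ← pow_add]
    congr 1
    ring
  have e3 : Λ⁻¹ ^ (3 * n + k) ≤ (κ * a⁻¹) ^ n * (κ * c * b⁻¹) ^ n * (κ * z * p⁻¹) ^ k := by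
    rw [hsplit]
    gcongr
  have e4 : Λ⁻¹ ^ (3 * n + k) ≤ (κ * a⁻¹) ^ n * (κ * c * b⁻¹) ^ n * (κ * p * z⁻¹) ^ k := by
    rw [hsplit]
    gcongr
  have hpos : 0 ≤ M * κ ^ (2 * n + k) * c ^ n * a⁻¹ ^ n * b⁻¹ ^ n := by positivity
  calc φ * (D + D') ≤ M * Λ⁻¹ ^ (3 * n + k) * (D + D') := by gcongr
    _ = M * (Λ⁻¹ ^ (3 * n + k) * D) + M * (Λ⁻¹ ^ (3 * n + k) * D') := by ring
    _ ≤ M * ((κ * a⁻¹) ^ n * (κ * c * b⁻¹) ^ n * (κ * z * p⁻¹) ^ k * D) +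
        M * ((κ * a⁻¹) ^ n * (κ * c * b⁻¹) ^ n * (κ * p * z⁻¹) ^ k * D') := by gcongr
    _ = M * κ ^ (2 * n + k) * c ^ n * a⁻¹ ^ n * b⁻¹ ^ n *
        (D * p⁻¹ ^ k * z ^ k + p ^ k * (D' * z⁻¹ ^ k)) := by
      simp only [mul_pow, pow_add, pow_mul']
      ring
    _ ≤ M * κ ^ (2 * n + k) * c ^ n * a⁻¹ ^ n * b⁻¹ ^ n *
        ((D * p⁻¹ ^ k + p ^ k) * (D' * z⁻¹ ^ k + z ^ k)) := by
      -- Adding the two missing cross terms produces a product of a function of `s` and a function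
      -- of `r`.
      refine mul_le_mul_of_nonneg_left ?_ hpos
      have t1 : 0 ≤ D * p⁻¹ ^ k * (D' * z⁻¹ ^ k) := by positivity
      have t2 : 0 ≤ p ^ k * z ^ k := by positivity
      linarith
    _ = _ := by ring

/-- The constant that enters the domination of the integrand. -/
def angleConst (A₁ A₃ C₁ C₃ : Fˣ) : ℝ :=
  logSize ((A₃ / (A₁ * C₁) : Fˣ) : F) * logSize ((A₁ / (A₃ * C₃) : Fˣ) : F) *
    (logSize (A₁ : F) * logSize (A₃ : F))

lemma logSize_units_mul_le (a b : Fˣ) :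
    logSize ((a * b : Fˣ) : F) ≤ logSize (a : F) * logSize (b : F) := by
  rw [Units.val_mul]
  exact logSize_mul_le _ _

lemma logSize_units_div_le (a b : Fˣ) :
    logSize ((a / b : Fˣ) : F) ≤ logSize (a : F) * logSize (b : F) := by
  rw [Units.val_div_eq_div_val]
  exact logSize_div_le _ _

/-- Up to constants `s = u y / x`, `t = v x / y` and `P = Z / x`, so the product `Λ` of the four
logarithmic sizes controls `s`, `t` and the ratio of `P` to `Z`. -/
lemma mul_poles_le_of_decay {n k : ℕ} {A₁ A₃ C₁ C₃ s t r g P Q Z : Fˣ} (hst : s * t = g * r)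
    (hP : (P : F) = 1 + s) (hZ : (Z : F) = 1 - r) {φ M : ℝ} (hM : 0 ≤ M)
    (hφ : φ ≤ M * (logWeight (3 * n + k) (C₁ * (s * (Q / P))) *
      logWeight (3 * n + k) (Z / A₁ / P) * (logWeight (3 * n + k) (C₃ * (t * (P / Q))) *
      logWeight (3 * n + k) (Z / A₃ / Q)))) :
    φ * (poleFactor (s : F) + poleFactor (-r : F)) ≤
      M * angleConst A₁ A₃ C₁ C₃ ^ (2 * n + k) * logSize (g : F) ^ n *
        (majorant n k (s : F) * majorant n k (-r : F)) := by
  set u := C₁ * (s * (Q / P)) with hu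
  set x := Z / A₁ / P with hx
  set v := C₃ * (t * (P / Q)) with hv
  set y := Z / A₃ / Q with hy
  have es : s = u * (y / x) * (A₃ / (A₁ * C₁)) := by
    rw [hu, hx, hy]
    ext
    simp only [Units.val_mul, Units.val_div_eq_div_val]
    field_simp
  have et : t = v * (x / y) * (A₁ / (A₃ * C₃)) := by
    rw [hv, hx, hy]
    ext
    simp only [Units.val_mul, Units.val_div_eq_div_val]
    field_simp
  have er : r = s * t / g := by rw [hst, mul_div_cancel_left]
  have eP : P = Z / (A₁ * x) := by
    rw [hx]
    ext
    simp only [Units.val_mul, Units.val_div_eq_div_val]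
    field_simp
  have eZ : Z = A₁ * x * P := by
    rw [hx]
    ext
    simp only [Units.val_mul, Units.val_div_eq_div_val]
    field_simp
  have l := fun w : Fˣ => one_le_logSize (w : F)
  have l0 := fun w : Fˣ => logSize_pos (w : F)
  set k₁ := logSize ((A₃ / (A₁ * C₁) : Fˣ) : F) with hk₁
  set k₃ := logSize ((A₁ / (A₃ * C₃) : Fˣ) : F) with hk₃
  have hk₁1 : 1 ≤ k₁ := l _
  have hk₃1 : 1 ≤ k₃ := l _
  set Λ := logSize (u : F) * logSize (x : F) * (logSize (v : F) * logSize (y : F)) with hΛdef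
  have hΛ : 0 < Λ := mul_pos (mul_pos (l0 u) (l0 x)) (mul_pos (l0 v) (l0 y))
  have hκeq : angleConst A₁ A₃ C₁ C₃ = k₁ * k₃ * (logSize (A₁ : F) * logSize (A₃ : F)) := rfl
  have hA : 1 ≤ logSize (A₁ : F) * logSize (A₃ : F) := one_le_mul_of_one_le_of_one_le (l _) (l _)
  have hκ : 0 < angleConst A₁ A₃ C₁ C₃ := by
    rw [hκeq]
    positivity
  have hs : logSize (s : F) ≤ k₁ * Λ := by
    calc logSize (s : F) ≤ logSize (u : F) * (logSize (y : F) * logSize (x : F)) * k₁ := by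
          conv_lhs => rw [es]
          refine (logSize_units_mul_le _ _).trans ?_
          gcongr
          refine (logSize_units_mul_le _ _).trans ?_
          gcongr
          · exact (l0 _).le
          · exact logSize_units_div_le _ _
      _ = k₁ * (logSize (u : F) * logSize (x : F) * (1 * logSize (y : F))) := by ring
      _ ≤ k₁ * Λ := by
          have := l0 u
          have := l0 x
          have := l0 y
          have := l v
          rw [hΛdef]
          gcongr
  have ht : logSize (t : F) ≤ k₃ * Λ := by
    calc logSize (t : F) ≤ logSize (v : F) * (logSize (x : F) * logSize (y : F)) * k₃ := by
          conv_lhs => rw [et]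
          refine (logSize_units_mul_le _ _).trans ?_
          gcongr
          refine (logSize_units_mul_le _ _).trans ?_
          gcongr
          · exact (l0 _).le
          · exact logSize_units_div_le _ _
      _ = k₃ * (1 * logSize (x : F) * (logSize (v : F) * logSize (y : F))) := by ring
      _ ≤ k₃ * Λ := by
          have := l0 v
          have := l0 x
          have := l0 y
          have := l u
          rw [hΛdef]
          gcongr
  have hxΛ : logSize (x : F) ≤ Λ := by
    calc logSize (x : F) = 1 * logSize (x : F) * (1 * 1) := by ring
      _ ≤ Λ := by
          have := l0 u
          have := l0 x
          have := l u
          have := l v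
          have := l y
          rw [hΛdef]
          gcongr
  have hA₁κ : logSize (A₁ : F) ≤ angleConst A₁ A₃ C₁ C₃ := by
    calc logSize (A₁ : F) = 1 * 1 * (logSize (A₁ : F) * 1) := by ring
      _ ≤ angleConst A₁ A₃ C₁ C₃ := by
          have := l0 A₁
          have := l A₃
          rw [hκeq]
          gcongr
  refine mul_poles_le_majorants hM hκ hΛ ?_ ?_ ?_ ?_ ?_
  · refine hφ.trans_eq ?_
    simp only [logWeight, hΛdef, mul_inv, mul_pow]
  · refine hs.trans ?_
    gcongr
    calc k₁ = k₁ * 1 * 1 := by ring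
      _ ≤ _ := by
        rw [hκeq]
        gcongr
  · calc logSize (r : F) ≤ logSize (s : F) * logSize (t : F) * logSize (g : F) := by
          conv_lhs => rw [er]
          refine (logSize_units_div_le _ _).trans ?_
          gcongr
          · exact (l0 _).le
          · exact logSize_units_mul_le _ _
      _ ≤ k₁ * Λ * (k₃ * Λ) * logSize (g : F) := by
          have := l0 s
          have := l0 t
          have := l0 g
          gcongr
      _ = k₁ * k₃ * 1 * Λ ^ 2 * logSize (g : F) := by ring
      _ ≤ _ := by
          have := l0 g
          rw [hκeq]
          gcongr
  · rw [← hP, ← hZ]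
    calc logSize (P : F) ≤ logSize (Z : F) * (logSize (A₁ : F) * logSize (x : F)) := by
          conv_lhs => rw [eP]
          refine (logSize_units_div_le _ _).trans ?_
          gcongr
          · exact (l0 _).le
          · exact logSize_units_mul_le _ _
      _ ≤ logSize (Z : F) * (angleConst A₁ A₃ C₁ C₃ * Λ) := by
          have := l0 Z
          have := l0 x
          gcongr
      _ = _ := by ring
  · rw [← hP, ← hZ]
    calc logSize (Z : F) ≤ logSize (A₁ : F) * logSize (x : F) * logSize (P : F) := by
          conv_lhs => rw [eZ]
          refine (logSize_units_mul_le _ _).trans ?_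
          gcongr
          · exact (l0 _).le
          · exact logSize_units_mul_le _ _
      _ ≤ angleConst A₁ A₃ C₁ C₃ * Λ * logSize (P : F) := by
          have := l0 P
          have := l0 x
          gcongr
      _ = _ := by ring

end Domination

/-! ### Convergence of the right hand side to the left hand side -/

section Main

variable {F : Type*} [NontriviallyNormedField F] [LocallyCompactSpace F]

/-- The share of the poles at `s = -1` and `r = 1` in the sum of the three poles. -/
def poleShare (p : Fˣ × Fˣ × Fˣ) : ℝ :=
  (poleFactor (p.2.2 : F) + poleFactor (-p.2.1 : F)) /
    (poleFactor (p.2.2 : F) + poleFactor (-p.2.1 : F) +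
      poleFactor ((p.1 * (p.2.1 / p.2.2) : Fˣ) : F))

lemma admissible_factorSwap {p : Fˣ × Fˣ × Fˣ} (h : Admissible p) :
    Admissible (factorSwap p) := by
  obtain ⟨h1, h2, h3⟩ := h
  refine ⟨h3, h2, ?_⟩
  simp only [factorSwap]
  have : p.1 * (p.2.1 / (p.1 * (p.2.1 / p.2.2))) = p.2.2 := by
    ext
    simp only [Units.val_mul, Units.val_div_eq_div_val]
    field_simp
  rwa [this]

lemma continuous_factorSwap : Continuous (factorSwap : Fˣ × Fˣ × Fˣ → Fˣ × Fˣ × Fˣ) := by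
  unfold factorSwap
  fun_prop

lemma isOpen_admissible : IsOpen {p : Fˣ × Fˣ × Fˣ | Admissible p} := by
  have hv : Continuous (Units.val : Fˣ → F) := Units.continuous_val
  have h1 : Continuous fun p : Fˣ × Fˣ × Fˣ => (1 + p.2.2 : F) := by fun_prop
  have h2 : Continuous fun p : Fˣ × Fˣ × Fˣ => (1 - p.2.1 : F) := by fun_prop
  have h3 : Continuous fun p : Fˣ × Fˣ × Fˣ => (1 + (p.1 * (p.2.1 / p.2.2) : Fˣ) : F) :=
    continuous_const.add (hv.comp (by fun_prop))
  exact (isOpen_ne_fun h1 continuous_const).inter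
    ((isOpen_ne_fun h2 continuous_const).inter (isOpen_ne_fun h3 continuous_const))

lemma continuousAt_poleFactor {t : F} (h : 1 + t ≠ 0) : ContinuousAt poleFactor t := by
  unfold poleFactor
  exact ContinuousAt.div (by fun_prop)
    (continuous_modulus.comp (by fun_prop : Continuous fun t : F => 1 + t)).continuousAt
    (modulus_pos h).ne'

lemma continuousAt_poleShare {p : Fˣ × Fˣ × Fˣ} (h : Admissible p) :
    ContinuousAt poleShare p := by
  obtain ⟨h1, h2, h3⟩ := h
  have hv : Continuous (Units.val : Fˣ → F) := Units.continuous_val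
  have c1 : ContinuousAt (fun p : Fˣ × Fˣ × Fˣ => poleFactor (p.2.2 : F)) p :=
    ContinuousAt.comp (f := fun p : Fˣ × Fˣ × Fˣ => (p.2.2 : F)) (continuousAt_poleFactor h1)
      (by fun_prop)
  have c2 : ContinuousAt (fun p : Fˣ × Fˣ × Fˣ => poleFactor (-p.2.1 : F)) p :=
    ContinuousAt.comp (f := fun p : Fˣ × Fˣ × Fˣ => (-p.2.1 : F))
      (continuousAt_poleFactor (by rwa [← sub_eq_add_neg])) (by fun_prop)
  have c3 : ContinuousAt (fun p : Fˣ × Fˣ × Fˣ =>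
      poleFactor ((p.1 * (p.2.1 / p.2.2) : Fˣ) : F)) p :=
    ContinuousAt.comp (f := fun p : Fˣ × Fˣ × Fˣ => ((p.1 * (p.2.1 / p.2.2) : Fˣ) : F))
      (continuousAt_poleFactor h3) (hv.comp (by fun_prop)).continuousAt
  refine (c1.add c2).div ((c1.add c2).add c3) (ne_of_gt ?_)
  have := poleFactor_pos h1
  have := poleFactor_nonneg (-p.2.1 : F)
  have := poleFactor_nonneg ((p.1 * (p.2.1 / p.2.2) : Fˣ) : F)
  positivity

lemma continuousAt_modulus_rpow {X : Type*} [TopologicalSpace X] {f : X → F} {x : X}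
    (hf : ContinuousAt f x) (h : f x ≠ 0) (e : ℝ) :
    ContinuousAt (fun x => modulus (f x) ^ e) x :=
  ContinuousAt.rpow_const (continuous_modulus.continuousAt.comp hf) (Or.inl (modulus_pos h).ne')

variable [MeasurableSpace F] [BorelSpace F]
  [MeasurableSpace (PontryaginDual Fˣ)] [BorelSpace (PontryaginDual Fˣ)]
  (μ : Measure F) [μ.IsAddHaarMeasure] {ν : Measure (PontryaginDual Fˣ)} [ν.IsHaarMeasure]
  {Φ : GaussianGroup F × GaussianGroup F → ℂ} {W : PontryaginDual Fˣ → ℝ}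
  {a c : Fin 5 → Angle F}

lemma measurable_poleShare : Measurable (poleShare : Fˣ × Fˣ × Fˣ → ℝ) := by
  unfold poleShare
  fun_prop

lemma measurable_core (a c : Fin 5 → Angle F) (hΦ : Continuous Φ) (hW : Integrable W ν) {M : ℝ}
    (hM : ∀ α x β y, ‖Φ ((α, x), (β, y))‖ ≤ M * (W α * W β)) : Measurable (core ν a c Φ) := by
  unfold core coreWeight
  refine Measurable.ite isOpen_admissible.measurableSet (Measurable.mul (by fun_prop)
    (measurable_dualTransform hΦ hW hM (by fun_prop) (by fun_prop) (by fun_prop) (by fun_prop)))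
    measurable_const

lemma continuousAt_core (a c : Fin 5 → Angle F) (hΦ : Continuous Φ) (hW : Integrable W ν) {M : ℝ}
    (hM : ∀ α x β y, ‖Φ ((α, x), (β, y))‖ ≤ M * (W α * W β)) {p : Fˣ × Fˣ × Fˣ}
    (h : Admissible p) : ContinuousAt (core ν a c Φ) p := by
  have hv : Continuous (Units.val : Fˣ → F) := Units.continuous_val
  have hT : Continuous fun p : Fˣ × Fˣ × Fˣ => p.1 * (p.2.1 / p.2.2) := by fun_prop
  have cs : ContinuousAt (fun p : Fˣ × Fˣ × Fˣ => (p.2.2 : F)) p := by fun_prop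
  have cr : ContinuousAt (fun p : Fˣ × Fˣ × Fˣ => (p.2.1 : F)) p := by fun_prop
  have ct : ContinuousAt (fun p : Fˣ × Fˣ × Fˣ => ((p.1 * (p.2.1 / p.2.2) : Fˣ) : F)) p :=
    (hv.comp hT).continuousAt
  have cP : ContinuousAt (fun p : Fˣ × Fˣ × Fˣ => (1 + p.2.2 : F)) p := continuousAt_const.add cs
  have cZ : ContinuousAt (fun p : Fˣ × Fˣ × Fˣ => (1 - p.2.1 : F)) p := continuousAt_const.sub cr
  have cQ : ContinuousAt (fun p : Fˣ × Fˣ × Fˣ => (1 + (p.1 * (p.2.1 / p.2.2) : Fˣ) : F)) p :=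
    continuousAt_const.add ct
  have uP := ContinuousAt.comp (f := fun p : Fˣ × Fˣ × Fˣ => (1 + p.2.2 : F))
    (continuousAt_toUnit h.1) cP
  have uZ := ContinuousAt.comp (f := fun p : Fˣ × Fˣ × Fˣ => (1 - p.2.1 : F))
    (continuousAt_toUnit h.2.1) cZ
  have uQ := ContinuousAt.comp
    (f := fun p : Fˣ × Fˣ × Fˣ => (1 + (p.1 * (p.2.1 / p.2.2) : Fˣ) : F))
    (continuousAt_toUnit h.2.2) cQ
  have us : ContinuousAt (fun p : Fˣ × Fˣ × Fˣ => p.2.2) p := by fun_prop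
  have hweight : ContinuousAt (fun p : Fˣ × Fˣ × Fˣ => coreWeight (Angle.re (a 0)) (Angle.re (c 0))
      (Angle.re (a 4)) (Angle.re (c 4)) (Angle.re (a 2)) (Angle.re (c 2)) (modulus (p.2.2 : F))
      (modulus (1 + p.2.2 : F)) (modulus ((p.1 * (p.2.1 / p.2.2) : Fˣ) : F))
      (modulus (1 + (p.1 * (p.2.1 / p.2.2) : Fˣ) : F)) (modulus (p.2.1 : F))
      (modulus (1 - p.2.1 : F))) p := by
    unfold coreWeight
    exact (((continuousAt_modulus_rpow cs (Units.ne_zero _) _).mul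
      (continuousAt_modulus_rpow cP h.1 _)).mul
      ((continuousAt_modulus_rpow ct (Units.ne_zero _) _).mul
      (continuousAt_modulus_rpow cQ h.2.2 _))).mul
      ((continuousAt_modulus_rpow cr (Units.ne_zero _) _).mul
      (continuousAt_modulus_rpow cZ h.2.1 _))
  have hargs : ContinuousAt (fun p : Fˣ × Fˣ × Fˣ =>
      (Angle.unit (c 1) * (p.2.2 * (toUnit (1 + (p.1 * (p.2.1 / p.2.2) : Fˣ) : F) /
        toUnit (1 + p.2.2 : F))),
      toUnit (1 - p.2.1 : F) / Angle.unit (a 1) / toUnit (1 + p.2.2 : F),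
      Angle.unit (c 3) * (p.1 * (p.2.1 / p.2.2) * (toUnit (1 + p.2.2 : F) /
        toUnit (1 + (p.1 * (p.2.1 / p.2.2) : Fˣ) : F))),
      toUnit (1 - p.2.1 : F) / Angle.unit (a 3) /
        toUnit (1 + (p.1 * (p.2.1 / p.2.2) : Fˣ) : F))) p :=
    (continuousAt_const.mul (us.mul (uQ.div' uP))).prodMk
      (((uZ.div' continuousAt_const).div' uP).prodMk
      ((continuousAt_const.mul (hT.continuousAt.mul (uP.div' uQ))).prodMk
      ((uZ.div' continuousAt_const).div' uQ)))
  have hdual := (continuous_dualTransform (ν := ν) hΦ hW hM).continuousAt.comp hargs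
  refine ((Complex.continuous_ofReal.continuousAt.comp hweight).mul hdual).congr ?_
  filter_upwards [isOpen_admissible.mem_nhds h] with q hq
  rw [core, if_pos hq]
  rfl

/-- The two parts of the common integrand are dominated by products of integrable functions, the
first one in the coordinates `(g, r, s)` and the second one in the coordinates `(g, r, t)`. -/
lemma exists_core_bound (h : PentagonAngles a c) {n k : ℕ} {M : ℝ} (hM0 : 0 ≤ M)
    (hM : ∀ u x v y, ‖dualTransform ν Φ u x v y‖ ≤
      M * (logWeight (3 * n + k) u * logWeight (3 * n + k) x *
        (logWeight (3 * n + k) v * logWeight (3 * n + k) y))) :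
    ∃ K : ℝ, ∀ p : Fˣ × Fˣ × Fˣ,
      ‖(poleShare p : ℂ) * core ν a c Φ p‖ ≤ K * logSize (p.1 : F) ^ n *
        (majorant n k (-p.2.1 : F) * majorant n k (p.2.2 : F)) ∧
      ‖((1 - poleShare p : ℝ) : ℂ) * core ν a c Φ p‖ ≤ K * logSize (p.1 : F) ^ n *
        (majorant n k (-p.2.1 : F) * majorant n k ((p.1 * (p.2.1 / p.2.2) : Fˣ) : F)) := by
  set A₁ := Angle.unit (a 1)
  set A₃ := Angle.unit (a 3)
  set C₁ := Angle.unit (c 1)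
  set C₃ := Angle.unit (c 3)
  have hκ : ∀ A B C D : Fˣ, 0 < angleConst A B C D := fun A B C D =>
    mul_pos (mul_pos (logSize_pos _) (logSize_pos _)) (mul_pos (logSize_pos _) (logSize_pos _))
  have h₁ := hκ A₁ A₃ C₁ C₃
  have h₃ := hκ A₃ A₁ C₃ C₁
  set K₁ := M * angleConst A₁ A₃ C₁ C₃ ^ (2 * n + k)
  set K₃ := M * angleConst A₃ A₁ C₃ C₁ ^ (2 * n + k)
  have hK₁ : 0 ≤ K₁ := by positivity
  have hK₃ : 0 ≤ K₃ := by positivity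
  refine ⟨K₁ + K₃, fun p => ?_⟩
  obtain ⟨g, r, s⟩ := p
  simp only
  have lg := logSize_pos (g : F)
  have ms := majorant_nonneg n k (s : F)
  have mr := majorant_nonneg n k (-r : F)
  have mt := majorant_nonneg n k ((g * (r / s) : Fˣ) : F)
  by_cases hadm : Admissible (g, r, s)
  swap
  · rw [core, if_neg hadm]
    simp only [mul_zero, norm_zero]
    constructor <;> positivity
  have hcore : core ν a c Φ (g, r, s) = _ := if_pos hadm
  obtain ⟨hP, hZ, hQ⟩ := hadm
  simp only at hP hZ hQ hcore
  have hst : s * (g * (r / s)) = g * r := by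
    ext
    simp only [Units.val_mul, Units.val_div_eq_div_val]
    field_simp
  simp only [poleShare]
  set t := g * (r / s) with ht
  set P := toUnit (1 + s : F)
  set Q := toUnit (1 + t : F)
  set Z := toUnit (1 - r : F)
  have hPv : (P : F) = 1 + s := coe_toUnit hP
  have hQv : (Q : F) = 1 + t := coe_toUnit hQ
  have hZv : (Z : F) = 1 - r := coe_toUnit hZ
  set φ := dualTransform ν Φ (C₁ * (s * (Q / P))) (Z / A₁ / P) (C₃ * (t * (P / Q))) (Z / A₃ / Q)
  have b₁ := mul_poles_le_of_decay hst hPv hZv hM0 (hM _ _ _ _ : ‖φ‖ ≤ _)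
  -- The same estimate after exchanging `s` with `t` and the index `1` with `3`.
  have b₃ := mul_poles_le_of_decay (show t * s = g * r by rw [mul_comm, hst]) hQv hZv hM0
    ((hM _ _ _ _ : ‖φ‖ ≤ _).trans_eq (by rw [mul_comm (logWeight _ _ * _)]))
  have hre := fun i => h.positive i
  have hc₂ : Angle.re (c 2) = Angle.re (c 0) + Angle.re (a 4) +
      (Angle.re (a 0) + Angle.re (c 4)) := by rw [h.c₂, h.c₁, h.c₃]; rfl
  have hb₂ : Angle.re (a 2) + Angle.re (c 2) ≤ 1 := by
    have := (hre 2).2.1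
    rw [Angle.re_third] at this
    linarith
  have hw := coreWeight_le (hre 0).1 (hre 0).2.2 (hre 4).1 (hre 4).2.2 (hre 2).1 hb₂ hc₂
    (modulus_units_pos s) (modulus_pos hP) (modulus_units_pos t) (modulus_pos hQ)
    (modulus_units_pos r) (modulus_pos hZ)
  have hw0 := coreWeight_nonneg (Angle.re (a 0)) (Angle.re (c 0)) (Angle.re (a 4)) (Angle.re (c 4))
    (Angle.re (a 2)) (Angle.re (c 2)) (modulus_nonneg (s : F)) (modulus_nonneg (1 + s : F))
    (modulus_nonneg (t : F)) (modulus_nonneg (1 + t : F)) (modulus_nonneg (r : F))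
    (modulus_nonneg (1 - r : F))
  have er : (1 + modulus (r : F)) / modulus (1 - r : F) = poleFactor (-r : F) := by
    rw [poleFactor, modulus_neg, ← sub_eq_add_neg]
  rw [er] at hw
  change _ ≤ poleFactor (s : F) + poleFactor (-r : F) + poleFactor (t : F) at hw
  rw [hcore]
  set w := coreWeight (Angle.re (a 0)) (Angle.re (c 0)) (Angle.re (a 4)) (Angle.re (c 4))
    (Angle.re (a 2)) (Angle.re (c 2)) (modulus (s : F)) (modulus (1 + s : F))
    (modulus (t : F)) (modulus (1 + t : F)) (modulus (r : F)) (modulus (1 - r : F))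
  have hDs := poleFactor_pos hP
  have hDt := poleFactor_pos hQ
  have hDr := poleFactor_nonneg (-r : F)
  set D := poleFactor (s : F) + poleFactor (-r : F)
  set E := poleFactor (t : F)
  have hD : 0 < D := by positivity
  have hsum : 0 < D + E := by positivity
  have hshare : 1 - D / (D + E) = E / (D + E) := by
    field_simp
    ring
  have hφ : 0 ≤ ‖φ‖ := norm_nonneg _
  -- The weight is at most `D + E`, which cancels the denominator of the share.
  have hsplit : ∀ d : ℝ, 0 ≤ d → ‖((d / (D + E) : ℝ) : ℂ) * ((w : ℂ) * φ)‖ ≤ ‖φ‖ * d := by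
    intro d hd
    rw [norm_mul, norm_mul, Complex.norm_real, Complex.norm_real, Real.norm_of_nonneg hw0,
      Real.norm_of_nonneg (by positivity)]
    calc d / (D + E) * (w * ‖φ‖) ≤ d / (D + E) * ((D + E) * ‖φ‖) := by gcongr
      _ = ‖φ‖ * d := by field_simp
  constructor
  · refine (hsplit D hD.le).trans (b₁.trans ?_)
    rw [mul_comm (majorant n k (-r : F))]
    gcongr
    linarith
  · rw [hshare]
    refine (hsplit E hDt.le).trans ?_
    -- The pole in `r` is added only because `b₃` estimates both poles together.
    calc ‖φ‖ * E ≤ ‖φ‖ * (E + poleFactor (-r : F)) := by gcongr; linarith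
      _ ≤ _ := b₃
      _ ≤ _ := by
        rw [mul_comm (majorant n k (-r : F))]
        gcongr
        linarith

lemma ae_admissible : ∀ᵐ p : Fˣ × Fˣ ∂((unitsHaar μ).prod (unitsHaar μ)), Admissible (1, p) := by
  set m := unitsHaar μ
  have h1 : ∀ᵐ p : Fˣ × Fˣ ∂(m.prod m), p.1 ≠ 1 :=
    Measure.quasiMeasurePreserving_fst.ae (compl_mem_ae_iff.mpr (measure_singleton (1 : Fˣ)))
  have h2 : ∀ᵐ p : Fˣ × Fˣ ∂(m.prod m), p.2 ≠ -1 :=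
    Measure.quasiMeasurePreserving_snd.ae (compl_mem_ae_iff.mpr (measure_singleton (-1 : Fˣ)))
  -- The condition on `t = r / s` is the condition on `s` transported by the swap.
  have h3 : ∀ᵐ p : Fˣ × Fˣ ∂(m.prod m), p.1 * (p.2)⁻¹ ≠ -1 := by
    have hmp : MeasurePreserving (fun p : Fˣ × Fˣ => (p.1, 1 * (p.1 / p.2))) (m.prod m)
      (m.prod m) := measurePreserving_factorSwap_fiber μ 1
    filter_upwards [hmp.quasiMeasurePreserving.ae h2] with p hp
    simpa [div_eq_mul_inv] using hp
  filter_upwards [h1, h2, h3] with p hp1 hp2 hp3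
  refine ⟨fun h => hp2 ?_, fun h => hp1 ?_, fun h => hp3 ?_⟩
  · ext
    rw [Units.val_neg, Units.val_one]
    linear_combination h
  · ext
    rw [Units.val_one]
    linear_combination -h
  · ext
    simp only [one_mul, div_eq_mul_inv] at h
    rw [Units.val_neg, Units.val_one]
    linear_combination h

theorem pentagon_relation (hν : IsDualNormalized (unitsHaar μ) ν) (h : PentagonAngles a c)
    (hΦ : IsSchwartzBruhat (unitsHaar μ) ν Φ) :
    ∃ I : ℂ, PentagonLeft (unitsHaar μ) ν a c Φ I ∧ PentagonRight (unitsHaar μ) ν a c Φ I := by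
  set m := unitsHaar μ
  obtain ⟨W, hW, -, hWb⟩ := hΦ.rapidlyDecreasing.exists_product_bound ν
  -- The exponent `0` gives a bound without weights, enough for continuity, measurability and the
  -- inner integrals.
  obtain ⟨M, -, hM⟩ := hWb 0
  simp only [logWeight, pow_zero, mul_one] at hM
  obtain ⟨n, k, hmaj⟩ := exists_integrable_majorant μ
  obtain ⟨N, hN0, hN⟩ := hΦ.exists_dualTransform_bound μ hν (3 * n + k)
  obtain ⟨K, hK⟩ := exists_core_bound h hN0 hN
  have hcont := hΦ.continuous
  -- `f₁` carries the poles in `s` and `r`. `f₂` carries the pole in `t` and is dominated by the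
  -- same `H` only after composition with `factorSwap`.
  set f₁ : Fˣ × Fˣ × Fˣ → ℂ := fun p => (poleShare p : ℂ) * core ν a c Φ p with hf₁
  set f₂ : Fˣ × Fˣ × Fˣ → ℂ := fun p => ((1 - poleShare p : ℝ) : ℂ) * core ν a c Φ p with hf₂
  set b : Fˣ → ℝ := fun g => K * logSize (g : F) ^ n
  set H : Fˣ × Fˣ → ℝ := fun q => majorant n k (-q.1 : F) * majorant n k (q.2 : F)
  have hb : Continuous b := continuous_const.mul (continuous_logSize_units.pow n)
  have hmaj' : Integrable (fun x : Fˣ => majorant n k (-x : F)) m := by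
    have := hmaj.comp_mul_left (-1 : Fˣ)
    simpa using this
  have hH : Integrable H (m.prod m) := hmaj'.mul_prod hmaj
  have hcore := measurable_core a c hcont hW hM
  have hshare := measurable_poleShare (F := F)
  have hf₁m : Measurable f₁ := by fun_prop
  have hf₂m : Measurable f₂ := by fun_prop
  have hsum : ∀ p, f₁ p + f₂ p = core ν a c Φ p := fun p => by
    simp only [hf₁, hf₂, ← add_mul, ← Complex.ofReal_add]
    simp
  have hswap := measurePreserving_factorSwap μ
  have hfs₂m : Measurable fun p => f₂ (factorSwap p) := hf₂m.comp hswap.measurable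
  have hb₁ : ∀ p, ‖f₁ p‖ ≤ b p.1 * H p.2 := fun p => (hK p).1
  have hb₂ : ∀ p, ‖f₂ (factorSwap p)‖ ≤ b p.1 * H p.2 := fun p => by
    have := (hK (factorSwap p)).2
    simp only [factorSwap] at this
    rwa [show p.1 * (p.2.1 / (p.1 * (p.2.1 / p.2.2))) = p.2.2 by
      ext
      simp only [Units.val_mul, Units.val_div_eq_div_val]
      field_simp] at this
  have hadm := ae_admissible μ
  have hc₁ : ∀ᵐ q ∂(m.prod m), ContinuousAt (fun g => f₁ (g, q)) 1 := by
    filter_upwards [hadm] with q hq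
    have : ContinuousAt f₁ (1, q) :=
      (Complex.continuous_ofReal.continuousAt.comp (continuousAt_poleShare hq)).mul
        (continuousAt_core a c hcont hW hM hq)
    exact ContinuousAt.comp (f := fun g : Fˣ => (g, q)) this (by fun_prop)
  have hc₂ : ∀ᵐ q ∂(m.prod m), ContinuousAt (fun g => f₂ (factorSwap (g, q))) 1 := by
    filter_upwards [hadm] with q hq
    have hq' := admissible_factorSwap hq
    have : ContinuousAt f₂ (factorSwap (1, q)) :=
      (Complex.continuous_ofReal.continuousAt.comp
        (continuousAt_const.sub (continuousAt_poleShare hq'))).mul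
        (continuousAt_core a c hcont hW hM hq')
    exact ContinuousAt.comp (f := fun g : Fˣ => factorSwap (g, q)) this
      (continuous_factorSwap.comp (by fun_prop : Continuous fun g : Fˣ => (g, q))).continuousAt
  have hfiber : ∀ {f : Fˣ × Fˣ × Fˣ → ℂ}, Measurable f → (∀ p, ‖f p‖ ≤ b p.1 * H p.2) →
      Integrable (fun q => f (1, q)) (m.prod m) := fun hf hfb =>
    (hH.const_mul (b 1)).mono' (hf.comp measurable_prodMk_left).aestronglyMeasurable
      (ae_of_all _ fun q => hfb (1, q))
  have hi₁ := hfiber hf₁m hb₁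
  have hi₂ := hfiber hfs₂m hb₂
  have hswap₁ := measurePreserving_factorSwap_fiber μ 1
  have hf₂1 : Measurable fun q : Fˣ × Fˣ => f₂ (1, q) := hf₂m.comp measurable_prodMk_left
  have hi₂' : Integrable (fun q => f₂ (1, q)) (m.prod m) := by
    rw [← hswap₁.integrable_comp hf₂1.aestronglyMeasurable]
    exact hi₂
  have hI₂ : ∫ q, f₂ (factorSwap (1, q)) ∂(m.prod m) = ∫ q, f₂ (1, q) ∂(m.prod m) := by
    conv_rhs => rw [← hswap₁.map_eq]
    rw [integral_map hswap₁.aemeasurable hf₂1.aestronglyMeasurable]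
    rfl
  have hcore1 : Integrable (fun q => core ν a c Φ (1, q)) (m.prod m) := by
    refine (hi₁.add hi₂').congr (ae_of_all _ fun q => ?_)
    exact hsum (1, q)
  have hIsum : ∫ q, core ν a c Φ (1, q) ∂(m.prod m) =
      ∫ q, f₁ (1, q) ∂(m.prod m) + ∫ q, f₂ (factorSwap (1, q)) ∂(m.prod m) := by
    rw [hI₂, ← integral_add hi₁ hi₂']
    simp only [hsum]
  -- The common value of both sides is the integral of `core` over the fibre `g = 1`.
  refine ⟨∫ q, core ν a c Φ (1, q) ∂(m.prod m), ?_, ?_⟩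
  · have hθ := measurable_pairSubst (Angle.unit (a 1)) (Angle.unit (a 3))
    have hδ : Measurable fun p : Fˣ × Fˣ => shiftDensity (-p.1 : F) := by fun_prop
    have hδ0 : ∀ p : Fˣ × Fˣ, 0 ≤ shiftDensity (-p.1 : F) := fun p => shiftDensity_nonneg _
    have hL := measurable_leftOuter a c hcont hW hM
    have hlin := lintegral_pairSubst μ (Angle.unit (a 1)) (Angle.unit (a 3))
    have hae : ∀ᵐ p ∂(m.prod m), (shiftDensity (-p.1 : F) : ℂ) * leftOuter ν a c Φ
        (pairSubst (Angle.unit (a 1)) (Angle.unit (a 3)) p) = core ν a c Φ (1, p) := by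
      filter_upwards [hadm] with p hp using shiftDensity_mul_leftOuter h Φ hp
    have hin := left_inner a c hcont hW hM
    refine ⟨ae_of_all _ fun t => (hin t).1, ?_, ?_⟩
    · simp only [fun t => (hin t).2]
      rw [integrable_iff_of_lintegral hθ hδ hδ0 hlin hL]
      exact (integrable_congr hae).mpr hcore1
    · simp only [fun t => (hin t).2]
      rw [integral_eq_of_lintegral hθ hδ hδ0 hlin hL]
      exact integral_congr_ae hae
  · intro ρ hρ
    have hin := fun n => right_inner μ a c hν hcont hW hM (hρ.continuous n)
      (hρ.hasCompactSupport n) (hρ.integrable_fourier n)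
    have hθ := measurable_tripleSubst (Angle.unit (a 0)) (Angle.unit (a 2)) (Angle.unit (a 4))
    have hδ := measurable_tripleDensity (F := F)
    have hlin := lintegral_tripleSubst μ (Angle.unit (a 0)) (Angle.unit (a 2)) (Angle.unit (a 4))
    have hR := fun n => measurable_rightOuter a c hcont hW hM (hρ.continuous n)
    have hT₁ := hρ.tendsto_integral hf₁m hH hb hb₁ hc₁
    have hT₂ := hρ.tendsto_integral hfs₂m hH hb hb₂ hc₂
    have hρm : ∀ n, Measurable (ρ n) := fun n => (hρ.continuous n).measurable
    have hJ₁ : ∀ n, Integrable (fun p => (ρ n p.1 : ℂ) * f₁ p) (m.prod (m.prod m)) := fun n =>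
      integrable_mul_of_fiber_bound (hρ.continuous n) (hρ.hasCompactSupport n) hf₁m hH hb hb₁
    have hJ₂' : ∀ n, Integrable (fun p => (ρ n p.1 : ℂ) * f₂ (factorSwap p))
        (m.prod (m.prod m)) := fun n =>
      integrable_mul_of_fiber_bound (hρ.continuous n) (hρ.hasCompactSupport n) hfs₂m hH hb hb₂
    have hm₂ : ∀ n, Measurable fun p : Fˣ × Fˣ × Fˣ => (ρ n p.1 : ℂ) * f₂ p := fun n => by
      have := hρm n
      fun_prop
    have hJ₂ : ∀ n, Integrable (fun p => (ρ n p.1 : ℂ) * f₂ p) (m.prod (m.prod m)) := fun n => by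
      rw [← hswap.integrable_comp (hm₂ n).aestronglyMeasurable]
      exact hJ₂' n
    have hJswap : ∀ n, ∫ p, (ρ n p.1 : ℂ) * f₂ (factorSwap p) ∂(m.prod (m.prod m)) =
        ∫ p, (ρ n p.1 : ℂ) * f₂ p ∂(m.prod (m.prod m)) := fun n => by
      conv_rhs => rw [← hswap.map_eq]
      rw [integral_map hswap.aemeasurable (hm₂ n).aestronglyMeasurable]
      rfl
    have hdec : ∀ n p, (ρ n p.1 : ℂ) * core ν a c Φ p =
        (ρ n p.1 : ℂ) * f₁ p + (ρ n p.1 : ℂ) * f₂ p := fun n p => by rw [← mul_add, hsum]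
    refine ⟨fun n => ∫ p, (ρ n p.1 : ℂ) * core ν a c Φ p ∂(m.prod (m.prod m)), fun n =>
      ⟨ae_of_all _ fun t => (hin n t).1, ?_, ?_⟩, ?_⟩
    · refine (integrable_congr (ae_of_all _ fun t => (hin n t).2)).mpr ?_
      rw [integrable_iff_of_lintegral hθ hδ tripleDensity_nonneg hlin (hR n)]
      simp only [tripleDensity_mul_rightOuter h, hdec]
      exact (hJ₁ n).add (hJ₂ n)
    · refine (integral_congr_ae (ae_of_all _ fun t => (hin n t).2)).trans ?_
      rw [integral_eq_of_lintegral hθ hδ tripleDensity_nonneg hlin (hR n)]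
      simp only [tripleDensity_mul_rightOuter h]
      rfl
    · have hsplit : ∀ n, ∫ p, (ρ n p.1 : ℂ) * core ν a c Φ p ∂(m.prod (m.prod m)) =
          ∫ p, (ρ n p.1 : ℂ) * f₁ p ∂(m.prod (m.prod m)) +
          ∫ p, (ρ n p.1 : ℂ) * f₂ (factorSwap p) ∂(m.prod (m.prod m)) := fun n => by
        rw [hJswap, ← integral_add (hJ₁ n) (hJ₂ n)]
        simp only [hdec]
      simp only [hsplit, hIsum]
      exact hT₁.add hT₂

end Main

end

end LocalPentagon

theorem theorem4p3 {F : Type*} [NontriviallyNormedField F] [LocallyCompactSpace F]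
    [MeasurableSpace F] [BorelSpace F]
    [MeasurableSpace (PontryaginDual Fˣ)] [BorelSpace (PontryaginDual Fˣ)]
    (μ : Measure F) [μ.IsAddHaarMeasure]
    (ν : Measure (PontryaginDual Fˣ)) [ν.IsHaarMeasure]
    (hν : LocalPentagon.IsDualNormalized (LocalPentagon.unitsHaar μ) ν)
    (a c : Fin 5 → LocalPentagon.Angle F)
    (hpos : ∀ i, LocalPentagon.Angle.Positive (a i) (c i))
    (h₁ : a 3 = a 2 + a 4) (h₂ : c 3 = a 0 + c 4) (h₃ : c 1 = c 0 + a 4)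
    (h₄ : a 1 = a 0 + a 2) (h₅ : c 2 = c 1 + c 3) :
    ∀ Φ : LocalPentagon.GaussianGroup F × LocalPentagon.GaussianGroup F → ℂ,
      LocalPentagon.IsSchwartzBruhat (LocalPentagon.unitsHaar μ) ν Φ →
      ∃ I : ℂ,
        LocalPentagon.PentagonLeft (LocalPentagon.unitsHaar μ) ν a c Φ I ∧
        LocalPentagon.PentagonRight (LocalPentagon.unitsHaar μ) ν a c Φ I := by
  intro Φ hΦ
  exact LocalPentagon.pentagon_relation μ hν ⟨hpos, h₁, h₂, h₃, h₄, h₅⟩ hΦ
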